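/- **Setting.** Let $M\ge 1$, let $\vec N=(N_1,\dots,N_M)$ be positive integers, $|\vec N|=\sum_k N_k$, $X=\{0,\dots,N_1\}\times\cdots\times\{0,\dots,N_M\}$, $|\eta|=\sum_k\eta_k$ for $\eta\in X$, and let $\lambda,\rho,v\in\mathbb R$. Put $$h^+_k(\xi)=\rho+\sum_{j=k}^M(2\xi_j-N_j),\qquad h^-_k(\zeta)=\lambda+\sum_{j=1}^k(2\zeta_j-N_j).$$ Let $\eta^{k,l}$ be $\eta$ after a particle has moved from site $k$ to site $l$. $\mathrm{SSEP}_{\mathsf R}(\vec N,\rho)$ is the particle system on $X$ in which, for $1\le k\le M-1$, a particle jumps from $k$ to $k+1$ and from $k+1$ to $k$ with the respective rates $$\frac{\xi_k(N_{k+1}-\xi_{k+1})(h^+_k-\xi_k)(h^+_{k+1}-\xi_{k+1})}{h^+_{k+1}(h^+_{k+1}+1)},\qquad \frac{\xi_{k+1}(N_k-\xi_k)(h^+_{k+1}+\xi_k)(h^+_{k+2}+\xi_{k+1})}{h^+_{k+1}(h^+_{k+1}-1)}.$$ $\mathrm{SSEP}_{\mathsf L}(\vec N,\lambda)$ is the one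 with respective rates $$\frac{\zeta_k(N_{k+1}-\zeta_{k+1})(h^-_{k-1}+\zeta_k)(h^-_k+\zeta_{k+1})}{h^-_k(h^-_k-1)},\qquad \frac{\zeta_{k+1}(N_k-\zeta_k)(h^-_k-\zeta_k)(h^-_{k+1}-\zeta_{k+1})}{h^-_k(h^-_k+1)}.$$ The generators $L^{\mathsf R}$, $L^{\mathsf L}$ are $Lf(\eta)=\sum_{k=1}^{M-1}\big(c_k^+(\eta)[f(\eta^{k,k+1})-f(\eta)]+c^-_{k+1}(\eta)[f(\eta^{k+1,k})-f(\eta)]\big)$ with these rates. (They are Markov generators when the rates are nonnegative, for example when $|\rho|,|\lambda|>|\vec N|$; nonnegativity is not needed below.) **Duality function.** With $(a)_n=a(a+1)\cdots(a+n-1)$ and the Racah polynomials $$\hat R_n(x;\alpha,\beta,\gamma,\delta)={}_4F_3\!\left({-n,\;n+\alpha+\beta+1,\;-x,\;x+\gamma+\delta+1\atop \alpha+1,\;\beta+\delta+1,\;\gamma+1};1\right),$$ let $$\hat r(y,x;\lambda,\rho,v,N)=\frac{(\frac12(\rho+\lambda-N+v+1))_x(\frac12(\rho+\lambda-N-v+1))_y(y+\frac12(\lambda-\rho-N+v+1))_N}{(-x+\frac12(\lambda-\rho+N+v+1))_{x+y}}\hat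 R_x\big(y;\tfrac12(\rho+\lambda-N-v-1),\tfrac12(\rho-\lambda-N+v-1),-N-1,\lambda\big)$$ and $$\hat R^v(\zeta,\xi)=\prod_{k=1}^M\hat r(\zeta_k,\xi_k;h^-_{k-1}(\zeta),h^+_{k+1}(\xi),v,N_k).$$ **Weights.** Let $$\hat W(x;N,\rho)=(-1)^x\,\frac{2x+\rho-N}{\rho-N}\,\frac{(\rho-N)_x}{(\rho+1)_x(-\rho)_N}\binom Nx,$$ $$\hat W_{\mathsf R}(\xi)=\prod_{k=1}^M\hat W(\xi_k;N_k,h^+_{k+1}(\xi)),\qquad \hat W_{\mathsf L}(\zeta)=\prod_{k=1}^M(-1)^{N_k}\hat W(\zeta_k;N_k,h^-_{k-1}(\zeta)).$$ **The $q$-objects.** For $q>0$, $q\ne1$, put $(a;p)_n=\prod_{i=0}^{n-1}(1-ap^i)$, $\binom nk_p=\frac{(p;p)_n}{(p;p)_k(p;p)_{n-k}}$, $$R_n(x;\alpha,\beta,\gamma,\delta;p)={}_4\varphi_3\!\left({p^{-n},\alpha\beta p^{n+1},p^{-x},\gamma\delta p^{x+1}\atop\alpha p,\beta\delta p,\gamma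 p};p,p\right),$$ where ${}_4\varphi_3\!\left({a_1,\dots,a_4\atop b_1,b_2,b_3};p,z\right)=\sum_{n\ge0}\frac{(a_1;p)_n\cdots(a_4;p)_n}{(b_1;p)_n(b_2;p)_n(b_3;p)_n}\frac{z^n}{(p;p)_n}$, and, for complex $\lambda,\rho,v$ with $v\neq0$, $$r(y,x;\lambda,\rho,v,N;q)=v^y\frac{(-vq^{\rho+\lambda-N+1};q^2)_x(-v^{-1}q^{\rho+\lambda-N+1};q^2)_y(vq^{2y-\rho+\lambda-N+1};q^2)_N}{q^{y(y+\rho+\lambda-N)}(vq^{-2x-\rho+\lambda+N+1};q^2)_{x+y}}\,R_x\big(y;-v^{-1}q^{\rho+\lambda-N-1},vq^{\rho-\lambda-N-1},q^{-2N-2},-q^{2\lambda};q^2\big),$$ $$W(x;N,\rho;q)=\frac{1+q^{4x+2\rho-2N}}{1+q^{2\rho-2N}}\frac{(-q^{2\rho-2N};q^2)_x}{(-q^{2\rho+2};q^2)_x}\frac{q^{-x(2\rho+1+x-2N)}}{(-q^{-2\rho};q^2)_N}\binom Nx_{q^2},$$ $$R^v(\zeta,\xi;\lambda,\rho;q)=\prod_k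 r(\zeta_k,\xi_k;h^-_{k-1}(\zeta),h^+_{k+1}(\xi),v,N_k;q),$$ $$W_{\mathsf R}(\xi;\rho;q)=\prod_kW(\xi_k;N_k,h^+_{k+1}(\xi);q),\qquad W_{\mathsf L}(\zeta;\lambda;q)=\prod_kW(\zeta_k;N_k,h^-_{k-1}(\zeta);q^{-1}).$$ Write $\tilde s=s+\frac{\pi i}{2\ln q}$ for $s\in\{\lambda,\rho\}$. **Proposition.** Assume that no denominator in the formula for $\hat R^v$ vanishes, for any $\zeta,\xi\in X$; that is, for all $\zeta,\xi,k$, with $a=h^-_{k-1}(\zeta)$ and $b=h^+_{k+1}(\xi)$, the numbers $(\frac12(a+b-N_k\pm v+1))_{\min(\zeta_k,\xi_k)}$ and $(-\xi_k+\frac12(a-b+N_k+v+1))_{\xi_k+\zeta_k}$ are nonzero. 1. For all $\zeta,\xi\in X$, $\displaystyle\lim_{q\to1}(1-q^2)^{-|\vec N|}R^{q^v}(\zeta,\xi;\tilde\lambda,\tilde\rho;q)=(-1)^{|\zeta|}\hat R^v(\zeta,\xi)$. 2. If no denominator in the rate of a possible jump of either process vanishes, then $\hat R^v$ is a duality function between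 $\mathrm{SSEP}_{\mathsf L}(\vec N,\lambda)$ and $\mathrm{SSEP}_{\mathsf R}(\vec N,\rho)$: for all $\zeta,\xi\in X$, $$[L^{\mathsf L}\hat R^v(\,\cdot\,,\xi)](\zeta)=[L^{\mathsf R}\hat R^v(\zeta,\,\cdot\,)](\xi).$$ 3. If $\lambda\notin\{-|\vec N|,\dots,|\vec N|\}$, then $\hat W_{\mathsf L}(\zeta)=\lim_{q\to1}(1-q^2)^{|\vec N|}W_{\mathsf L}(\zeta;\tilde\lambda;q)\ne0$ for all $\zeta\in X$, and $\hat W_{\mathsf L}$ is a (signed) reversible measure of $\mathrm{SSEP}_{\mathsf L}(\vec N,\lambda)$, i.e. satisfies detailed balance. If $\rho\notin\{-|\vec N|,\dots,|\vec N|\}$, the same holds for $\hat W_{\mathsf R}$, $W_{\mathsf R}(\,\cdot\,;\tilde\rho;q)$ and $\mathrm{SSEP}_{\mathsf R}(\vec N,\rho)$. 4. If $\lambda,\rho\notin\{-|\vec N|,\dots,|\vec N|\}$ and no denominator in $\hat R^{-v}$ vanishes either, then $$\sum_{\zeta\in X}\hat R^v(\zeta,\xi)\hat R^{-v}(\zeta,\xi')\hat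 W_{\mathsf L}(\zeta)=\frac{\delta_{\xi,\xi'}}{\hat W_{\mathsf R}(\xi)},\qquad \sum_{\xi\in X}\hat R^v(\zeta,\xi)\hat R^{-v}(\zeta',\xi)\hat W_{\mathsf R}(\xi)=\frac{\delta_{\zeta,\zeta'}}{\hat W_{\mathsf L}(\zeta)}.$$ -/

import Mathlib

open scoped Topology BigOperators

namespace DynSSEP

noncomputable section

/-! ### Configurations, height functions and particle jumps

Sites are indexed by `Fin M`; the index `i` stands for the site `k = i + 1` of `{1, …, M}`. -/

/-- The state space `X = {0,…,N₁} × ⋯ × {0,…,N_M}`. -/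
abbrev Config {M : ℕ} (N : Fin M → ℕ) : Type := (k : Fin M) → Fin (N k + 1)

/-- `|N| = N₁ + ⋯ + N_M`. -/
def capacity {M : ℕ} (N : Fin M → ℕ) : ℕ := ∑ k, N k

/-- `|η| = η₁ + ⋯ + η_M`. -/
def particles {M : ℕ} {N : Fin M → ℕ} (η : Config N) : ℕ := ∑ k, (η k : ℕ)

/-- `heightR rho ξ i` is `rho + ∑ (2 ξ_j - N_j)` over all sites with index `≥ i`. With `k = i + 1`
this is `h⁺_k(ξ)`, so that `h⁺_{k+1}(ξ)` is `heightR rho ξ (i + 1)` and `h⁺_{M+1} = rho`. -/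
def heightR {K : Type*} [CommRing K] {M : ℕ} {N : Fin M → ℕ} (rho : K) (ξ : Config N) (i : ℕ) : K :=
  rho + ∑ j : Fin M, if i ≤ (j : ℕ) then 2 * ((ξ j : ℕ) : K) - (N j : K) else 0

/-- `heightL lam ζ i` is `lam + ∑ (2 ζ_j - N_j)` over the first `i` sites, that is `h⁻_i(ζ)`.
For the site `k = i + 1` of index `i`, `h⁻_{k-1}(ζ)` is `heightL lam ζ i` and `h⁻_k(ζ)` is
`heightL lam ζ (i + 1)`. -/
def heightL {K : Type*} [CommRing K] {M : ℕ} {N : Fin M → ℕ} (lam : K) (ζ : Config N) (i : ℕ) : K :=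
  lam + ∑ j : Fin M, if (j : ℕ) < i then 2 * ((ζ j : ℕ) : K) - (N j : K) else 0

/-- The configuration after a particle has jumped from site `i` to site `j` (unchanged if site `i`
is empty or site `j` is full; such jumps have rate zero). -/
def jump {M : ℕ} {N : Fin M → ℕ} (η : Config N) (i j : Fin M) : Config N :=
  if h : 0 < (η i : ℕ) ∧ (η j : ℕ) < N j then
    Function.update
      (Function.update η i ⟨(η i : ℕ) - 1, lt_of_le_of_lt (Nat.sub_le _ _) (η i).isLt⟩)
      j ⟨(η j : ℕ) + 1, Nat.succ_lt_succ h.2⟩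
  else η

/-! ### The processes -/

/-- Right process, `j` the right neighbour of `i`: rate of a jump from `i` to `j`. -/
def rateRRight {M : ℕ} {N : Fin M → ℕ} (rho : ℝ) (ξ : Config N) (i j : Fin M) : ℝ :=
  ((ξ i : ℕ) : ℝ) * ((N j : ℝ) - ((ξ j : ℕ) : ℝ))
      * (heightR rho ξ i - ((ξ i : ℕ) : ℝ)) * (heightR rho ξ j - ((ξ j : ℕ) : ℝ))
    / (heightR rho ξ j * (heightR rho ξ j + 1))

/-- Right process, `j` the right neighbour of `i`: rate of a jump from `j` to `i`. -/
def rateRLeft {M : ℕ} {N : Fin M → ℕ} (rho : ℝ) (ξ : Config N) (i j : Fin M) : ℝ :=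
  ((ξ j : ℕ) : ℝ) * ((N i : ℝ) - ((ξ i : ℕ) : ℝ))
      * (heightR rho ξ j + ((ξ i : ℕ) : ℝ)) * (heightR rho ξ (j + 1) + ((ξ j : ℕ) : ℝ))
    / (heightR rho ξ j * (heightR rho ξ j - 1))

/-- Left process, `j` the right neighbour of `i`: rate of a jump from `i` to `j`. -/
def rateLRight {M : ℕ} {N : Fin M → ℕ} (lam : ℝ) (ζ : Config N) (i j : Fin M) : ℝ :=
  ((ζ i : ℕ) : ℝ) * ((N j : ℝ) - ((ζ j : ℕ) : ℝ))
      * (heightL lam ζ i + ((ζ i : ℕ) : ℝ)) * (heightL lam ζ (i + 1) + ((ζ j : ℕ) : ℝ))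
    / (heightL lam ζ (i + 1) * (heightL lam ζ (i + 1) - 1))

/-- Left process, `j` the right neighbour of `i`: rate of a jump from `j` to `i`. -/
def rateLLeft {M : ℕ} {N : Fin M → ℕ} (lam : ℝ) (ζ : Config N) (i j : Fin M) : ℝ :=
  ((ζ j : ℕ) : ℝ) * ((N i : ℝ) - ((ζ i : ℕ) : ℝ))
      * (heightL lam ζ j - ((ζ i : ℕ) : ℝ)) * (heightL lam ζ (j + 1) - ((ζ j : ℕ) : ℝ))
    / (heightL lam ζ j * (heightL lam ζ j + 1))

/-- The Markov generator of a nearest neighbour particle system: the sum over all pairs of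
neighbouring sites `(i, j)`, `j = i + 1`, with `cR η i j` the rate of a jump from `i` to `j` and
`cL η i j` the rate of a jump from `j` to `i`. -/
def generator {M : ℕ} {N : Fin M → ℕ} (cR cL : Config N → Fin M → Fin M → ℝ)
    (f : Config N → ℝ) (η : Config N) : ℝ :=
  ∑ i : Fin M, ∑ j : Fin M,
    if (i : ℕ) + 1 = (j : ℕ) then
      cR η i j * (f (jump η i j) - f η) + cL η i j * (f (jump η j i) - f η)
    else 0

/-- Generator of the dynamic symmetric exclusion process with right boundary value `rho`. -/
def generatorR {M : ℕ} (N : Fin M → ℕ) (rho : ℝ) : (Config N → ℝ) → Config N → ℝ :=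
  generator (rateRRight rho) (rateRLeft rho)

/-- Generator of the dynamic symmetric exclusion process with left boundary value `lam`. -/
def generatorL {M : ℕ} (N : Fin M → ℕ) (lam : ℝ) : (Config N → ℝ) → Config N → ℝ :=
  generator (rateLRight lam) (rateLLeft lam)

/-- The rates of the right process are well defined: no denominator of a possible jump vanishes. -/
def RatesDefinedR {M : ℕ} (N : Fin M → ℕ) (rho : ℝ) : Prop :=
  ∀ (ξ : Config N) (i j : Fin M), (i : ℕ) + 1 = (j : ℕ) →
    (0 < (ξ i : ℕ) → (ξ j : ℕ) < N j → heightR rho ξ j * (heightR rho ξ j + 1) ≠ 0) ∧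
    (0 < (ξ j : ℕ) → (ξ i : ℕ) < N i → heightR rho ξ j * (heightR rho ξ j - 1) ≠ 0)

/-- The rates of the left process are well defined: no denominator of a possible jump vanishes. -/
def RatesDefinedL {M : ℕ} (N : Fin M → ℕ) (lam : ℝ) : Prop :=
  ∀ (ζ : Config N) (i j : Fin M), (i : ℕ) + 1 = (j : ℕ) →
    (0 < (ζ i : ℕ) → (ζ j : ℕ) < N j →
      heightL lam ζ (i + 1) * (heightL lam ζ (i + 1) - 1) ≠ 0) ∧
    (0 < (ζ j : ℕ) → (ζ i : ℕ) < N i → heightL lam ζ j * (heightL lam ζ j + 1) ≠ 0)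

/-- Markov duality of (the processes with generators) `L` and `L'` with duality function `D`. -/
def IsDuality {A B : Type*} (L : (A → ℝ) → A → ℝ) (L' : (B → ℝ) → B → ℝ) (D : A → B → ℝ) : Prop :=
  ∀ (a : A) (b : B), L (fun a' => D a' b) a = L' (fun b' => D a b') b

/-- Detailed balance `μ(a) L(a,b) = μ(b) L(b,a)`, where `L(a,b) = (L δ_b)(a)` is, for `a ≠ b`, the
jump rate from `a` to `b`. -/
def IsReversible {A : Type*} [DecidableEq A] (L : (A → ℝ) → A → ℝ) (μ : A → ℝ) : Prop :=
  ∀ a b : A, μ a * L (Pi.single b 1) a = μ b * L (Pi.single a 1) b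

/-! ### Hypergeometric series and Racah polynomials -/

/-- The shifted factorial `(a)_n = a (a+1) ⋯ (a+n-1)`. -/
def poch (a : ℝ) (n : ℕ) : ℝ := ∏ i ∈ Finset.range n, (a + i)

/-- The hypergeometric series with upper parameters `as` and lower parameters `bs`. In a terminating
series a term in which an upper and a lower factor vanish together counts as zero. -/
def hyper (as bs : List ℝ) (z : ℝ) : ℝ :=
  ∑' n : ℕ, (as.map fun a => poch a n).prod / (bs.map fun b => poch b n).prod
    * (z ^ n / (n.factorial : ℝ))

/-- The Racah polynomial `R_n(x; α, β, γ, δ)`. -/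
def racah (n x : ℕ) (α β γ δ : ℝ) : ℝ :=
  hyper [-(n : ℝ), n + α + β + 1, -(x : ℝ), x + γ + δ + 1] [α + 1, β + δ + 1, γ + 1] 1

/-- The one-site duality function `r̂(y, x; lam, rho, v, N)`. -/
def siteDuality (y x : ℕ) (lam rho v : ℝ) (N : ℕ) : ℝ :=
  poch ((rho + lam - N + v + 1) / 2) x * poch ((rho + lam - N - v + 1) / 2) y
      * poch (y + (lam - rho - N + v + 1) / 2) N
    / poch (-(x : ℝ) + (lam - rho + N + v + 1) / 2) (x + y)
    * racah x y ((rho + lam - N - v - 1) / 2) ((rho - lam - N + v - 1) / 2) (-(N : ℝ) - 1) lam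

/-- The duality function `R̂^v(ζ, ξ)`, a doubly nested product. -/
def duality {M : ℕ} {N : Fin M → ℕ} (lam rho v : ℝ) (ζ ξ : Config N) : ℝ :=
  ∏ k : Fin M, siteDuality (ζ k) (ξ k) (heightL lam ζ k) (heightR rho ξ (k + 1)) v (N k)

/-- No denominator in the formula for `R̂^v` vanishes. (The lower parameter `-N_k` of the Racah
polynomial causes no zero, since the series stops after the index `min ζ_k ξ_k ≤ N_k`.) -/
def DualityDefined {M : ℕ} (N : Fin M → ℕ) (lam rho v : ℝ) : Prop :=
  ∀ (ζ ξ : Config N) (k : Fin M),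
    poch ((heightR rho ξ (k + 1) + heightL lam ζ k - N k - v + 1) / 2) (min (ζ k : ℕ) (ξ k)) ≠ 0 ∧
    poch ((heightR rho ξ (k + 1) + heightL lam ζ k - N k + v + 1) / 2) (min (ζ k : ℕ) (ξ k)) ≠ 0 ∧
    poch (-((ξ k : ℕ) : ℝ) + (heightL lam ζ k - heightR rho ξ (k + 1) + N k + v + 1) / 2)
      ((ξ k : ℕ) + ζ k) ≠ 0

/-! ### Reversible weights -/

/-- The one-site weight `Ŵ(x; N, rho)`. -/
def siteWeight (x N : ℕ) (rho : ℝ) : ℝ :=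
  (-1) ^ x * ((2 * x + rho - N) / (rho - N))
    * (poch (rho - N) x / (poch (rho + 1) x * poch (-rho) N)) * (N.choose x : ℝ)

/-- The weight `Ŵ_R(ξ; N, rho)`. -/
def weightR {M : ℕ} {N : Fin M → ℕ} (rho : ℝ) (ξ : Config N) : ℝ :=
  ∏ k : Fin M, siteWeight (ξ k) (N k) (heightR rho ξ (k + 1))

/-- The weight `Ŵ_L(ζ; N, lam)`. -/
def weightL {M : ℕ} {N : Fin M → ℕ} (lam : ℝ) (ζ : Config N) : ℝ :=
  ∏ k : Fin M, (-1) ^ (N k) * siteWeight (ζ k) (N k) (heightL lam ζ k)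

/-- `s` is none of the integers `-|N|, …, |N|`. When all `N_k` are positive, this says exactly that
no denominator occurs as zero in the weights with boundary value `s`. -/
def WeightDefined {M : ℕ} (N : Fin M → ℕ) (s : ℝ) : Prop :=
  ∀ m : ℤ, |m| ≤ (capacity N : ℤ) → s ≠ (m : ℝ)

/-! ### The objects with parameter `q` (dynamic asymmetric exclusion) -/

/-- `q^z` for real `q > 0` and complex `z`. -/
def qpow (q : ℝ) (z : ℂ) : ℂ := (q : ℂ) ^ z

/-- The `p`-shifted factorial `(a; p)_n`. -/
def qpoch (a p : ℂ) (n : ℕ) : ℂ := ∏ i ∈ Finset.range n, (1 - a * p ^ i)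

/-- The `p`-binomial coefficient. -/
def qbinom (p : ℂ) (n k : ℕ) : ℂ := qpoch p p n / (qpoch p p k * qpoch p p (n - k))

/-- The basic hypergeometric series (one more upper than lower parameter) to base `p`. -/
def qhyper (as bs : List ℂ) (p z : ℂ) : ℂ :=
  ∑' n : ℕ, (as.map fun a => qpoch a p n).prod / (bs.map fun b => qpoch b p n).prod
    * (z ^ n / qpoch p p n)

/-- The `p`-Racah polynomial `R_n(x; α, β, γ, δ; p)`. -/
def qRacah (n x : ℕ) (α β γ δ p : ℂ) : ℂ :=
  qhyper [(p ^ n)⁻¹, α * β * p ^ (n + 1), (p ^ x)⁻¹, γ * δ * p ^ (x + 1)]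
    [α * p, β * δ * p, γ * p] p p

/-- The one-site duality function `r(y, x; lam, rho, v, N; q)`. -/
def qSiteDuality (y x : ℕ) (lam rho v : ℂ) (N : ℕ) (q : ℝ) : ℂ :=
  v ^ y * (qpoch (-v * qpow q (rho + lam - N + 1)) ((q : ℂ) ^ 2) x
      * qpoch (-v⁻¹ * qpow q (rho + lam - N + 1)) ((q : ℂ) ^ 2) y
      * qpoch (v * qpow q (2 * y - rho + lam - N + 1)) ((q : ℂ) ^ 2) N)
    / (qpow q (y * (y + rho + lam - N))
      * qpoch (v * qpow q (-2 * x - rho + lam + N + 1)) ((q : ℂ) ^ 2) (x + y))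
    * qRacah x y (-v⁻¹ * qpow q (rho + lam - N - 1)) (v * qpow q (rho - lam - N - 1))
        (qpow q (-2 * N - 2)) (-qpow q (2 * lam)) ((q : ℂ) ^ 2)

/-- The duality function `R^v(ζ, ξ; lam, rho, N; q)`. -/
def qDuality {M : ℕ} {N : Fin M → ℕ} (lam rho v : ℂ) (q : ℝ) (ζ ξ : Config N) : ℂ :=
  ∏ k : Fin M, qSiteDuality (ζ k) (ξ k) (heightL lam ζ k) (heightR rho ξ (k + 1)) v (N k) q

/-- The one-site weight `W(x; N, rho; q)`. -/
def qSiteWeight (x N : ℕ) (rho : ℂ) (q : ℝ) : ℂ :=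
  (1 + qpow q (4 * x + 2 * rho - 2 * N)) / (1 + qpow q (2 * rho - 2 * N))
    * (qpoch (-qpow q (2 * rho - 2 * N)) ((q : ℂ) ^ 2) x
      / qpoch (-qpow q (2 * rho + 2)) ((q : ℂ) ^ 2) x)
    * (qpow q (-x * (2 * rho + 1 + x - 2 * N)) / qpoch (-qpow q (-2 * rho)) ((q : ℂ) ^ 2) N)
    * qbinom ((q : ℂ) ^ 2) N x

/-- The weight `W_R(ξ; N, rho; q)`. -/
def qWeightR {M : ℕ} {N : Fin M → ℕ} (rho : ℂ) (q : ℝ) (ξ : Config N) : ℂ :=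
  ∏ k : Fin M, qSiteWeight (ξ k) (N k) (heightR rho ξ (k + 1)) q

/-- The weight `W_L(ζ; N, lam; q)`; its one-site weights have the parameter `q⁻¹`. -/
def qWeightL {M : ℕ} {N : Fin M → ℕ} (lam : ℂ) (q : ℝ) (ζ : Config N) : ℂ :=
  ∏ k : Fin M, qSiteWeight (ζ k) (N k) (heightL lam ζ k) q⁻¹

/-- The shifted boundary value `s + π i / (2 log q)`, for which `q^(2 s)` becomes `-q^(2 s)`. -/
def shift (q s : ℝ) : ℂ := (s : ℂ) + Complex.I * (Real.pi : ℂ) / (2 * (Real.log q : ℂ))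

end

end DynSSEP

open DynSSEP

namespace DynSSEP

/-! ### Shifted factorials -/

/-! All algebraic claims are first proved for generic parameters (`Generic`), where no denominator
can vanish. They are then extended by continuity: the parameters move along a line through the given
point that is generic at all nearby points except possibly the point itself, and both sides of each
identity are continuous there (`eventually_generic`, `eq_of_eventuallyEq_punctured`). The hypotheses
of the theorem are what this continuity needs.

Duality rests on fusion. A site with `N + 1` places can be split into one with `N` places and one
with a single place. The contiguous relations `siteDuality_splitR_zero`, `siteDuality_splitR_one`,
`siteDuality_splitL_zero` and `siteDuality_splitL_one` say that the one-site duality function is the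
average, over the occupation of the split-off place, of a product of two smaller duality functions.
The weights of the average are `splitR` or `splitL`, and each depends on one process only. The
exchange operators of a bond are compatible with the same averages (`bondL_split_right`,
`bondL_split_left` and their right analogues). Hence the two-site relation `BondDuality` follows
from the case of one place per site, a finite check. In the full system a jump across a bond changes
only the two factors at its ends, because all heights except the one between these sites are
preserved. The generator identity is therefore a sum of two-site identities (`duality_exchanged`,
`isDuality_of_generic`).

Orthogonality on one site is an induction on `N`. Summation by parts against the weight lowers `N`,
the splitting relations express the resulting difference through parameters `rho - 1` and `rho + 1`,
and the mixed products cancel (`siteDuality_orthogonal`). Several sites are handled by peeling off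
the leftmost one. The second biorthogonality relation follows from the first because a one-sided
inverse of a square matrix is two-sided. Detailed balance reduces to one identity for two
neighbouring sites, `siteWeight_pair_balance`, which serves both processes by reflection.

The limits in `q` are taken factor by factor from `(1 - q^a) / (1 - q^2) → a / 2`. The imaginary
shift turns each `1 + q^a` into `1 - q^a`, and the power of `1 - q^2` counts the unbalanced factors.
-/

@[simp] lemma poch_zero (a : ℝ) : poch a 0 = 1 := by simp [poch]

@[simp] lemma poch_one (a : ℝ) : poch a 1 = a := by simp [poch]

lemma poch_succ (a : ℝ) (n : ℕ) : poch a (n + 1) = poch a n * (a + n) := by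
  simp [poch, Finset.prod_range_succ]

lemma poch_succ_left (a : ℝ) (n : ℕ) : poch a (n + 1) = a * poch (a + 1) n := by
  simp only [poch, Finset.prod_range_succ']
  rw [mul_comm]
  congr 1
  · simp
  · refine Finset.prod_congr rfl fun i _ => ?_
    push_cast; ring

lemma mul_poch_add_one (a : ℝ) (n : ℕ) : a * poch (a + 1) n = poch a n * (a + n) := by
  rw [← poch_succ_left, poch_succ]

lemma poch_ne_zero {a : ℝ} {n : ℕ} (h : ∀ i < n, a + i ≠ 0) : poch a n ≠ 0 :=
  Finset.prod_ne_zero_iff.2 fun i hi => h i (Finset.mem_range.1 hi)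

lemma poch_neg_eq_zero {x n : ℕ} (h : x < n) : poch (-(x : ℝ)) n = 0 :=
  Finset.prod_eq_zero (Finset.mem_range.2 h) (by simp)

lemma poch_neg_ne_zero {x n : ℕ} (h : n ≤ x) : poch (-(x : ℝ)) n ≠ 0 := by
  refine poch_ne_zero fun i hi => ?_
  have : (i : ℝ) < x := by exact_mod_cast lt_of_lt_of_le hi h
  linarith

/-- No integer occurs among the six linear forms in the parameters that control all
denominators. -/
structure Generic (lam rho v : ℝ) : Prop where
  lam_ne : ∀ m : ℤ, lam ≠ m
  rho_ne : ∀ m : ℤ, rho ≠ m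
  sum_add_ne : ∀ m : ℤ, rho + lam + v ≠ m
  sum_sub_ne : ∀ m : ℤ, rho + lam - v ≠ m
  diff_add_ne : ∀ m : ℤ, lam - rho + v ≠ m
  diff_sub_ne : ∀ m : ℤ, lam - rho - v ≠ m

/-- Heights differ from the boundary values by integers, so this carries genericity to every site.
-/
lemma Generic.shift {lam rho v lam' rho' : ℝ} (h : Generic lam rho v) (m n : ℤ)
    (hm : lam' = lam + m) (hn : rho' = rho + n) : Generic lam' rho' v := by
  subst hm hn
  constructor
  · intro k hk; exact h.lam_ne (k - m) (by push_cast; linarith)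
  · intro k hk; exact h.rho_ne (k - n) (by push_cast; linarith)
  · intro k hk; exact h.sum_add_ne (k - m - n) (by push_cast; linarith)
  · intro k hk; exact h.sum_sub_ne (k - m - n) (by push_cast; linarith)
  · intro k hk; exact h.diff_add_ne (k - m + n) (by push_cast; linarith)
  · intro k hk; exact h.diff_sub_ne (k - m + n) (by push_cast; linarith)

lemma Generic.neg {lam rho v : ℝ} (h : Generic lam rho v) : Generic lam rho (-v) where
  lam_ne := h.lam_ne
  rho_ne := h.rho_ne
  sum_add_ne m hm := h.sum_sub_ne m (by linarith)
  sum_sub_ne m hm := h.sum_add_ne m (by linarith)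
  diff_add_ne m hm := h.diff_sub_ne m (by linarith)
  diff_sub_ne m hm := h.diff_add_ne m (by linarith)

lemma poch_half_ne_zero {a b : ℝ} (h : ∀ m : ℤ, a ≠ m) (k : ℤ) (hb : b = (a + k) / 2) (n : ℕ) :
    poch b n ≠ 0 := by
  refine poch_ne_zero fun i _ hi => h (-k - 2 * i) ?_
  push_cast; linarith

lemma poch_int_ne_zero {a b : ℝ} (h : ∀ m : ℤ, a ≠ m) (k : ℤ) (hb : b = a + k) (n : ℕ) :
    poch b n ≠ 0 := by
  refine poch_ne_zero fun i _ hi => h (-k - i) ?_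
  push_cast; linarith

/-! ### Terms of the hypergeometric series -/

/-- The `n`-th term of a `₄F₃` at `1`. -/
noncomputable def serTerm (X σ s t A B D : ℝ) (n : ℕ) : ℝ :=
  poch X n * poch σ n * poch s n * poch t n / (poch A n * poch B n * poch D n) / (n.factorial : ℝ)

lemma serTerm_swap (X σ s t A B D : ℝ) (n : ℕ) :
    serTerm X σ s t A B D n = serTerm X σ t s A B D n := by
  simp only [serTerm]; ring

/-- Beyond `min n x` a factor of the numerator vanishes. The free bound `m` allows series that stop
at different indices to be compared over a common range. -/
lemma racah_eq_sum {n x m : ℕ} (h : min n x < m) (α β γ δ : ℝ) :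
    racah n x α β γ δ = ∑ k ∈ Finset.range m,
      serTerm (-(n : ℝ)) (n + α + β + 1) (-(x : ℝ)) (x + γ + δ + 1) (α + 1) (β + δ + 1) (γ + 1) k := by
  rw [racah, hyper, tsum_eq_sum (s := Finset.range m)]
  · refine Finset.sum_congr rfl fun k _ => ?_
    simp only [List.map_cons, List.map_nil, List.prod_cons, List.prod_nil, serTerm, one_pow]
    ring
  · intro k hk
    rw [Finset.mem_range, not_lt] at hk
    have : poch (-(n : ℝ)) k = 0 ∨ poch (-(x : ℝ)) k = 0 := by
      rcases lt_or_ge n k with h1 | h1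
      · exact Or.inl (poch_neg_eq_zero h1)
      · exact Or.inr (poch_neg_eq_zero (by omega))
    rcases this with h | h <;> simp [h]

/-- The factor of `siteDuality` in front of the Racah polynomial. -/
noncomputable def prefactor (y x : ℕ) (lam rho v : ℝ) (N : ℕ) : ℝ :=
  poch ((rho + lam - N + v + 1) / 2) x * poch ((rho + lam - N - v + 1) / 2) y
      * poch (y + (lam - rho - N + v + 1) / 2) N
    / poch (-(x : ℝ) + (lam - rho + N + v + 1) / 2) (x + y)

/-- In this form the series is visibly symmetric under exchanging `(x, rho)` with `(y, lam)` and
under `v ↦ -v`; only the prefactor breaks these symmetries. -/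
lemma siteDuality_eq_sum {y x m : ℕ} (h : min x y < m) (lam rho v : ℝ) (N : ℕ) :
    siteDuality y x lam rho v N = prefactor y x lam rho v N * ∑ n ∈ Finset.range m,
      serTerm (-(x : ℝ)) (x + rho - N) (-(y : ℝ)) (y + lam - N)
        ((rho + lam - N + v + 1) / 2) ((rho + lam - N - v + 1) / 2) (-(N : ℝ)) n := by
  rw [siteDuality, racah_eq_sum h, prefactor]
  congr 1
  refine Finset.sum_congr rfl fun k _ => ?_
  have e1 : (x : ℝ) + (rho + lam - N - v - 1) / 2 + (rho - lam - N + v - 1) / 2 + 1 = x + rho - N := by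
    ring
  have e2 : (y : ℝ) + (-(N : ℝ) - 1) + lam + 1 = y + lam - N := by ring
  have e3 : (rho + lam - N - v - 1) / 2 + 1 = (rho + lam - N - v + 1) / 2 := by ring
  have e4 : (rho - lam - N + v - 1) / 2 + lam + 1 = (rho + lam - N + v + 1) / 2 := by ring
  have e5 : -(N : ℝ) - 1 + 1 = -N := by ring
  rw [e1, e2, e3, e4, e5]
  simp only [serTerm]; ring

/-! ### Contiguous relations for terms -/

/-- The telescoping certificate of `serTerm_telescope`. -/
noncomputable def certTerm (X σ s t A B D ρ : ℝ) (n : ℕ) : ℝ :=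
  D * n * (ρ + t + n) / t * serTerm X σ s t A B D n

/-- A contiguous relation for balanced series: the last two hypotheses give `X + σ + s + t + 1 = A +
B + D`. It does not hold term by term, but the defect is a difference of consecutive values of a
certificate. With all shifted factorials reduced to the unshifted ones, a rational identity remains.
-/
lemma serTerm_telescope {X σ s t A B D ρ : ℝ} {n : ℕ} (hA : poch A (n + 1) ≠ 0)
    (hB : poch B (n + 1) ≠ 0) (hD : poch D (n + 1) ≠ 0) (ht : t ≠ 0)
    (hAB : A + B = ρ + s + t + 1) (hσ : σ = ρ + D - X) :
    -ρ * D * serTerm X σ s t A B D n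
      = (ρ - X) * (X - D) * serTerm X σ s (t + 1) A B (D + 1) n
        - X * σ * ((A - s) * (B - s) / (A * B))
          * serTerm (X + 1) (σ + 1) s (t + 1) (A + 1) (B + 1) (D + 1) n
        + (certTerm X σ s t A B D ρ n - certTerm X σ s t A B D ρ (n + 1)) := by
  have hA0 : A ≠ 0 := fun h => hA (by rw [poch_succ_left, h, zero_mul])
  have hB0 : B ≠ 0 := fun h => hB (by rw [poch_succ_left, h, zero_mul])
  have hD0 : D ≠ 0 := fun h => hD (by rw [poch_succ_left, h, zero_mul])
  have hXX := mul_poch_add_one X n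
  have hSS := mul_poch_add_one σ n
  have hTT : poch (t + 1) n = poch t n * (t + n) / t := by
    rw [← mul_poch_add_one]; field_simp
  have hAA : poch (A + 1) n = poch A n * (A + n) / A := by
    rw [← mul_poch_add_one]; field_simp
  have hBB : poch (B + 1) n = poch B n * (B + n) / B := by
    rw [← mul_poch_add_one]; field_simp
  have hDD : poch (D + 1) n = poch D n * (D + n) / D := by
    rw [← mul_poch_add_one]; field_simp
  rw [poch_succ] at hA hB hD
  -- `X` and `σ` may be zero, so the factorials based at `X + 1` and `σ + 1` are not solved for; the
  -- prefactor `X * σ` is absorbed into them instead.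
  have h3 : X * σ * ((A - s) * (B - s) / (A * B))
          * serTerm (X + 1) (σ + 1) s (t + 1) (A + 1) (B + 1) (D + 1) n
      = ((A - s) * (B - s) / (A * B)) * ((poch X n * (X + n)) * (poch σ n * (σ + n)) * poch s n
         * poch (t + 1) n / (poch (A + 1) n * poch (B + 1) n * poch (D + 1) n) / n.factorial) := by
    rw [← hXX, ← hSS, serTerm]; ring
  rw [h3]
  simp only [serTerm, certTerm, poch_succ, hTT, hAA, hBB, hDD, Nat.factorial_succ]
  have hn : ((n : ℝ) + 1) ≠ 0 := by positivity
  have hf : (n.factorial : ℝ) ≠ 0 := by positivity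
  obtain ⟨a1, a2⟩ := mul_ne_zero_iff.1 hA
  obtain ⟨b1, b2⟩ := mul_ne_zero_iff.1 hB
  obtain ⟨d1, d2⟩ := mul_ne_zero_iff.1 hD
  obtain rfl : ρ = A + B - s - t - 1 := by linarith
  subst hσ
  push_cast
  field_simp
  ring

/-- This one holds term by term, from `-(t - s) * (D + n) = (s - D) * (t + n) - (t - D) * (s + n)`.
-/
lemma serTerm_lower_split {X σ s t A B D : ℝ} {n : ℕ} (hD : poch D (n + 1) ≠ 0) :
    -D * (t - s) * serTerm X σ s t A B D n
      = (s - D) * t * serTerm X σ s (t + 1) A B (D + 1) n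
        - s * (t - D) * serTerm X σ (s + 1) t A B (D + 1) n := by
  have hD0 : D ≠ 0 := fun h => hD (by rw [poch_succ_left, h, zero_mul])
  have hDD : poch (D + 1) n = poch D n * (D + n) / D := by
    rw [← mul_poch_add_one]; field_simp
  rw [poch_succ] at hD
  obtain ⟨d1, d2⟩ := mul_ne_zero_iff.1 hD
  have h1 : (s - D) * t * serTerm X σ s (t + 1) A B (D + 1) n = (s - D) * (poch X n * poch σ n * poch s n
      * (poch t n * (t + n)) / (poch A n * poch B n * poch (D + 1) n) / (n.factorial : ℝ)) := by
    rw [← mul_poch_add_one, serTerm]; ring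
  have h2 : s * (t - D) * serTerm X σ (s + 1) t A B (D + 1) n = (t - D) * (poch X n * poch σ n
      * (poch s n * (s + n)) * poch t n / (poch A n * poch B n * poch (D + 1) n)
        / (n.factorial : ℝ)) := by
    rw [← mul_poch_add_one, serTerm]; ring
  rw [h1, h2, hDD, serTerm]
  generalize poch A n = a
  generalize poch B n = b
  -- The factorials of `A` and `B` are not assumed nonzero, so they are isolated as a common inverse
  -- before denominators are cleared.
  have e : ∀ z w : ℝ, z / (a * b * w) / (n.factorial : ℝ) = z / w * (a * b)⁻¹ * (n.factorial : ℝ)⁻¹ := by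
    intro z w; simp only [div_eq_mul_inv, mul_inv]; ring
  rw [e, e, e]
  field_simp
  ring

/-! ### One particle per site -/

section unitSite
variable {lam rho v : ℝ}

/-- For a single place the four values are linear in the parameters. They enter the splitting
relations as coefficients, and they are the data of the two-site base case. -/
lemma siteDuality_unit_zero_zero (lam rho v : ℝ) :
    siteDuality 0 0 lam rho v 1 = (v + lam - rho) / 2 := by
  rw [siteDuality_eq_sum (m := 1) (by simp)]
  simp [prefactor, serTerm]
  ring

lemma siteDuality_unit_zero_one (hg : Generic lam rho v) :
    siteDuality 0 1 lam rho v 1 = (v + lam + rho) / 2 := by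
  rw [siteDuality_eq_sum (m := 1) (by simp)]
  have := hg.diff_add_ne 0
  have h : lam - rho + v ≠ 0 := by simpa using this
  have h' : -1 + (lam - rho + 1 + v + 1) / 2 ≠ 0 := by intro h0; apply h; linarith
  have h2 : (lam - rho - 1 + v + 1) / 2 = -1 + (lam - rho + 1 + v + 1) / 2 := by ring
  simp [prefactor, serTerm, h2]
  rw [mul_div_assoc, div_self h']
  ring

lemma siteDuality_unit_one_zero (hg : Generic lam rho v) :
    siteDuality 1 0 lam rho v 1 = (lam + rho - v) / 2 := by
  rw [siteDuality_eq_sum (m := 1) (by simp)]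
  have := hg.diff_add_ne (-2)
  have h : lam - rho + v ≠ -2 := by simpa using this
  have h' : (lam - rho + 1 + v + 1) / 2 ≠ 0 := by intro h0; apply h; linarith
  have h2 : 1 + (lam - rho - 1 + v + 1) / 2 = (lam - rho + 1 + v + 1) / 2 := by ring
  simp [prefactor, serTerm, h2]
  rw [mul_div_assoc, div_self h']
  ring

lemma siteDuality_unit_one_one (hg : Generic lam rho v) :
    siteDuality 1 1 lam rho v 1 = (lam - rho - v) / 2 := by
  rw [siteDuality_eq_sum (m := 2) (by simp)]
  have h : lam - rho + v ≠ 0 := by simpa using hg.diff_add_ne 0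
  have h1 : lam - rho + v ≠ -2 := by simpa using hg.diff_add_ne (-2)
  have hA : rho + lam + v ≠ 0 := by simpa using hg.sum_add_ne 0
  have hB : rho + lam - v ≠ 0 := by simpa using hg.sum_sub_ne 0
  have e1 : (rho + lam - (1 : ℕ) + v + 1) / 2 = (rho + lam + v) / 2 := by push_cast; ring
  have e2 : (rho + lam - (1 : ℕ) - v + 1) / 2 = (rho + lam - v) / 2 := by push_cast; ring
  have e3 : -((1 : ℕ) : ℝ) + (lam - rho + (1 : ℕ) + v + 1) / 2 = (lam - rho + v) / 2 := by
    push_cast; ring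
  have e4 : ((1 : ℕ) : ℝ) + (lam - rho - (1 : ℕ) + v + 1) / 2 = (lam - rho + v + 2) / 2 := by
    push_cast; ring
  have h1' : lam - rho + v + 2 ≠ 0 := by intro h0; apply h1; linarith
  rw [prefactor, e1, e2, e3, e4]
  simp only [Finset.sum_range_succ, Finset.sum_range_zero, serTerm, poch_succ, poch_zero]
  norm_num
  have h1'' : (lam - rho + v) / 2 + 1 ≠ 0 := by intro h0; apply h1; linarith
  field_simp
  ring

end unitSite

/-! ### Prefactors -/

section prefactors
variable {lam rho v : ℝ}

/-- A one-place value is exactly the quotient of two prefactors here, so a splitting relation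
becomes a relation between the bare series. -/
lemma prefactor_split_zero_zero (y x N : ℕ) (lam rho v : ℝ) :
    prefactor y x lam rho v (N + 1)
      = prefactor y x lam (rho - 1) v N * ((v + (lam + 2 * y - N) - rho) / 2) := by
  simp only [prefactor]
  push_cast
  rw [poch_succ_left (y + (lam - rho - (N + 1) + v + 1) / 2) N,
    show rho + lam - (N + 1 : ℝ) + v + 1 = rho - 1 + lam - N + v + 1 by ring,
    show rho + lam - (N + 1 : ℝ) - v + 1 = rho - 1 + lam - N - v + 1 by ring,
    show y + (lam - rho - (N + 1) + v + 1) / 2 + 1 = y + (lam - (rho - 1) - N + v + 1) / 2 by ring,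
    show lam - rho + (N + 1 : ℝ) + v + 1 = lam - (rho - 1) + N + v + 1 by ring]
  ring

lemma prefactor_split_one_zero (y x N : ℕ) (hg : Generic lam rho v) :
    prefactor (y + 1) x lam rho v (N + 1)
      = prefactor y x lam (rho - 1) v N * ((lam + 2 * y - N + rho - v) / 2) := by
  simp only [prefactor]
  push_cast
  have h1 := poch_half_ne_zero hg.diff_add_ne (N + 2 - 2 * x)
    (b := -(x : ℝ) + (lam - (rho - 1) + N + v + 1) / 2) (by push_cast; ring) (x + y + 1)
  rw [show x + (y + 1) = x + y + 1 by ring, show (y : ℝ) + 1 + (lam - rho - (N + 1) + v + 1) / 2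
      = y + (lam - (rho - 1) - N + v + 1) / 2 by ring,
    show rho + lam - (N + 1 : ℝ) + v + 1 = rho - 1 + lam - N + v + 1 by ring,
    show rho + lam - (N + 1 : ℝ) - v + 1 = rho - 1 + lam - N - v + 1 by ring,
    show lam - rho + (N + 1 : ℝ) + v + 1 = lam - (rho - 1) + N + v + 1 by ring]
  rw [poch_succ] at h1
  obtain ⟨h1, h2⟩ := mul_ne_zero_iff.1 h1
  rw [poch_succ, poch_succ, poch_succ]
  push_cast at h2 ⊢
  rw [div_mul_eq_mul_div, div_eq_div_iff (mul_ne_zero h1 h2) h1]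
  ring

/-- Raising `rho` by one raises both lower parameters `A`, `B` of the series. The quotient of
prefactors therefore supplies only `(B + y) / (A * B)`; the one-place value supplies `A + y`,
completing the coefficient `(A - s) * (B - s) / (A * B)` at `s = -y`. -/
lemma prefactor_split_zero_one (y x N : ℕ) (hg : Generic lam rho v) :
    (rho + lam - N + v) / 2 * ((rho + lam - N - v) / 2) * prefactor y x lam (rho + 1) v N
      = prefactor y (x + 1) lam rho v (N + 1) * ((rho + lam - N - v) / 2 + y) := by
  simp only [prefactor]
  push_cast
  have h1 := poch_half_ne_zero hg.diff_add_ne (N - 2 * x)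
    (b := -(x : ℝ) + (lam - (rho + 1) + N + v + 1) / 2) (by push_cast; ring) (x + y + 1)
  have e1 := poch_succ_left ((rho + lam - N + v) / 2) x
  have e2 : poch ((rho + lam - N - v) / 2) y * ((rho + lam - N - v) / 2 + y) = _ :=
    (mul_poch_add_one ((rho + lam - N - v) / 2) y).symm
  rw [show x + 1 + y = x + y + 1 by ring,
    show rho + lam - (N + 1 : ℝ) + v + 1 = rho + lam - N + v by ring,
    show rho + lam - (N + 1 : ℝ) - v + 1 = rho + lam - N - v by ring,
    show (rho + 1 + lam - N + v + 1) / 2 = (rho + lam - N + v) / 2 + 1 by ring,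
    show (rho + 1 + lam - N - v + 1) / 2 = (rho + lam - N - v) / 2 + 1 by ring,
    show y + (lam - rho - (N + 1) + v + 1) / 2 = y + (lam - (rho + 1) - N + v + 1) / 2 by ring,
    show -((x : ℝ) + 1) + (lam - rho + (N + 1) + v + 1) / 2
      = -(x : ℝ) + (lam - (rho + 1) + N + v + 1) / 2 by ring, e1,
    show ∀ a b c d e : ℝ, a * b * c / d * e = a * (b * e) * c / d by intros; ring, e2]
  rw [poch_succ] at h1
  obtain ⟨h1, h2⟩ := mul_ne_zero_iff.1 h1
  rw [poch_succ, poch_succ]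
  push_cast at h2 ⊢
  rw [← mul_div_assoc, div_eq_div_iff h1 (mul_ne_zero h1 h2)]
  ring

lemma prefactor_split_one_one (y x N : ℕ) (hg : Generic lam rho v) :
    (rho + lam - N + v) / 2 * ((rho + lam - N - v) / 2) * prefactor y x lam (rho + 1) v N
      = prefactor (y + 1) (x + 1) lam rho v (N + 1) * ((lam - rho - N + v) / 2 + y) := by
  simp only [prefactor]
  push_cast
  have h1 := poch_half_ne_zero hg.diff_add_ne (N - 2 * x)
    (b := -(x : ℝ) + (lam - (rho + 1) + N + v + 1) / 2) (by push_cast; ring) (x + y + 1 + 1)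
  have e1 := poch_succ_left ((rho + lam - N + v) / 2) x
  have e2 := poch_succ_left ((rho + lam - N - v) / 2) y
  have e3 := mul_poch_add_one (y + (lam - (rho + 1) - N + v + 1) / 2) (N + 1)
  rw [show x + 1 + (y + 1) = x + y + 1 + 1 by ring,
    show rho + lam - (N + 1 : ℝ) + v + 1 = rho + lam - N + v by ring,
    show rho + lam - (N + 1 : ℝ) - v + 1 = rho + lam - N - v by ring,
    show (rho + 1 + lam - N + v + 1) / 2 = (rho + lam - N + v) / 2 + 1 by ring,
    show (rho + 1 + lam - N - v + 1) / 2 = (rho + lam - N - v) / 2 + 1 by ring,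
    show (y : ℝ) + 1 + (lam - rho - (N + 1) + v + 1) / 2
      = y + (lam - (rho + 1) - N + v + 1) / 2 + 1 by ring,
    show -((x : ℝ) + 1) + (lam - rho + (N + 1) + v + 1) / 2
      = -(x : ℝ) + (lam - (rho + 1) + N + v + 1) / 2 by ring, e1, e2,
    show (lam - rho - N + v) / 2 + y = y + (lam - (rho + 1) - N + v + 1) / 2 by ring,
    show ∀ a b c d e : ℝ, a * b * c / d * e = a * b * (e * c) / d by intros; ring, e3]
  rw [poch_succ, poch_succ] at h1
  obtain ⟨h1, h3⟩ := mul_ne_zero_iff.1 h1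
  obtain ⟨h1, h2⟩ := mul_ne_zero_iff.1 h1
  rw [poch_succ, poch_succ, poch_succ]
  push_cast at h2 h3 ⊢
  rw [← mul_div_assoc, div_eq_div_iff h1 (mul_ne_zero (mul_ne_zero h1 h2) h3)]
  ring

end prefactors

/-! ### Contiguous relations: splitting a site of the right process -/

section contiguous
variable {lam rho v : ℝ}

/-- Splitting a site on the right hand side, with no particle on the last place of the left hand
side. -/
lemma siteDuality_splitR_zero (hg : Generic lam rho v) {y N : ℕ} (hy : y ≤ N) (x : ℕ) :
    rho * (N + 1) * siteDuality y x lam rho v (N + 1)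
      = (rho + x) * (N + 1 - x) * (siteDuality y x lam (rho - 1) v N
          * siteDuality 0 0 (lam + 2 * y - N) rho v 1)
        + x * (rho - N - 1 + x) * (siteDuality y (x - 1) lam (rho + 1) v N
          * siteDuality 0 1 (lam + 2 * y - N) rho v 1) := by
  have hg' : Generic (lam + 2 * y - N) rho v :=
    hg.shift (2 * y - N) 0 (by push_cast; ring) (by simp)
  rw [siteDuality_unit_zero_zero, siteDuality_unit_zero_one hg',
    siteDuality_eq_sum (m := y + 1) (by omega), siteDuality_eq_sum (m := y + 1) (by omega),
    siteDuality_eq_sum (m := y + 1) (by omega)]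
  set A := (rho + lam - N + v) / 2 with hA
  set B := (rho + lam - N - v) / 2 with hB
  have hA0 : A ≠ 0 := fun h => by
    simpa using poch_half_ne_zero hg.sum_add_ne (-N) (b := A) (by push_cast; ring) 1 (by simpa)
  have hB0 : B ≠ 0 := fun h => by
    simpa using poch_half_ne_zero hg.sum_sub_ne (-N) (b := B) (by push_cast; ring) 1 (by simpa)
  have ht : (y : ℝ) + lam - N - 1 ≠ 0 := fun h =>
    hg.lam_ne (N + 1 - y) (by push_cast; linarith)
  -- Since `y ≤ N`, the summation index stays at most `N`, and the factorial of the lower parameter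
  -- `-(N + 1)` has no zero factor.
  have key : ∀ n ∈ Finset.range (y + 1),
      _ = _ := fun n hn => serTerm_telescope (X := -(x : ℝ)) (σ := x + rho - N - 1) (s := -(y : ℝ))
      (t := y + lam - N - 1) (A := A) (B := B) (D := -(N : ℝ) - 1) (ρ := rho) (n := n)
      (poch_half_ne_zero hg.sum_add_ne (-N) (by push_cast; ring) _)
      (poch_half_ne_zero hg.sum_sub_ne (-N) (by push_cast; ring) _)
      (by
        rw [show -(N : ℝ) - 1 = -((N + 1 : ℕ) : ℝ) by push_cast; ring]
        exact poch_neg_ne_zero (by have := Finset.mem_range.1 hn; omega))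
      ht (by rw [hA, hB]; ring) (by ring)
  have key := Finset.sum_congr rfl key
  rw [← Finset.mul_sum, Finset.sum_add_distrib, Finset.sum_sub_distrib, ← Finset.mul_sum,
    ← Finset.mul_sum, Finset.sum_range_sub'] at key
  have c0 : certTerm (-(x : ℝ)) (x + rho - N - 1) (-(y : ℝ)) (y + lam - N - 1) A B (-(N : ℝ) - 1)
      rho 0 = 0 := by simp [certTerm]
  -- The telescoping sum has no boundary term: the certificate contains `(-y)_{y+1} = 0`.
  have c1 : certTerm (-(x : ℝ)) (x + rho - N - 1) (-(y : ℝ)) (y + lam - N - 1) A B (-(N : ℝ) - 1)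
      rho (y + 1) = 0 := by
    simp [certTerm, serTerm, poch_neg_eq_zero (Nat.lt_succ_self y)]
  rw [c0, c1] at key
  have p1 := prefactor_split_zero_zero y x N lam rho v
  rw [show (rho + lam - ((N + 1 : ℕ) : ℝ) + v + 1) / 2 = A by rw [hA]; push_cast; ring,
    show (rho + lam - ((N + 1 : ℕ) : ℝ) - v + 1) / 2 = B by rw [hB]; push_cast; ring,
    show (x : ℝ) + rho - ((N + 1 : ℕ) : ℝ) = x + rho - N - 1 by push_cast; ring,
    show (y : ℝ) + lam - ((N + 1 : ℕ) : ℝ) = y + lam - N - 1 by push_cast; ring,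
    show -((N + 1 : ℕ) : ℝ) = -(N : ℝ) - 1 by push_cast; ring,
    show (x : ℝ) + (rho - 1) - N = x + rho - N - 1 by ring,
    show (rho - 1 + lam - N + v + 1) / 2 = A by rw [hA]; ring,
    show (rho - 1 + lam - N - v + 1) / 2 = B by rw [hB]; ring,
    show (rho + 1 + lam - N + v + 1) / 2 = A + 1 by rw [hA]; ring,
    show (rho + 1 + lam - N - v + 1) / 2 = B + 1 by rw [hB]; ring]
  rw [show (y : ℝ) + lam - N - 1 + 1 = y + lam - N by ring,
    show -(N : ℝ) - 1 + 1 = -N by ring] at key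
  -- At `x = 0` the coefficient `X` kills the second series, and the truncated `x - 1` plays no
  -- role.
  rcases x with _ | x
  · simp only [Nat.cast_zero, neg_zero, zero_mul, add_zero, sub_zero, zero_add] at key p1 ⊢
    linear_combination prefactor y 0 lam rho v (N + 1) * key + (rho * (N + 1)) * (∑ i ∈ Finset.range (y + 1), serTerm 0 (rho - N - 1) (-(y : ℝ)) (y + lam - N) A B (-N) i) * p1
  · have p2 := prefactor_split_zero_one y x N hg
    rw [← hA, ← hB] at p2
    have p2' : prefactor y x lam (rho + 1) v N
        = prefactor y (x + 1) lam rho v (N + 1) * (B + y) / (A * B) := by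
      rw [← p2]; field_simp
    rw [Nat.add_sub_cancel, p2']
    push_cast at key ⊢
    rw [show -((x : ℝ) + 1) + 1 = -x by ring, show (x : ℝ) + 1 + rho - N - 1 + 1 = x + (rho + 1) - N by ring] at key
    set S1 := ∑ i ∈ Finset.range (y + 1), serTerm (-((x : ℝ) + 1)) (x + 1 + rho - N - 1) (-(y : ℝ)) (y + lam - N - 1) A B (-N - 1) i
    set S2 := ∑ i ∈ Finset.range (y + 1), serTerm (-((x : ℝ) + 1)) (x + 1 + rho - N - 1) (-(y : ℝ)) (y + lam - N) A B (-N) i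
    set S3 := ∑ i ∈ Finset.range (y + 1), serTerm (-(x : ℝ)) (x + (rho + 1) - N) (-(y : ℝ)) (y + lam - N) (A + 1) (B + 1) (-N) i
    rw [show (v + (lam + 2 * y - N) + rho) / 2 = A + y by rw [hA]; ring]
    linear_combination prefactor y (x + 1) lam rho v (N + 1) * key + (rho + (x + 1)) * (N + 1 - (x + 1)) * S2 * p1

/-- Splitting a site on the right hand side, with a particle on the last place of the left hand
side. -/
lemma siteDuality_splitR_one (hg : Generic lam rho v) {y N : ℕ} (hy : y ≤ N) (x : ℕ) :
    rho * (N + 1) * siteDuality (y + 1) x lam rho v (N + 1)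
      = (rho + x) * (N + 1 - x) * (siteDuality y x lam (rho - 1) v N
          * siteDuality 1 0 (lam + 2 * y - N) rho v 1)
        + x * (rho - N - 1 + x) * (siteDuality y (x - 1) lam (rho + 1) v N
          * siteDuality 1 1 (lam + 2 * y - N) rho v 1) := by
  have hg' : Generic (lam + 2 * y - N) rho v :=
    hg.shift (2 * y - N) 0 (by push_cast; ring) (by simp)
  rw [siteDuality_unit_one_zero hg', siteDuality_unit_one_one hg',
    siteDuality_eq_sum (y := y + 1) (m := y + 1 + 1) (by omega),
    siteDuality_eq_sum (m := y + 1) (by omega), siteDuality_eq_sum (m := y + 1) (by omega),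
    Finset.sum_range_succ]
  set A := (rho + lam - N + v) / 2 with hA
  set B := (rho + lam - N - v) / 2 with hB
  have hA0 : A ≠ 0 := fun h => by
    simpa using poch_half_ne_zero hg.sum_add_ne (-N) (b := A) (by push_cast; ring) 1 (by simpa)
  have hB0 : B ≠ 0 := fun h => by
    simpa using poch_half_ne_zero hg.sum_sub_ne (-N) (b := B) (by push_cast; ring) 1 (by simpa)
  have ht : -((y : ℝ) + 1) ≠ 0 := by
    have : (0 : ℝ) < y + 1 := by positivity
    linarith
  -- The roles of `s` and `t` are interchanged relative to the empty case: here `t = -(y + 1)`, so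
  -- raising `t` produces the series for `y` particles.
  have key : ∀ n ∈ Finset.range (y + 1),
      _ = _ := fun n hn => serTerm_telescope (X := -(x : ℝ)) (σ := x + rho - N - 1)
      (s := y + lam - N) (t := -((y : ℝ) + 1)) (A := A) (B := B) (D := -(N : ℝ) - 1) (ρ := rho)
      (n := n)
      (poch_half_ne_zero hg.sum_add_ne (-N) (by push_cast; ring) _)
      (poch_half_ne_zero hg.sum_sub_ne (-N) (by push_cast; ring) _)
      (by
        rw [show -(N : ℝ) - 1 = -((N + 1 : ℕ) : ℝ) by push_cast; ring]
        exact poch_neg_ne_zero (by have := Finset.mem_range.1 hn; omega))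
      ht (by rw [hA, hB]; ring) (by ring)
  have key := Finset.sum_congr rfl key
  rw [← Finset.mul_sum, Finset.sum_add_distrib, Finset.sum_sub_distrib, ← Finset.mul_sum,
    ← Finset.mul_sum, Finset.sum_range_sub'] at key
  have c0 : certTerm (-(x : ℝ)) (x + rho - N - 1) (y + lam - N) (-((y : ℝ) + 1)) A B (-(N : ℝ) - 1)
      rho 0 = 0 := by simp [certTerm]
  -- The boundary term does not vanish now. It is exactly the missing term of index `y + 1` in the
  -- series on the left, which could not be included in the telescoping because for `y = N` the next
  -- lower factorial is zero.
  have c1 : certTerm (-(x : ℝ)) (x + rho - N - 1) (y + lam - N) (-((y : ℝ) + 1)) A B (-(N : ℝ) - 1)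
      rho (y + 1) = rho * (N + 1) * serTerm (-(x : ℝ)) (x + rho - N - 1) (-((y : ℝ) + 1)) (y + lam - N) A B (-(N : ℝ) - 1) (y + 1) := by
    rw [certTerm, serTerm_swap]
    push_cast
    field_simp
    ring
  rw [c0, c1] at key
  simp only [fun X σ A B D n => serTerm_swap X σ (y + lam - N) (-((y : ℝ) + 1)) A B D n,
    fun X σ A B D n => serTerm_swap X σ (y + lam - N) (-((y : ℝ) + 1) + 1) A B D n] at key
  have p1 := prefactor_split_one_zero y x N hg
  rw [show (rho + lam - ((N + 1 : ℕ) : ℝ) + v + 1) / 2 = A by rw [hA]; push_cast; ring,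
    show (rho + lam - ((N + 1 : ℕ) : ℝ) - v + 1) / 2 = B by rw [hB]; push_cast; ring,
    show (x : ℝ) + rho - ((N + 1 : ℕ) : ℝ) = x + rho - N - 1 by push_cast; ring,
    show ((y + 1 : ℕ) : ℝ) + lam - ((N + 1 : ℕ) : ℝ) = y + lam - N by push_cast; ring,
    show ((y + 1 : ℕ) : ℝ) = (y : ℝ) + 1 by push_cast; ring,
    show -((N + 1 : ℕ) : ℝ) = -(N : ℝ) - 1 by push_cast; ring,
    show (x : ℝ) + (rho - 1) - N = x + rho - N - 1 by ring,
    show (rho - 1 + lam - N + v + 1) / 2 = A by rw [hA]; ring,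
    show (rho - 1 + lam - N - v + 1) / 2 = B by rw [hB]; ring,
    show (rho + 1 + lam - N + v + 1) / 2 = A + 1 by rw [hA]; ring,
    show (rho + 1 + lam - N - v + 1) / 2 = B + 1 by rw [hB]; ring]
  rw [show -((y : ℝ) + 1) + 1 = -y by ring,
    show -(N : ℝ) - 1 + 1 = -N by ring] at key
  rcases x with _ | x
  · simp only [Nat.cast_zero, neg_zero, zero_mul, add_zero, sub_zero, zero_add] at key p1 ⊢
    linear_combination prefactor (y + 1) 0 lam rho v (N + 1) * key + (rho * (N + 1)) * (∑ i ∈ Finset.range (y + 1), serTerm 0 (rho - N - 1) (-(y : ℝ)) (y + lam - N) A B (-N) i) * p1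
  · have p2 := prefactor_split_one_one y x N hg
    rw [← hA, ← hB] at p2
    have p2' : prefactor y x lam (rho + 1) v N
        = prefactor (y + 1) (x + 1) lam rho v (N + 1) * ((lam - rho - N + v) / 2 + y) / (A * B) := by
      rw [← p2]; field_simp
    rw [Nat.add_sub_cancel, p2']
    push_cast at key ⊢
    rw [show -((x : ℝ) + 1) + 1 = -x by ring, show (x : ℝ) + 1 + rho - N - 1 + 1 = x + (rho + 1) - N by ring] at key
    set S2 := ∑ i ∈ Finset.range (y + 1), serTerm (-((x : ℝ) + 1)) (x + 1 + rho - N - 1) (-(y : ℝ)) (y + lam - N) A B (-N) i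
    rw [show (lam + 2 * y - N - rho - v) / 2 = y + lam - N - A by rw [hA]; ring,
      show (lam - rho - N + v) / 2 + y = y + lam - N - B by rw [hB]; ring]
    linear_combination prefactor (y + 1) (x + 1) lam rho v (N + 1) * key + (rho + (x + 1)) * (N + 1 - (x + 1)) * S2 * p1

end contiguous

/-! ### Contiguous relations: splitting a site of the left process -/

section contiguousL
variable {lam rho v : ℝ}

/-- Splitting a site on the left hand side, with no particle on the last place of the right hand
side. -/
lemma siteDuality_splitL_zero (hg : Generic lam rho v) {x N : ℕ} (hx : x ≤ N) (y : ℕ) :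
    (N + 1) * (lam - N - 1 + 2 * y) * siteDuality y x lam rho v (N + 1)
      = (N + 1 - y) * (lam - N - 1 + y) * (siteDuality y x lam (rho - 1) v N
          * siteDuality 0 0 (lam + 2 * y - N) rho v 1)
        + y * (lam + y) * (siteDuality (y - 1) x lam (rho - 1) v N
          * siteDuality 1 0 (lam + 2 * y - 2 - N) rho v 1) := by
  have hg' : Generic (lam + 2 * y - 2 - N) rho v :=
    hg.shift (2 * y - 2 - N) 0 (by push_cast; ring) (by simp)
  rw [siteDuality_unit_zero_zero, siteDuality_unit_one_zero hg',
    siteDuality_eq_sum (m := x + 1) (by omega), siteDuality_eq_sum (m := x + 1) (by omega),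
    siteDuality_eq_sum (m := x + 1) (by omega)]
  set A := (rho + lam - N + v) / 2 with hA
  set B := (rho + lam - N - v) / 2 with hB
  have key : ∀ n ∈ Finset.range (x + 1),
      _ = _ := fun n hn => serTerm_lower_split (X := -(x : ℝ)) (σ := x + rho - N - 1)
      (s := -(y : ℝ)) (t := y + lam - N - 1) (A := A) (B := B) (D := -(N : ℝ) - 1) (n := n)
      (by
        rw [show -(N : ℝ) - 1 = -((N + 1 : ℕ) : ℝ) by push_cast; ring]
        exact poch_neg_ne_zero (by have := Finset.mem_range.1 hn; omega))
  have key := Finset.sum_congr rfl key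
  rw [← Finset.mul_sum, Finset.sum_sub_distrib, ← Finset.mul_sum, ← Finset.mul_sum] at key
  have p1 := prefactor_split_zero_zero y x N lam rho v
  rw [show (rho + lam - ((N + 1 : ℕ) : ℝ) + v + 1) / 2 = A by rw [hA]; push_cast; ring,
    show (rho + lam - ((N + 1 : ℕ) : ℝ) - v + 1) / 2 = B by rw [hB]; push_cast; ring,
    show (x : ℝ) + rho - ((N + 1 : ℕ) : ℝ) = x + rho - N - 1 by push_cast; ring,
    show (y : ℝ) + lam - ((N + 1 : ℕ) : ℝ) = y + lam - N - 1 by push_cast; ring,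
    show -((N + 1 : ℕ) : ℝ) = -(N : ℝ) - 1 by push_cast; ring,
    show (x : ℝ) + (rho - 1) - N = x + rho - N - 1 by ring,
    show (rho - 1 + lam - N + v + 1) / 2 = A by rw [hA]; ring,
    show (rho - 1 + lam - N - v + 1) / 2 = B by rw [hB]; ring]
  rw [show (y : ℝ) + lam - N - 1 + 1 = y + lam - N by ring,
    show -(N : ℝ) - 1 + 1 = -N by ring] at key
  rcases y with _ | y
  · simp only [Nat.cast_zero, neg_zero, zero_mul, add_zero, sub_zero, zero_add] at key p1 ⊢
    linear_combination prefactor 0 x lam rho v (N + 1) * key + ((N + 1) * (lam - N - 1)) * (∑ i ∈ Finset.range (x + 1), serTerm (-(x : ℝ)) (x + rho - N - 1) 0 (lam - N) A B (-N) i) * p1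
  · have p2 := prefactor_split_one_zero y x N hg
    rw [Nat.add_sub_cancel]
    push_cast at key p1 ⊢
    rw [show -((y : ℝ) + 1) + 1 = -y by ring,
      show (y : ℝ) + 1 + lam - N - 1 = y + lam - N by ring] at key
    rw [show (y : ℝ) + 1 + lam - N - 1 = y + lam - N by ring]
    set S2 := ∑ i ∈ Finset.range (x + 1), serTerm (-(x : ℝ)) (x + rho - N - 1) (-((y : ℝ) + 1)) (y + 1 + lam - N) A B (-N) i
    set S3 := ∑ i ∈ Finset.range (x + 1), serTerm (-(x : ℝ)) (x + rho - N - 1) (-(y : ℝ)) (y + lam - N) A B (-N) i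
    linear_combination prefactor (y + 1) x lam rho v (N + 1) * key + (N + 1 - (y + 1)) * (lam - N - 1 + (y + 1)) * S2 * p1 + (y + 1) * (lam + (y + 1)) * S3 * p2

/-- Splitting a site on the left hand side, with a particle on the last place of the right hand
side. -/
lemma siteDuality_splitL_one (hg : Generic lam rho v) {x y N : ℕ} (hx : x ≤ N) (hy : y ≤ N + 1) :
    (N + 1) * (lam - N - 1 + 2 * y) * siteDuality y (x + 1) lam rho v (N + 1)
      = (N + 1 - y) * (lam - N - 1 + y) * (siteDuality y x lam (rho + 1) v N
          * siteDuality 0 1 (lam + 2 * y - N) rho v 1)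
        + y * (lam + y) * (siteDuality (y - 1) x lam (rho + 1) v N
          * siteDuality 1 1 (lam + 2 * y - 2 - N) rho v 1) := by
  -- The relation is a consequence of the other three: split the right site for both occupations of
  -- the left place, average over that place, and remove the part with an empty right place by
  -- `siteDuality_splitL_zero`. The extra factors `N + 1 - y`, `y` and `N + 1 - (x + 1)` make the
  -- cases outside the allowed range trivial.
  have h0 : ((N : ℝ) + 1 - y) * (rho * (N + 1) * siteDuality y (x + 1) lam rho v (N + 1))
      = ((N : ℝ) + 1 - y) * ((rho + (x + 1)) * (N + 1 - (x + 1)) * (siteDuality y (x + 1) lam (rho - 1) v N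
          * siteDuality 0 0 (lam + 2 * y - N) rho v 1)
        + (x + 1) * (rho - N - 1 + (x + 1)) * (siteDuality y x lam (rho + 1) v N
          * siteDuality 0 1 (lam + 2 * y - N) rho v 1)) := by
    rcases Nat.lt_or_ge N y with h | h
    · obtain rfl : y = N + 1 := by omega
      simp
    · rw [siteDuality_splitR_zero hg h]; push_cast; simp
  have h1 : (y : ℝ) * (rho * (N + 1) * siteDuality y (x + 1) lam rho v (N + 1))
      = y * ((rho + (x + 1)) * (N + 1 - (x + 1)) * (siteDuality (y - 1) (x + 1) lam (rho - 1) v N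
          * siteDuality 1 0 (lam + 2 * y - 2 - N) rho v 1)
        + (x + 1) * (rho - N - 1 + (x + 1)) * (siteDuality (y - 1) x lam (rho + 1) v N
          * siteDuality 1 1 (lam + 2 * y - 2 - N) rho v 1)) := by
    rcases y with _ | y
    · simp
    · rw [siteDuality_splitR_one hg (by omega)]
      rw [show lam + 2 * ((y + 1 : ℕ) : ℝ) - 2 - N = lam + 2 * y - N by push_cast; ring]
      push_cast; simp
  have h2 : ((N : ℝ) + 1 - (x + 1)) * ((N + 1) * (lam - N - 1 + 2 * y) * siteDuality y (x + 1) lam rho v (N + 1))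
      = ((N : ℝ) + 1 - (x + 1)) * ((N + 1 - y) * (lam - N - 1 + y) * (siteDuality y (x + 1) lam (rho - 1) v N
          * siteDuality 0 0 (lam + 2 * y - N) rho v 1)
        + y * (lam + y) * (siteDuality (y - 1) (x + 1) lam (rho - 1) v N
          * siteDuality 1 0 (lam + 2 * y - 2 - N) rho v 1)) := by
    rcases Nat.lt_or_ge N (x + 1) with h | h
    · obtain rfl : x = N := by omega
      simp
    · rw [siteDuality_splitL_zero hg h]
  -- This factor is what remains of the total weight `rho * (N + 1)` after the part with an empty
  -- right place has been subtracted.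
  have hne : ((x : ℝ) + 1) * (rho - N - 1 + (x + 1)) ≠ 0 := by
    refine mul_ne_zero (by positivity) fun h => hg.rho_ne (N - x) ?_
    push_cast; linarith
  apply mul_left_cancel₀ hne
  linear_combination (lam - N - 1 + y) * h0 + (lam + y) * h1 - (rho + (x + 1)) * h2

end contiguousL

/-! ### One-site weights -/

lemma poch_add (a : ℝ) (m n : ℕ) : poch a (m + n) = poch a m * poch (a + m) n := by
  simp only [poch, Finset.prod_range_add]
  congr 1
  refine Finset.prod_congr rfl fun i _ => ?_
  push_cast; ring

lemma poch_neg_reflect (a : ℝ) (n : ℕ) : poch (-a) n = (-1) ^ n * poch (a - n + 1) n := by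
  induction n generalizing a with
  | zero => simp
  | succ n ih =>
    rw [poch_succ_left, show -a + 1 = -(a - 1) by ring, ih, poch_succ, pow_succ]
    push_cast
    rw [show a - 1 - n + 1 = a - (n + 1) + 1 by ring]
    ring

section weights
variable {rho : ℝ}

/-- The three factorials merge into the single run from `rho - N + x` to `rho + x`. Later weight
identities compare runs that differ at an end. -/
lemma siteWeight_eq (h : ∀ m : ℤ, rho ≠ m) (x N : ℕ) :
    siteWeight x N rho
      = (-1) ^ (x + N) * (N.choose x : ℝ) * (rho - N + 2 * x) / poch (rho - N + x) (N + 1) := by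
  have h1 : poch (rho - N) x * poch (rho - N + x) (N + 1)
      = (rho - N) * poch (rho - N + 1) N * poch (rho + 1) x := by
    rw [← poch_add, ← poch_succ_left, show x + (N + 1) = (N + 1) + x by ring, poch_add]
    congr 2
    push_cast; ring
  have n1 : rho - N ≠ 0 := fun h0 => h N (by push_cast; linarith)
  have n2 : poch (rho - N + x) (N + 1) ≠ 0 :=
    poch_int_ne_zero h (-N + x) (by push_cast; ring) _
  have n3 : poch (rho - N + 1) N ≠ 0 := poch_int_ne_zero h (-N + 1) (by push_cast; ring) _
  have n4 : poch (rho + 1) x ≠ 0 := poch_int_ne_zero h 1 (by push_cast; ring) _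
  have e : ((-1 : ℝ) ^ N)⁻¹ = (-1) ^ N := by
    rw [← inv_pow]; norm_num
  rw [siteWeight, poch_neg_reflect, mul_comm ((-1 : ℝ) ^ N), ← mul_assoc, ← div_div,
    div_eq_mul_inv _ ((-1 : ℝ) ^ N), e, pow_add, eq_div_iff n2]
  field_simp
  linear_combination (2 * x + rho - N) * (N.choose x : ℝ) * h1

lemma siteWeight_ne_zero (h : ∀ m : ℤ, rho ≠ m) {x N : ℕ} (hx : x ≤ N) : siteWeight x N rho ≠ 0 := by
  rw [siteWeight_eq h]
  refine div_ne_zero (mul_ne_zero (mul_ne_zero (by simp) ?_) ?_) ?_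
  · exact_mod_cast (Nat.choose_pos hx).ne'
  · exact fun h0 => h (N - 2 * x) (by push_cast; linarith)
  · exact poch_int_ne_zero h (-N + x) (by push_cast; ring) _

lemma choose_cast_sub {N x : ℕ} (hx : x ≤ N + 1) :
    ((N + 1).choose x : ℝ) * (N + 1 - x) = (N + 1) * (N.choose x : ℝ) := by
  have := Nat.choose_mul_succ_eq N x
  have h2 : ((N + 1 - x : ℕ) : ℝ) = N + 1 - x := by push_cast [Nat.cast_sub hx]; ring
  rw [← h2, mul_comm (_ : ℝ) (N.choose x : ℝ)]
  exact_mod_cast this.symm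

lemma choose_cast_succ (N x : ℕ) :
    ((N + 1).choose (x + 1) : ℝ) * (x + 1) = (N + 1) * (N.choose x : ℝ) := by
  exact_mod_cast (Nat.add_one_mul_choose_eq N x).symm

/-- Together with `siteWeight_split_one` this translates weights at `rho - 1` and `rho + 1`,
delivered by the induction hypothesis of `siteDuality_orthogonal`, back to the weight at `rho`. -/
lemma siteWeight_split_zero (h : ∀ m : ℤ, rho ≠ m) {x N : ℕ} (hx : x ≤ N + 1) :
    (rho + x) * (N + 1 - x) * siteWeight x (N + 1) rho
      = -((N : ℝ) + 1) * siteWeight x N (rho - 1) := by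
  have h' : ∀ m : ℤ, rho - 1 ≠ m := fun m hm => h (m + 1) (by push_cast; linarith)
  have n := poch_int_ne_zero h (-N - 1 + x) (b := rho - 1 - N + x) (by push_cast; ring) (N + 1 + 1)
  have hc := choose_cast_sub hx
  rw [siteWeight_eq h, siteWeight_eq h']
  push_cast
  rw [show rho - (N + 1 : ℝ) + x = rho - 1 - N + x by ring,
    show x + (N + 1) = x + N + 1 by ring, pow_succ]
  rw [poch_succ] at n ⊢
  obtain ⟨n1, n2⟩ := mul_ne_zero_iff.1 n
  push_cast at n2 ⊢
  rw [show rho - 1 - (N : ℝ) + x + (N + 1) = rho + x by ring] at n2 ⊢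
  field_simp
  linear_combination -(rho - N - 1 + 2 * x) * hc

lemma siteWeight_split_one (h : ∀ m : ℤ, rho ≠ m) (x N : ℕ) :
    x * (rho - N - 1 + x) * siteWeight x (N + 1) rho
      = ((N : ℝ) + 1) * (if x = 0 then 0 else siteWeight (x - 1) N (rho + 1)) := by
  rcases x with _ | x
  · simp
  have h' : ∀ m : ℤ, rho + 1 ≠ m := fun m hm => h (m - 1) (by push_cast; linarith)
  have n := poch_int_ne_zero h (-N + x) (b := rho - N + x) (by push_cast; ring) (N + 1 + 1)
  have hc := choose_cast_succ N x
  rw [siteWeight_eq h, if_neg (Nat.succ_ne_zero x), Nat.add_sub_cancel, siteWeight_eq h']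
  push_cast
  rw [show rho - (N + 1 : ℝ) + (x + 1) = rho - N + x by ring,
    show rho + 1 - (N : ℝ) + x = rho - N + x + 1 by ring,
    show x + 1 + (N + 1) = x + N + 1 + 1 by ring, pow_succ, pow_succ]
  rw [poch_succ_left] at n ⊢
  obtain ⟨n1, n2⟩ := mul_ne_zero_iff.1 n
  field_simp
  linear_combination (rho - N + 1 + 2 * x) * (rho - N + x) * hc

/-- The larger weight is a discrete derivative of the smaller one divided by the height. Over a
common denominator this is Pascal's rule and the absorption identity for binomial coefficients. -/
lemma siteWeight_left_split (h : ∀ m : ℤ, rho ≠ m) (y N : ℕ) :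
    (-1) ^ (N + 1) * siteWeight (y + 1) (N + 1) rho
      = (-1) ^ N * siteWeight (y + 1) N rho / (rho + 2 * (y + 1) - N)
        - (-1) ^ N * siteWeight y N rho / (rho + 2 * y - N) := by
  have n := poch_int_ne_zero h (-N + y) (b := rho - N + y) (by push_cast; ring) (N + 1 + 1)
  have hc := choose_cast_succ N y
  have hp : ((N + 1).choose (y + 1) : ℝ) = N.choose y + N.choose (y + 1) := by
    exact_mod_cast Nat.choose_succ_succ N y
  have m1 : rho + 2 * (y + 1) - N ≠ 0 := fun h0 => h (N - 2 * (y + 1)) (by push_cast; linarith)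
  have m2 : rho + 2 * y - N ≠ 0 := fun h0 => h (N - 2 * y) (by push_cast; linarith)
  have e : ((-1 : ℝ) ^ N) * (-1) ^ N = 1 := by rw [← mul_pow]; norm_num
  rw [siteWeight_eq h, siteWeight_eq h, siteWeight_eq h]
  push_cast
  rw [show rho - (N + 1 : ℝ) + (y + 1) = rho - N + y by ring,
    show rho - (N : ℝ) + (y + 1) = rho - N + y + 1 by ring,
    show rho - (N + 1 : ℝ) + 2 * (y + 1) = rho - N + 2 * y + 1 by ring,
    show rho - (N : ℝ) + 2 * (y + 1) = rho + 2 * (y + 1) - N by ring,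
    show rho - (N : ℝ) + 2 * y = rho + 2 * y - N by ring]
  have e1 : poch (rho - N + y) (N + 1 + 1) = (rho - N + y) * poch (rho - N + y + 1) (N + 1) :=
    poch_succ_left _ _
  have e2 : poch (rho - N + y) (N + 1) * (rho + 1 + y)
      = (rho - N + y) * poch (rho - N + y + 1) (N + 1) := by
    rw [← e1, poch_succ _ (N + 1)]; push_cast; ring
  rw [e1] at n ⊢
  obtain ⟨n1, n2⟩ := mul_ne_zero_iff.1 n
  have n3 : rho + 1 + y ≠ 0 := fun h0 => h (-1 - y) (by push_cast; linarith)
  have e3 : poch (rho - N + y) (N + 1)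
      = (rho - N + y) * poch (rho - N + y + 1) (N + 1) / (rho + 1 + y) := by
    rw [← e2]; field_simp
  rw [e3]
  generalize poch (rho - N + y + 1) (N + 1) = p at *
  simp only [pow_add, pow_one]
  field_simp
  linear_combination -hc - (rho - N + y) * hp

end weights

/-! ### Orthogonality for one site -/

/-- Summation by parts based on `siteWeight_left_split`. The lower end is checked separately, and at
the upper end the smaller weight vanishes with its binomial coefficient. -/
lemma sum_siteWeight_left_split {lam : ℝ} (h : ∀ m : ℤ, lam ≠ m) (N : ℕ) (G : ℕ → ℝ) :
    ∑ y ∈ Finset.range (N + 1 + 1), G y * ((-1) ^ (N + 1) * siteWeight y (N + 1) lam)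
      = ∑ y ∈ Finset.range (N + 1), (G y - G (y + 1)) / (lam + 2 * y - N)
          * ((-1) ^ N * siteWeight y N lam) := by
  have h0 : (-1) ^ (N + 1) * siteWeight 0 (N + 1) lam
      = (-1) ^ N * siteWeight 0 N lam / (lam + 2 * (0 : ℕ) - N) := by
    have n := poch_int_ne_zero h (-N - 1) (b := lam - (N + 1)) (by push_cast; ring) (N + 1 + 1)
    have m2 : lam - N ≠ 0 := fun h0 => h N (by push_cast; linarith)
    have e : ((-1 : ℝ) ^ N) * (-1) ^ N = 1 := by rw [← mul_pow]; norm_num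
    rw [siteWeight_eq h, siteWeight_eq h]
    simp only [Nat.choose_zero_right]
    push_cast
    rw [poch_succ_left] at n
    simp only [mul_zero, add_zero, zero_add]
    rw [poch_succ_left,
      show lam - (N + 1 : ℝ) + 1 = lam - N by ring]
    rw [show lam - (N + 1 : ℝ) + 1 = lam - N by ring] at n
    obtain ⟨n1, n2⟩ := mul_ne_zero_iff.1 n
    simp only [pow_add, pow_one]
    field_simp
  have hlast : siteWeight (N + 1) N lam = 0 := by simp [siteWeight]
  rw [Finset.sum_range_succ']
  have : ∀ y ∈ Finset.range (N + 1), G (y + 1) * ((-1) ^ (N + 1) * siteWeight (y + 1) (N + 1) lam)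
      = G (y + 1) * ((-1) ^ N * siteWeight (y + 1) N lam / (lam + 2 * ((y + 1 : ℕ) : ℝ) - N))
        - G (y + 1) * ((-1) ^ N * siteWeight y N lam / (lam + 2 * y - N)) := by
    intro y _
    rw [siteWeight_left_split h]
    push_cast; ring
  rw [Finset.sum_congr rfl this, Finset.sum_sub_distrib, h0]
  have h2 := Finset.sum_range_succ' (fun y : ℕ => G y * ((-1) ^ N * siteWeight y N lam
    / (lam + 2 * (y : ℝ) - N))) (N + 1)
  rw [Finset.sum_range_succ, hlast] at h2
  simp only [mul_zero, zero_div, add_zero] at h2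
  rw [sub_add_eq_add_sub, ← h2, ← Finset.sum_sub_distrib]
  refine Finset.sum_congr rfl fun y _ => ?_
  ring

/-- Induction on `N`. After summation by parts, both factors are split on the right. With `μ = lam +
2 * y - N`, the mixed products cancel because `v` and `-v` are paired, while the pure products
acquire `-μ * rho` and `μ * rho`; the `μ` cancels the divisor from the summation by parts. What is
left are orthogonality sums for `rho - 1` and `rho + 1`. -/
lemma siteDuality_orthogonal {lam rho v : ℝ} (hg : Generic lam rho v) {N x x' : ℕ} (hx : x ≤ N)
    (hx' : x' ≤ N) :
    ∑ y ∈ Finset.range (N + 1), siteDuality y x lam rho v N * siteDuality y x' lam rho (-v) N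
        * ((-1) ^ N * siteWeight y N lam)
      = (if x = x' then 1 else 0) / siteWeight x N rho := by
  induction N generalizing lam rho x x' with
  | zero =>
    obtain rfl : x = 0 := by omega
    obtain rfl : x' = 0 := by omega
    have h1 : lam ≠ 0 := by simpa using hg.lam_ne 0
    have h2 : rho ≠ 0 := by simpa using hg.rho_ne 0
    simp [siteDuality_eq_sum (m := 1) (y := 0) (x := 0) (by simp), prefactor, serTerm, siteWeight,
      h1, h2]
  | succ N ih =>
    have hgm : Generic lam (rho - 1) v := hg.shift 0 (-1) (by simp) (by push_cast; ring)
    have hgp : Generic lam (rho + 1) v := hg.shift 0 1 (by simp) (by push_cast; ring)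
    have r0 : rho ≠ 0 := by simpa using hg.rho_ne 0
    have N0 : (N : ℝ) + 1 ≠ 0 := by positivity
    rw [sum_siteWeight_left_split hg.lam_ne]
    have hG : ∀ y ∈ Finset.range (N + 1),
        (siteDuality y x lam rho v (N + 1) * siteDuality y x' lam rho (-v) (N + 1)
          - siteDuality (y + 1) x lam rho v (N + 1) * siteDuality (y + 1) x' lam rho (-v) (N + 1))
          / (lam + 2 * y - N) * ((-1) ^ N * siteWeight y N lam)
        = (x * (rho - N - 1 + x) * (x' * (rho - N - 1 + x'))
            * (siteDuality y (x - 1) lam (rho + 1) v N * siteDuality y (x' - 1) lam (rho + 1) (-v) N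
              * ((-1) ^ N * siteWeight y N lam))
          - (rho + x) * (N + 1 - x) * ((rho + x') * (N + 1 - x'))
            * (siteDuality y x lam (rho - 1) v N * siteDuality y x' lam (rho - 1) (-v) N
              * ((-1) ^ N * siteWeight y N lam))) / (rho * (N + 1) ^ 2) := by
      intro y hy
      have hy : y ≤ N := by have := Finset.mem_range.1 hy; omega
      have hμ : lam + 2 * y - N ≠ 0 := fun h0 => hg.lam_ne (N - 2 * y) (by push_cast; linarith)
      have hg' : Generic (lam + 2 * y - N) rho v :=
        hg.shift (2 * y - N) 0 (by push_cast; ring) (by simp)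
      have a1 := siteDuality_splitR_zero hg hy x
      have a2 := siteDuality_splitR_zero hg.neg hy x'
      have b1 := siteDuality_splitR_one hg hy x
      have b2 := siteDuality_splitR_one hg.neg hy x'
      rw [siteDuality_unit_zero_zero, siteDuality_unit_zero_one hg'] at a1
      rw [siteDuality_unit_zero_zero, siteDuality_unit_zero_one hg'.neg] at a2
      rw [siteDuality_unit_one_zero hg', siteDuality_unit_one_one hg'] at b1
      rw [siteDuality_unit_one_zero hg'.neg, siteDuality_unit_one_one hg'.neg] at b2
      have hr : rho * (N + 1) ≠ 0 := mul_ne_zero r0 N0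
      rw [mul_comm, ← eq_div_iff hr] at a1 a2 b1 b2
      rw [a1, a2, b1, b2]
      generalize siteDuality y x lam (rho - 1) v N = p
      generalize siteDuality y (x - 1) lam (rho + 1) v N = q
      generalize siteDuality y x' lam (rho - 1) (-v) N = p'
      generalize siteDuality y (x' - 1) lam (rho + 1) (-v) N = q'
      generalize (-1) ^ N * siteWeight y N lam = w
      generalize (rho + x) * (N + 1 - x) = α
      generalize (rho + x') * (N + 1 - x') = α'
      generalize x * (rho - N - 1 + x) = β
      generalize x' * (rho - N - 1 + x') = β'
      rw [show lam = (lam + 2 * y - N) - 2 * y + N by ring] at hμ ⊢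
      generalize lam + 2 * y - N = μ at hμ ⊢
      field_simp
      ring
    rw [Finset.sum_congr rfl hG, ← Finset.sum_div, Finset.sum_sub_distrib, ← Finset.mul_sum,
      ← Finset.mul_sum]
    have w0 := siteWeight_split_zero hg.rho_ne hx
    have w1 := siteWeight_split_one hg.rho_ne x N
    have w := siteWeight_ne_zero hg.rho_ne hx
    -- The induction hypothesis is unavailable at `x = N + 1` or `x' = N + 1`, but there the
    -- coefficient in front is zero.
    have s0 : (rho + x) * (N + 1 - x) * ((rho + x') * (N + 1 - x'))
        * ∑ y ∈ Finset.range (N + 1), siteDuality y x lam (rho - 1) v N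
          * siteDuality y x' lam (rho - 1) (-v) N * ((-1) ^ N * siteWeight y N lam)
        = (if x = x' then 1 else 0) * (-(N + 1) * ((rho + x) * (N + 1 - x)) / siteWeight x (N + 1) rho) := by
      rcases Nat.lt_or_ge N x with h | h
      · obtain rfl : x = N + 1 := by omega
        simp
      rcases Nat.lt_or_ge N x' with h' | h'
      · obtain rfl : x' = N + 1 := by omega
        rw [if_neg (by omega)]
        simp
      rw [ih hgm h h']
      split_ifs with hxx
      · subst hxx
        have := siteWeight_ne_zero hgm.rho_ne h
        have e : siteWeight x N (rho - 1)
          = -((rho + x) * (N + 1 - x) * siteWeight x (N + 1) rho) / (N + 1) := by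
          rw [w0]; field_simp
        have e2 : (rho + x) * (N + 1 - x) ≠ 0 := by
          intro h0; rw [e, h0] at this; simp at this
        rw [e]
        field_simp
      · simp
    have s1 : x * (rho - N - 1 + x) * (x' * (rho - N - 1 + x'))
        * ∑ y ∈ Finset.range (N + 1), siteDuality y (x - 1) lam (rho + 1) v N
          * siteDuality y (x' - 1) lam (rho + 1) (-v) N * ((-1) ^ N * siteWeight y N lam)
        = (if x = x' then 1 else 0) * ((N + 1) * (x * (rho - N - 1 + x)) / siteWeight x (N + 1) rho) := by
      rcases x with _ | x
      · simp
      rcases x' with _ | x'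
      · simp
      rw [if_neg (Nat.succ_ne_zero x)] at w1
      simp only [Nat.add_sub_cancel] at w1 ⊢
      rw [ih hgp (by omega) (by omega)]
      simp only [Nat.add_right_cancel_iff]
      split_ifs with hxx
      · subst hxx
        have := siteWeight_ne_zero hgp.rho_ne (show x ≤ N by omega)
        have e : siteWeight x N (rho + 1)
          = ((x + 1 : ℕ) * (rho - N - 1 + (x + 1 : ℕ)) * siteWeight (x + 1) (N + 1) rho) / (N + 1) := by
          rw [w1]; field_simp
        have e2 : ((x + 1 : ℕ) : ℝ) * (rho - N - 1 + (x + 1 : ℕ)) ≠ 0 := by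
          intro h0; rw [e, h0] at this; simp at this
        rw [e]
        field_simp
      · simp
    -- The two diagonal contributions combine through `x * (rho - N - 1 + x) + (rho + x) * (N + 1 -
    -- x) = rho * (N + 1)`.
    rw [s0, s1]
    field_simp
    ring

/-! ### The exchange operators of one bond -/

/-- The part of the left generator that belongs to two neighbouring sites. -/
noncomputable def bondL (N₁ N₂ : ℕ) (lam : ℝ) (f : ℕ → ℕ → ℝ) (a b : ℕ) : ℝ :=
  a * (N₂ - b) * (lam + a) * (lam + 2 * a - N₁ + b)
      / ((lam + 2 * a - N₁) * (lam + 2 * a - N₁ - 1)) * (f (a - 1) (b + 1) - f a b)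
    + b * (N₁ - a) * (lam + a - N₁) * (lam + 2 * a - N₁ + b - N₂)
      / ((lam + 2 * a - N₁) * (lam + 2 * a - N₁ + 1)) * (f (a + 1) (b - 1) - f a b)

/-- The part of the right generator that belongs to two neighbouring sites. -/
noncomputable def bondR (N₁ N₂ : ℕ) (rho : ℝ) (f : ℕ → ℕ → ℝ) (a b : ℕ) : ℝ :=
  a * (N₂ - b) * (rho + 2 * b - N₂ + a - N₁) * (rho + b - N₂)
      / ((rho + 2 * b - N₂) * (rho + 2 * b - N₂ + 1)) * (f (a - 1) (b + 1) - f a b)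
    + b * (N₁ - a) * (rho + 2 * b - N₂ + a) * (rho + b)
      / ((rho + 2 * b - N₂) * (rho + 2 * b - N₂ - 1)) * (f (a + 1) (b - 1) - f a b)

/-- Rates of impossible jumps vanish, so only values on admissible pairs with the same particle
number matter. This makes truncated subtraction harmless and lets conserved quantities be treated as
constants. -/
lemma exchange_congr {N₁ N₂ a b : ℕ} {f g : ℕ → ℕ → ℝ} (ha : a ≤ N₁) (hb : b ≤ N₂)
    (h : ∀ p q, p ≤ N₁ → q ≤ N₂ → p + q = a + b → f p q = g p q) (A B C D E F : ℝ) :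
    a * (N₂ - b) * A * B / C * (f (a - 1) (b + 1) - f a b)
        + b * (N₁ - a) * D * E / F * (f (a + 1) (b - 1) - f a b)
      = a * (N₂ - b) * A * B / C * (g (a - 1) (b + 1) - g a b)
        + b * (N₁ - a) * D * E / F * (g (a + 1) (b - 1) - g a b) := by
  rw [h a b ha hb rfl]
  congr 1
  · rcases Nat.eq_zero_or_pos a with rfl | h1
    · simp
    rcases hb.eq_or_lt with rfl | h2
    · simp
    rw [h (a - 1) (b + 1) (by omega) (by omega) (by omega)]
  · rcases Nat.eq_zero_or_pos b with rfl | h1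
    · simp
    rcases ha.eq_or_lt with rfl | h2
    · simp
    rw [h (a + 1) (b - 1) (by omega) (by omega) (by omega)]

lemma bondL_congr {N₁ N₂ a b : ℕ} {f g : ℕ → ℕ → ℝ} (lam : ℝ) (ha : a ≤ N₁) (hb : b ≤ N₂)
    (h : ∀ p q, p ≤ N₁ → q ≤ N₂ → p + q = a + b → f p q = g p q) :
    bondL N₁ N₂ lam f a b = bondL N₁ N₂ lam g a b :=
  exchange_congr ha hb h _ _ _ _ _ _

lemma bondR_congr {N₁ N₂ a b : ℕ} {f g : ℕ → ℕ → ℝ} (rho : ℝ) (ha : a ≤ N₁) (hb : b ≤ N₂)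
    (h : ∀ p q, p ≤ N₁ → q ≤ N₂ → p + q = a + b → f p q = g p q) :
    bondR N₁ N₂ rho f a b = bondR N₁ N₂ rho g a b :=
  exchange_congr ha hb h _ _ _ _ _ _

lemma bondL_sum (N₁ N₂ : ℕ) (lam : ℝ) (k : ℕ → ℝ) (g : ℕ → ℕ → ℕ → ℝ) (a b : ℕ) :
    bondL N₁ N₂ lam (fun p q => ∑ e ∈ Finset.range 2, k e * g e p q) a b
      = ∑ e ∈ Finset.range 2, k e * bondL N₁ N₂ lam (g e) a b := by
  simp only [bondL, Finset.sum_range_succ, Finset.sum_range_zero]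
  ring

lemma bondR_sum (N₁ N₂ : ℕ) (rho : ℝ) (k : ℕ → ℝ) (g : ℕ → ℕ → ℕ → ℝ) (a b : ℕ) :
    bondR N₁ N₂ rho (fun p q => ∑ e ∈ Finset.range 2, k e * g e p q) a b
      = ∑ e ∈ Finset.range 2, k e * bondR N₁ N₂ rho (g e) a b := by
  simp only [bondR, Finset.sum_range_succ, Finset.sum_range_zero]
  ring

/-! ### Splitting a site into two -/

/-- Conditional probability that the last place of a site of the left process with `N + 1` places
and `y` particles holds `e` particles. -/
noncomputable def splitL (N y e : ℕ) (lam : ℝ) : ℝ :=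
  (if e = 0 then (N + 1 - y) * (lam - N - 1 + y) else y * (lam + y))
    / ((N + 1) * (lam - N - 1 + 2 * y))

/-- Conditional probability that the last place of a site of the right process with `N + 1` places
and `x` particles holds `e` particles. -/
noncomputable def splitR (N x e : ℕ) (rho : ℝ) : ℝ :=
  (if e = 0 then (rho + x) * (N + 1 - x) else x * (rho - N - 1 + x)) / (rho * (N + 1))

/-- Every term of a splitting sum either drops out or has a genuine subtraction `y - e` and an
admissible remaining site. -/
lemma splitL_eq_zero_or {N y e : ℕ} (lam : ℝ) (hy : y ≤ N + 1) (he : e < 2) :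
    splitL N y e lam = 0 ∨ (e ≤ y ∧ y - e ≤ N) := by
  interval_cases e
  · rcases hy.eq_or_lt with rfl | h
    · left; simp [splitL]
    · right; omega
  · rcases Nat.eq_zero_or_pos y with rfl | h
    · left; simp [splitL]
    · right; omega

lemma splitR_eq_zero_or {N x e : ℕ} (rho : ℝ) (hx : x ≤ N + 1) (he : e < 2) :
    splitR N x e rho = 0 ∨ (e ≤ x ∧ x - e ≤ N) := by
  interval_cases e
  · rcases hx.eq_or_lt with rfl | h
    · left; simp [splitR]
    · right; omega
  · rcases Nat.eq_zero_or_pos x with rfl | h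
    · left; simp [splitR]
    · right; omega

section split
variable {lam rho v : ℝ}

/-- The weights do not depend on the left configuration. They therefore commute with the left
exchange operator, which is what the fusion argument uses. -/
lemma siteDuality_splitR (hg : Generic lam rho v) {y N e' : ℕ} (hy : y ≤ N) (he : e' < 2) (x : ℕ) :
    siteDuality (y + e') x lam rho v (N + 1) = ∑ e ∈ Finset.range 2, splitR N x e rho
      * (siteDuality y (x - e) lam (rho + 2 * e - 1) v N
        * siteDuality e' e (lam + 2 * y - N) rho v 1) := by
  have r0 : rho * (N + 1) ≠ 0 :=
    mul_ne_zero (by simpa using hg.rho_ne 0) (by positivity)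
  simp only [Finset.sum_range_succ, Finset.sum_range_zero, splitR]
  norm_num
  rw [show rho + 2 - 1 = rho + 1 by ring]
  interval_cases e'
  · have := siteDuality_splitR_zero hg hy x
    rw [div_mul_eq_mul_div, div_mul_eq_mul_div, ← add_div, eq_div_iff r0, ← this]
    ring_nf
  · have := siteDuality_splitR_one hg hy x
    rw [div_mul_eq_mul_div, div_mul_eq_mul_div, ← add_div, eq_div_iff r0, ← this]
    ring_nf

lemma siteDuality_splitL (hg : Generic lam rho v) {x y N e : ℕ} (hx : x ≤ N) (hy : y ≤ N + 1)
    (he : e < 2) :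
    siteDuality y (x + e) lam rho v (N + 1) = ∑ e' ∈ Finset.range 2, splitL N y e' lam
      * (siteDuality (y - e') x lam (rho + 2 * e - 1) v N
        * siteDuality e' e (lam + 2 * ((y - e' : ℕ) : ℝ) - N) rho v 1) := by
  have l0 : ((N : ℝ) + 1) * (lam - N - 1 + 2 * y) ≠ 0 :=
    mul_ne_zero (by positivity) fun h0 => hg.lam_ne (N + 1 - 2 * y) (by push_cast; linarith)
  -- The factor `y` hides the one case, `y = 0`, in which the truncated and the real `y - 1` differ.
  have cast : ∀ z : ℝ → ℝ, (y : ℝ) * z ((y - 1 : ℕ) : ℝ) = y * z (y - 1) := by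
    intro z
    rcases y with _ | y
    · simp
    · simp
  have cast := cast fun z => (lam + y) * (siteDuality (y - 1) x lam (rho + 2 * e - 1) v N
    * siteDuality 1 e (lam + 2 * z - N) rho v 1)
  simp only [Finset.sum_range_succ, Finset.sum_range_zero, splitL]
  norm_num
  rw [div_mul_eq_mul_div, div_mul_eq_mul_div, ← add_div, eq_div_iff l0,
    mul_assoc (y : ℝ), cast, show lam + 2 * ((y : ℝ) - 1) - N = lam + 2 * y - 2 - N by ring]
  interval_cases e
  · have := siteDuality_splitL_zero hg hx y
    push_cast
    rw [show rho + 2 * 0 - 1 = rho - 1 by ring]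
    linear_combination this
  · have := siteDuality_splitL_one hg hx hy
    push_cast
    rw [show rho + 2 * 1 - 1 = rho + 1 by ring]
    linear_combination this

lemma siteDuality_unit (hg : Generic lam rho v) {x y : ℕ} (hy : y ≤ 1) (hx : x ≤ 1) :
    siteDuality y x lam rho v 1 = ((1 - 2 * y) * v + lam - (1 - 2 * x) * (1 - 2 * y) * rho) / 2 := by
  interval_cases y <;> interval_cases x
  · rw [siteDuality_unit_zero_zero]; push_cast; ring
  · rw [siteDuality_unit_zero_one hg]; push_cast; ring
  · rw [siteDuality_unit_one_zero hg]; push_cast; ring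
  · rw [siteDuality_unit_one_one hg]; push_cast; ring

/-- Heuristically the `N₂ + 1` places of the second site share its exchange equally. Freezing the
place farthest from the bond retains the fraction `N₂ / (N₂ + 1)`. -/
lemma bondL_split_right (h : ∀ m : ℤ, lam ≠ m) (N₁ N₂ a b : ℕ) (f : ℕ → ℕ → ℝ) :
    N₂ * bondL N₁ (N₂ + 1) lam f a b = (N₂ + 1) * ∑ e ∈ Finset.range 2,
      splitL N₂ b e (lam + 2 * a - N₁) * bondL N₁ N₂ lam (fun p q => f p (q + e)) a (b - e) := by
  have hh : ∀ k : ℤ, lam + 2 * a - N₁ + k ≠ 0 :=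
    fun k h0 => h (-2 * a + N₁ - k) (by push_cast; linarith)
  have e1 : splitL N₂ b 1 (lam + 2 * a - N₁) * bondL N₁ N₂ lam (fun p q => f p (q + 1)) a (b - 1)
      = splitL N₂ b 1 (lam + 2 * a - N₁) * (a * (N₂ - (b - 1)) * (lam + a)
            * (lam + 2 * a - N₁ + (b - 1)) / ((lam + 2 * a - N₁) * (lam + 2 * a - N₁ - 1))
            * (f (a - 1) (b + 1) - f a b)
          + (b - 1) * (N₁ - a) * (lam + a - N₁) * (lam + 2 * a - N₁ + (b - 1) - N₂)
            / ((lam + 2 * a - N₁) * (lam + 2 * a - N₁ + 1)) * (f (a + 1) (b - 1) - f a b)) := by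
    rcases b with _ | _ | b <;> simp [splitL, bondL]
  rw [Finset.sum_range_succ, Finset.sum_range_one, e1]
  simp only [splitL, bondL, Nat.sub_zero, add_zero, if_true, one_ne_zero, if_false]
  generalize f _ _ - f _ _ = z₁
  generalize f _ _ - f _ _ = z₂
  have h0 := hh 0
  have h1 := hh 1
  have h2 := hh (-1)
  have h3 := hh (2 * b - N₂ - 1)
  have hN : (N₂ : ℝ) + 1 ≠ 0 := by positivity
  push_cast at h0 h1 h2 h3 ⊢
  -- The heights `H` and `K` before and after the second site replace `lam` and `b` as coordinates,
  -- which keeps the denominators simple.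
  obtain ⟨H, hH⟩ : ∃ H, H = lam + 2 * a - N₁ := ⟨_, rfl⟩
  obtain rfl : lam = H - 2 * a + N₁ := by rw [hH]; ring
  simp only [← hH] at h0 h1 h2 h3 ⊢
  clear hH hh h e1
  rw [add_zero] at h0
  rw [show H + -1 = H - 1 by ring] at h2
  obtain ⟨K, hK⟩ : ∃ K, K = H - N₂ - 1 + 2 * b := ⟨_, rfl⟩
  rw [show H + (2 * b - N₂ - 1) = K by rw [hK]; ring] at h3
  simp only [← hK]
  obtain ⟨β, hβ⟩ : ∃ β, β = (b : ℝ) := ⟨_, rfl⟩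
  simp only [← hβ] at hK ⊢
  obtain rfl : β = (K - H + N₂ + 1) / 2 := by rw [hK]; ring
  clear hK hβ
  field_simp
  ring

lemma bondR_split_right (h : ∀ m : ℤ, rho ≠ m) (N₁ N₂ a b : ℕ) (f : ℕ → ℕ → ℝ) :
    N₂ * bondR N₁ (N₂ + 1) rho f a b = (N₂ + 1) * ∑ e ∈ Finset.range 2,
      splitR N₂ b e rho * bondR N₁ N₂ (rho + 2 * e - 1) (fun p q => f p (q + e)) a (b - e) := by
  have hh : ∀ k : ℤ, rho + k ≠ 0 :=
    fun k h0 => h (-k) (by push_cast; linarith)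
  have e1 : splitR N₂ b 1 rho
        * bondR N₁ N₂ (rho + 2 * (1 : ℕ) - 1) (fun p q => f p (q + 1)) a (b - 1)
      = splitR N₂ b 1 rho * (a * (N₂ - (b - 1)) * (rho + 2 * b - (N₂ + 1) + a - N₁)
            * (rho + b - N₂) / ((rho + 2 * b - (N₂ + 1)) * (rho + 2 * b - (N₂ + 1) + 1))
            * (f (a - 1) (b + 1) - f a b)
          + (b - 1) * (N₁ - a) * (rho + 2 * b - (N₂ + 1) + a) * (rho + b)
            / ((rho + 2 * b - (N₂ + 1)) * (rho + 2 * b - (N₂ + 1) - 1))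
            * (f (a + 1) (b - 1) - f a b)) := by
    rcases b with _ | b
    · simp [splitR]
    · rw [bondR]
      have c : ∀ z : ℝ, (b : ℝ) * z * (f (a + 1) (b - 1 + 1) - f a (b + 1))
          = b * z * (f (a + 1) b - f a (b + 1)) := by
        intro z; rcases b with _ | b <;> simp
      simp only [Nat.add_sub_cancel]
      push_cast
      congr 2
      · congr 2
        · congr 1 <;> ring
        · ring
      · have := c ((N₁ - a) * (rho + 2 * (b + 1) - (N₂ + 1) + a) * (rho + (b + 1))
            / ((rho + 2 * (b + 1) - (N₂ + 1)) * (rho + 2 * (b + 1) - (N₂ + 1) - 1)))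
        rw [show rho + 2 * 1 - 1 + 2 * (b : ℝ) - N₂ = rho + 2 * (b + 1) - (N₂ + 1) by ring,
          show rho + 2 * 1 - 1 + (b : ℝ) = rho + (b + 1) by ring]
        linear_combination this
  rw [Finset.sum_range_succ, Finset.sum_range_one, e1]
  simp only [splitR, bondR, Nat.sub_zero, add_zero, if_true, one_ne_zero, if_false]
  generalize f _ _ - f _ _ = z₁
  generalize f _ _ - f _ _ = z₂
  have r0 := hh 0
  have h0 := hh (2 * b - N₂ - 1)
  have h1 := hh (2 * b - N₂)
  have h2 := hh (2 * b - N₂ - 2)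
  have hN : (N₂ : ℝ) + 1 ≠ 0 := by positivity
  push_cast at r0 h0 h1 h2 ⊢
  rw [show rho + 2 * (0 : ℝ) - 1 + 2 * b - N₂ = rho + 2 * b - (N₂ + 1) by ring,
    show rho + 2 * (0 : ℝ) - 1 + b = rho + b - 1 by ring]
  obtain ⟨g, hg⟩ : ∃ g, g = rho + 2 * b - (N₂ + 1) := ⟨_, rfl⟩
  simp only [← hg]
  rw [add_zero] at r0
  rw [show rho + (2 * b - N₂ - 1) = g by rw [hg]; ring] at h0
  rw [show rho + (2 * b - N₂ : ℝ) = g + 1 by rw [hg]; ring] at h1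
  rw [show rho + (2 * b - N₂ - 2 : ℝ) = g - 1 by rw [hg]; ring] at h2
  field_simp
  rw [hg]
  ring

/-- Here only the place next to the bond is kept active, and it carries the fraction `1 / (N₁ + 1)`
of the exchange. If it is full it contributes only jumps to the right, if it is empty only jumps to
the left. -/
lemma bondL_split_left (h : ∀ m : ℤ, lam ≠ m) (N₁ N₂ a b : ℕ) (f : ℕ → ℕ → ℝ) :
    bondL (N₁ + 1) N₂ lam f a b = (N₁ + 1) * ∑ e ∈ Finset.range 2,
      splitL N₁ a e lam * bondL 1 N₂ (lam + 2 * ((a - e : ℕ) : ℝ) - N₁)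
        (fun p q => f (p + (a - e)) q) e b := by
  have hh : ∀ k : ℤ, lam + k ≠ 0 :=
    fun k h0 => h (-k) (by push_cast; linarith)
  have e1 : splitL N₁ a 1 lam * bondL 1 N₂ (lam + 2 * ((a - 1 : ℕ) : ℝ) - N₁)
        (fun p q => f (p + (a - 1)) q) 1 b
      = splitL N₁ a 1 lam * ((N₂ - b) * (lam + 2 * a - (N₁ + 1)) * (lam + 2 * a - (N₁ + 1) + b)
          / ((lam + 2 * a - (N₁ + 1)) * (lam + 2 * a - (N₁ + 1) - 1))
          * (f (a - 1) (b + 1) - f a b)) := by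
    rcases a with _ | a
    · simp [splitL]
    · rw [bondL]
      simp only [Nat.add_sub_cancel, show 1 - 1 = 0 from rfl, zero_add,
        show 1 + a = a + 1 by omega]
      push_cast
      rw [show lam + 2 * (a : ℝ) - N₁ + 2 * 1 - 1 = lam + 2 * (a + 1) - (N₁ + 1) by ring,
        show lam + 2 * (a : ℝ) - N₁ + 1 = lam + 2 * (a + 1) - (N₁ + 1) by ring]
      ring
  have e0 : bondL 1 N₂ (lam + 2 * ((a - 0 : ℕ) : ℝ) - N₁) (fun p q => f (p + (a - 0)) q) 0 b
      = b * (lam + 2 * a - (N₁ + 1)) * (lam + 2 * a - (N₁ + 1) + b - N₂)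
          / ((lam + 2 * a - (N₁ + 1)) * (lam + 2 * a - (N₁ + 1) + 1))
          * (f (a + 1) (b - 1) - f a b) := by
    rw [bondL]
    simp only [Nat.sub_zero, zero_add, show 1 + a = a + 1 by omega]
    push_cast
    rw [show lam + 2 * (a : ℝ) - N₁ + 2 * 0 - 1 = lam + 2 * a - (N₁ + 1) by ring,
      show lam + 2 * (a : ℝ) - N₁ + 0 - 1 = lam + 2 * a - (N₁ + 1) by ring]
    ring
  rw [Finset.sum_range_succ, Finset.sum_range_one, e1, e0]
  simp only [splitL, bondL, if_true, one_ne_zero, if_false]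
  generalize f _ _ - f _ _ = z₁
  generalize f _ _ - f _ _ = z₂
  have h0 := hh (2 * a - N₁ - 1)
  have h1 := hh (2 * a - N₁)
  have h2 := hh (2 * a - N₁ - 2)
  have hN : (N₁ : ℝ) + 1 ≠ 0 := by positivity
  push_cast at h0 h1 h2 ⊢
  obtain ⟨g, hg⟩ : ∃ g, g = lam + 2 * a - (N₁ + 1) := ⟨_, rfl⟩
  rw [show lam - N₁ - 1 + 2 * a = g by rw [hg]; ring]
  simp only [← hg]
  rw [show lam + (2 * a - N₁ - 1) = g by rw [hg]; ring] at h0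
  rw [show lam + (2 * a - N₁ : ℝ) = g + 1 by rw [hg]; ring] at h1
  rw [show lam + (2 * a - N₁ - 2 : ℝ) = g - 1 by rw [hg]; ring] at h2
  field_simp
  ring

lemma bondR_split_left (h : ∀ m : ℤ, rho ≠ m) (N₁ N₂ a b : ℕ) (f : ℕ → ℕ → ℝ) :
    bondR (N₁ + 1) N₂ rho f a b = (N₁ + 1) * ∑ e ∈ Finset.range 2,
      splitR N₁ a e (rho + 2 * b - N₂) * bondR 1 N₂ rho (fun p q => f (p + (a - e)) q) e b := by
  have hh : ∀ k : ℤ, rho + k ≠ 0 :=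
    fun k h0 => h (-k) (by push_cast; linarith)
  have e1 : splitR N₁ a 1 (rho + 2 * b - N₂) * bondR 1 N₂ rho (fun p q => f (p + (a - 1)) q) 1 b
      = splitR N₁ a 1 (rho + 2 * b - N₂) * ((N₂ - b) * (rho + 2 * b - N₂) * (rho + b - N₂)
          / ((rho + 2 * b - N₂) * (rho + 2 * b - N₂ + 1)) * (f (a - 1) (b + 1) - f a b)) := by
    rcases a with _ | a
    · simp [splitR]
    · rw [bondR]
      simp only [Nat.add_sub_cancel, show 1 - 1 = 0 from rfl, zero_add,
        show 1 + a = a + 1 by omega]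
      push_cast
      ring
  have e0 : bondR 1 N₂ rho (fun p q => f (p + (a - 0)) q) 0 b
      = b * (rho + 2 * b - N₂) * (rho + b)
          / ((rho + 2 * b - N₂) * (rho + 2 * b - N₂ - 1)) * (f (a + 1) (b - 1) - f a b) := by
    rw [bondR]
    simp only [Nat.sub_zero, zero_add, show 1 + a = a + 1 by omega]
    push_cast
    ring
  rw [Finset.sum_range_succ, Finset.sum_range_one, e1, e0]
  simp only [splitR, bondR, if_true, one_ne_zero, if_false]
  generalize f _ _ - f _ _ = z₁
  generalize f _ _ - f _ _ = z₂
  have h0 := hh (2 * b - N₂)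
  have h1 := hh (2 * b - N₂ + 1)
  have h2 := hh (2 * b - N₂ - 1)
  have hN : (N₁ : ℝ) + 1 ≠ 0 := by positivity
  push_cast at h0 h1 h2 ⊢
  obtain ⟨g, hg⟩ : ∃ g, g = rho + 2 * b - N₂ := ⟨_, rfl⟩
  simp only [← hg]
  rw [show rho + (2 * b - N₂ : ℝ) = g by rw [hg]; ring] at h0
  rw [show rho + (2 * b - N₂ + 1: ℝ) = g + 1 by rw [hg]; ring] at h1
  rw [show rho + (2 * b - N₂ - 1 : ℝ) = g - 1 by rw [hg]; ring] at h2
  field_simp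
  ring

end split

/-! ### Duality for two sites -/

/-- The duality function of two sites. -/
noncomputable def pairDuality (N₁ N₂ : ℕ) (lam rho v : ℝ) (a b c d : ℕ) : ℝ :=
  siteDuality a c lam (rho + 2 * d - N₂) v N₁ * siteDuality b d (lam + 2 * a - N₁) rho v N₂

lemma pairDuality_unit {lam rho v : ℝ} (hg : Generic lam rho v) {a b c d : ℕ} (ha : a ≤ 1)
    (hb : b ≤ 1) (hc : c ≤ 1) (hd : d ≤ 1) :
    pairDuality 1 1 lam rho v a b c d
      = ((1 - 2 * a) * v + lam - (1 - 2 * c) * (1 - 2 * a) * (rho + 2 * d - 1)) / 2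
        * (((1 - 2 * b) * v + (lam + 2 * a - 1) - (1 - 2 * d) * (1 - 2 * b) * rho) / 2) := by
  have g1 : Generic lam (rho + 2 * d - 1) v :=
    hg.shift 0 (2 * d - 1) (by simp) (by push_cast; ring)
  have g2 : Generic (lam + 2 * a - 1) rho v :=
    hg.shift (2 * a - 1) 0 (by push_cast; ring) (by simp)
  rw [pairDuality, Nat.cast_one, siteDuality_unit g1 ha hc, siteDuality_unit g2 hb hd]

/-- The duality relation of one bond. -/
def BondDuality (N₁ N₂ : ℕ) : Prop :=
  ∀ lam rho v : ℝ, Generic lam rho v → ∀ a b c d : ℕ, a ≤ N₁ → b ≤ N₂ → c ≤ N₁ → d ≤ N₂ →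
    bondL N₁ N₂ lam (fun p q => pairDuality N₁ N₂ lam rho v p q c d) a b
      = bondR N₁ N₂ rho (fun p q => pairDuality N₁ N₂ lam rho v a b p q) c d

/-- Base of the fusion argument: with the explicit one-place values, sixteen rational identities
remain. -/
lemma bondDuality_unit : BondDuality 1 1 := by
  intro lam rho v hg a b c d ha hb hc hd
  rw [bondL_congr lam ha hb fun p q hp hq _ => pairDuality_unit hg hp hq hc hd,
    bondR_congr rho hc hd fun p q hp hq _ => pairDuality_unit hg ha hb hp hq]
  have l : ∀ k : ℤ, lam + k ≠ 0 := fun k h0 => hg.lam_ne (-k) (by push_cast; linarith)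
  have r : ∀ k : ℤ, rho + k ≠ 0 := fun k h0 => hg.rho_ne (-k) (by push_cast; linarith)
  have l0 := l 0
  have l1 := l 1
  have l2 := l (-1)
  have r0 := r 0
  have r1 := r 1
  have r2 := r (-1)
  push_cast at l0 l1 l2 r0 r1 r2
  rw [add_zero] at l0 r0
  rw [← sub_eq_add_neg] at l2 r2
  have e1 : ∀ z : ℝ, z + 2 - 1 = z + 1 := fun z => by ring
  simp only [bondL, bondR]
  interval_cases a <;> interval_cases b <;> interval_cases c <;> interval_cases d <;>
    norm_num [e1] <;> first | (right; ring1) | (field_simp; ring1)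

/-- The place farthest from the bond is split off and frozen. Expanding its occupation in both
processes turns each side into the same double average of the smaller bond relation. The factor `N₂`
must be cancelled, hence `hN`. -/
lemma BondDuality.succ_right {N₁ N₂ : ℕ} (h : BondDuality N₁ N₂) (hN : N₂ ≠ 0) :
    BondDuality N₁ (N₂ + 1) := by
  intro lam rho v hg a b c d ha hb hc hd
  have hN' : (N₂ : ℝ) ≠ 0 := by exact_mod_cast hN
  apply mul_left_cancel₀ hN'
  rw [bondL_split_right hg.lam_ne, bondR_split_right hg.rho_ne]
  congr 1
  have gL : ∀ p : ℕ, Generic (lam + 2 * p - N₁) rho v := fun p =>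
    hg.shift (2 * p - N₁) 0 (by push_cast; ring) (by simp)
  have gR : ∀ e : ℕ, Generic lam (rho + 2 * e - 1) v := fun e =>
    hg.shift 0 (2 * e - 1) (by simp) (by push_cast; ring)
  have gR' : ∀ d : ℕ, Generic lam (rho + 2 * d - N₂) v := fun e =>
    hg.shift 0 (2 * e - N₂) (by simp) (by push_cast; ring)
  have hl : ∀ e' ∈ Finset.range 2,
      splitL N₂ b e' (lam + 2 * a - N₁) * bondL N₁ N₂ lam
        (fun p q => pairDuality N₁ (N₂ + 1) lam rho v p (q + e') c d) a (b - e')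
      = ∑ e ∈ Finset.range 2, splitL N₂ b e' (lam + 2 * a - N₁) * splitR N₂ d e rho
        * siteDuality e' e (lam + 2 * a - N₁ + 2 * ((b - e' : ℕ) : ℝ) - N₂) rho v 1
        * bondL N₁ N₂ lam (fun p q => pairDuality N₁ N₂ lam (rho + 2 * e - 1) v p q c (d - e)) a
          (b - e') := by
    intro e' he'
    have he' := Finset.mem_range.1 he'
    rcases splitL_eq_zero_or (lam + 2 * a - N₁) hb he' with h0 | ⟨h1, h2⟩
    · simp [h0]
    rw [bondL_congr lam (g := fun p q => ∑ e ∈ Finset.range 2, (splitR N₂ d e rho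
        * siteDuality e' e (lam + 2 * a - N₁ + 2 * ((b - e' : ℕ) : ℝ) - N₂) rho v 1)
        * pairDuality N₁ N₂ lam (rho + 2 * e - 1) v p q c (d - e)) ha h2, bondL_sum,
      Finset.mul_sum]
    · exact Finset.sum_congr rfl fun e _ => by ring
    intro p q hp hq hpq
    rw [pairDuality, siteDuality_splitR (gL p) hq he', Finset.mul_sum]
    refine Finset.sum_congr rfl fun e he => ?_
    rcases splitR_eq_zero_or rho hd (Finset.mem_range.1 he) with h0 | ⟨h3, h4⟩
    · simp [h0]
    -- The bond conserves `p + q`, so the height seen by the frozen place is constant and its factor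
    -- comes out of the exchange operator.
    have hpq' : (p : ℝ) + q = a + ((b - e' : ℕ) : ℝ) := by exact_mod_cast hpq
    rw [pairDuality, show lam + 2 * a - N₁ + 2 * ((b - e' : ℕ) : ℝ) - N₂
        = lam + 2 * p - N₁ + 2 * q - N₂ by linear_combination -2 * hpq',
      show rho + 2 * (e : ℝ) - 1 + 2 * ((d - e : ℕ) : ℝ) - N₂ = rho + 2 * d - ((N₂ + 1 : ℕ) : ℝ) by
        push_cast [Nat.cast_sub h3]; ring]
    ring
  have hr : ∀ e ∈ Finset.range 2,
      splitR N₂ d e rho * bondR N₁ N₂ (rho + 2 * e - 1)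
        (fun p q => pairDuality N₁ (N₂ + 1) lam rho v a b p (q + e)) c (d - e)
      = ∑ e' ∈ Finset.range 2, splitL N₂ b e' (lam + 2 * a - N₁) * splitR N₂ d e rho
        * siteDuality e' e (lam + 2 * a - N₁ + 2 * ((b - e' : ℕ) : ℝ) - N₂) rho v 1
        * bondR N₁ N₂ (rho + 2 * e - 1)
          (fun p q => pairDuality N₁ N₂ lam (rho + 2 * e - 1) v a (b - e') p q) c (d - e) := by
    intro e he
    have he := Finset.mem_range.1 he
    rcases splitR_eq_zero_or rho hd he with h0 | ⟨h1, h2⟩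
    · simp [h0]
    rw [bondR_congr _ (g := fun p q => ∑ e' ∈ Finset.range 2,
        (splitL N₂ b e' (lam + 2 * a - N₁)
        * siteDuality e' e (lam + 2 * a - N₁ + 2 * ((b - e' : ℕ) : ℝ) - N₂) rho v 1)
        * pairDuality N₁ N₂ lam (rho + 2 * e - 1) v a (b - e') p q) hc h2, bondR_sum,
      Finset.mul_sum]
    · exact Finset.sum_congr rfl fun e _ => by ring
    intro p q hp hq hpq
    rw [pairDuality, siteDuality_splitL (gL a) hq hb he, Finset.mul_sum]
    refine Finset.sum_congr rfl fun e' he' => ?_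
    rw [pairDuality, show rho + 2 * (e : ℝ) - 1 + 2 * q - N₂
      = rho + 2 * ((q + e : ℕ) : ℝ) - ((N₂ + 1 : ℕ) : ℝ) by push_cast; ring]
    ring
  rw [Finset.sum_congr rfl hl, Finset.sum_congr rfl hr, Finset.sum_comm]
  refine Finset.sum_congr rfl fun e he => Finset.sum_congr rfl fun e' he' => ?_
  rcases splitL_eq_zero_or (lam + 2 * a - N₁) hb (Finset.mem_range.1 he') with h0 | ⟨h1, h2⟩
  · simp [h0]
  rcases splitR_eq_zero_or rho hd (Finset.mem_range.1 he) with h0 | ⟨h3, h4⟩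
  · simp [h0]
  rw [h lam _ v (gR e) a (b - e') c (d - e) ha h2 hc h4]

/-- Now the `N₁` places away from the bond are frozen. Conservation of particles on the bond in the
right process keeps the height seen by them constant. -/
lemma BondDuality.of_unit_left {N₂ : ℕ} (h : BondDuality 1 N₂) (N₁ : ℕ) :
    BondDuality (N₁ + 1) N₂ := by
  intro lam rho v hg a b c d ha hb hc hd
  rw [bondL_split_left hg.lam_ne, bondR_split_left hg.rho_ne]
  congr 1
  have gL : ∀ p : ℕ, Generic (lam + 2 * p - N₁) rho v := fun p =>
    hg.shift (2 * p - N₁) 0 (by push_cast; ring) (by simp)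
  have gR : ∀ d : ℕ, Generic lam (rho + 2 * d - N₂) v := fun e =>
    hg.shift 0 (2 * e - N₂) (by simp) (by push_cast; ring)
  have hl : ∀ e' ∈ Finset.range 2,
      splitL N₁ a e' lam * bondL 1 N₂ (lam + 2 * ((a - e' : ℕ) : ℝ) - N₁)
        (fun p q => pairDuality (N₁ + 1) N₂ lam rho v (p + (a - e')) q c d) e' b
      = ∑ e ∈ Finset.range 2, splitL N₁ a e' lam * splitR N₁ c e (rho + 2 * d - N₂)
        * siteDuality (a - e') (c - e) lam (rho + 2 * d - N₂ + 2 * e - 1) v N₁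
        * bondL 1 N₂ (lam + 2 * ((a - e' : ℕ) : ℝ) - N₁)
          (fun p q => pairDuality 1 N₂ (lam + 2 * ((a - e' : ℕ) : ℝ) - N₁) rho v p q e d) e' b := by
    intro e' he'
    have he' := Finset.mem_range.1 he'
    rcases splitL_eq_zero_or lam ha he' with h0 | ⟨h1, h2⟩
    · simp [h0]
    rw [bondL_congr _ (g := fun p q => ∑ e ∈ Finset.range 2, (splitR N₁ c e (rho + 2 * d - N₂)
        * siteDuality (a - e') (c - e) lam (rho + 2 * d - N₂ + 2 * e - 1) v N₁)
        * pairDuality 1 N₂ (lam + 2 * ((a - e' : ℕ) : ℝ) - N₁) rho v p q e d)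
        (show e' ≤ 1 by omega) hb, bondL_sum, Finset.mul_sum]
    · exact Finset.sum_congr rfl fun e _ => by ring
    intro p q hp hq hpq
    rw [pairDuality, add_comm p, siteDuality_splitR (gR d) h2 (show p < 2 by omega),
      Finset.sum_mul]
    refine Finset.sum_congr rfl fun e he => ?_
    rw [pairDuality, show lam + 2 * ((a - e' : ℕ) : ℝ) - N₁ + 2 * p - ((1 : ℕ) : ℝ)
        = lam + 2 * ((a - e' + p : ℕ) : ℝ) - ((N₁ + 1 : ℕ) : ℝ) by push_cast; ring]
    ring
  have hr : ∀ e ∈ Finset.range 2,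
      splitR N₁ c e (rho + 2 * d - N₂) * bondR 1 N₂ rho
        (fun p q => pairDuality (N₁ + 1) N₂ lam rho v a b (p + (c - e)) q) e d
      = ∑ e' ∈ Finset.range 2, splitL N₁ a e' lam * splitR N₁ c e (rho + 2 * d - N₂)
        * siteDuality (a - e') (c - e) lam (rho + 2 * d - N₂ + 2 * e - 1) v N₁
        * bondR 1 N₂ rho
          (fun p q => pairDuality 1 N₂ (lam + 2 * ((a - e' : ℕ) : ℝ) - N₁) rho v e' b p q) e d := by
    intro e he
    have he := Finset.mem_range.1 he
    rcases splitR_eq_zero_or (rho + 2 * d - N₂) hc he with h0 | ⟨h1, h2⟩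
    · simp [h0]
    rw [bondR_congr _ (g := fun p q => ∑ e' ∈ Finset.range 2, (splitL N₁ a e' lam
        * siteDuality (a - e') (c - e) lam (rho + 2 * d - N₂ + 2 * e - 1) v N₁)
        * pairDuality 1 N₂ (lam + 2 * ((a - e' : ℕ) : ℝ) - N₁) rho v e' b p q)
        (show e ≤ 1 by omega) hd, bondR_sum, Finset.mul_sum]
    · exact Finset.sum_congr rfl fun e _ => by ring
    intro p q hp hq hpq
    rw [pairDuality, add_comm p, siteDuality_splitL (gR q) h2 ha (show p < 2 by omega),
      Finset.sum_mul]
    refine Finset.sum_congr rfl fun e' he' => ?_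
    rcases splitL_eq_zero_or lam ha (Finset.mem_range.1 he') with h0 | ⟨h3, h4⟩
    · simp [h0]
    have hpq' : (p : ℝ) + q = e + d := by exact_mod_cast hpq
    rw [pairDuality, show lam + 2 * ((a - e' : ℕ) : ℝ) - N₁ + 2 * e' - ((1 : ℕ) : ℝ)
        = lam + 2 * a - ((N₁ + 1 : ℕ) : ℝ) by push_cast [Nat.cast_sub h3]; ring,
      show rho + 2 * (q : ℝ) - N₂ + 2 * p - 1 = rho + 2 * d - N₂ + 2 * e - 1 by
        linear_combination 2 * hpq']
    ring
  rw [Finset.sum_congr rfl hl, Finset.sum_congr rfl hr, Finset.sum_comm]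
  refine Finset.sum_congr rfl fun e he => Finset.sum_congr rfl fun e' he' => ?_
  have he := Finset.mem_range.1 he
  have he' := Finset.mem_range.1 he'
  rw [h _ rho v (gL (a - e')) e' b e d (by omega) hb (by omega) hd]

/-- Induction is needed only for the right site: `BondDuality.of_unit_left` passes from one place to
any number on the left at once. -/
lemma bondDuality {N₁ N₂ : ℕ} (h₁ : 0 < N₁) (h₂ : 0 < N₂) : BondDuality N₁ N₂ := by
  have : BondDuality 1 N₂ := by
    induction N₂, h₂ using Nat.le_induction with
    | base => exact bondDuality_unit
    | succ n hn ih => exact ih.succ_right (by omega)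
  obtain ⟨n, rfl⟩ : ∃ n, N₁ = n + 1 := ⟨N₁ - 1, by omega⟩
  exact this.of_unit_left n

/-! ### Height functions and jumps -/

section config
variable {M : ℕ} {N : Fin M → ℕ}

lemma heightL_succ (lam : ℝ) (ζ : Config N) (i : Fin M) :
    heightL lam ζ ((i : ℕ) + 1) = heightL lam ζ i + 2 * ((ζ i : ℕ) : ℝ) - N i := by
  have : ∀ j : Fin M, (if (j : ℕ) < i + 1 then 2 * ((ζ j : ℕ) : ℝ) - (N j : ℝ) else 0)
      = (if (j : ℕ) < i then 2 * ((ζ j : ℕ) : ℝ) - (N j : ℝ) else 0)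
        + if j = i then 2 * ((ζ j : ℕ) : ℝ) - (N j : ℝ) else 0 := by
    intro j
    rcases lt_trichotomy (j : ℕ) i with h | h | h
    · rw [if_pos (by omega), if_pos h, if_neg (by rintro rfl; omega), add_zero]
    · rw [if_pos (by omega), if_neg (by omega), if_pos (Fin.ext h), zero_add]
    · rw [if_neg (by omega), if_neg (by omega), if_neg (by rintro rfl; omega), add_zero]
  simp only [heightL, this, Finset.sum_add_distrib, Finset.sum_ite_eq', Finset.mem_univ, if_true]
  ring

lemma heightR_eq_succ (rho : ℝ) (ξ : Config N) (i : Fin M) :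
    heightR rho ξ i = heightR rho ξ ((i : ℕ) + 1) + 2 * ((ξ i : ℕ) : ℝ) - N i := by
  have : ∀ j : Fin M, (if (i : ℕ) ≤ j then 2 * ((ξ j : ℕ) : ℝ) - (N j : ℝ) else 0)
      = (if (i : ℕ) + 1 ≤ j then 2 * ((ξ j : ℕ) : ℝ) - (N j : ℝ) else 0)
        + if j = i then 2 * ((ξ j : ℕ) : ℝ) - (N j : ℝ) else 0 := by
    intro j
    rcases lt_trichotomy (j : ℕ) i with h | h | h
    · rw [if_neg (by omega), if_neg (by omega), if_neg (by rintro rfl; omega), add_zero]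
    · rw [if_pos (by omega), if_neg (by omega), if_pos (Fin.ext h), zero_add]
    · rw [if_pos (by omega), if_pos (by omega), if_neg (by rintro rfl; omega), add_zero]
  simp only [heightR, this, Finset.sum_add_distrib, Finset.sum_ite_eq', Finset.mem_univ, if_true]
  ring

/-- The integer is independent of `lam`, which serves both genericity and continuity in the
parameter. -/
lemma exists_heightL_eq (ζ : Config N) (i : ℕ) : ∃ m : ℤ, ∀ lam : ℝ, heightL lam ζ i = lam + m := by
  refine ⟨∑ j : Fin M, if (j : ℕ) < i then 2 * ((ζ j : ℕ) : ℤ) - (N j : ℤ) else 0, fun lam => ?_⟩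
  rw [heightL]
  push_cast
  congr 1

lemma exists_heightR_eq (ξ : Config N) (i : ℕ) : ∃ m : ℤ, ∀ rho : ℝ, heightR rho ξ i = rho + m := by
  refine ⟨∑ j : Fin M, if i ≤ (j : ℕ) then 2 * ((ξ j : ℕ) : ℤ) - (N j : ℤ) else 0, fun rho => ?_⟩
  rw [heightR]
  push_cast
  congr 1

lemma Generic.height {lam rho v : ℝ} (hg : Generic lam rho v) (ζ ξ : Config N) (i j : ℕ) :
    Generic (heightL lam ζ i) (heightR rho ξ j) v := by
  obtain ⟨m, hm⟩ := exists_heightL_eq ζ i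
  obtain ⟨n, hn⟩ := exists_heightR_eq ξ j
  exact hg.shift m n (hm _) (hn _)

/-- `η'` arises from `η` by moving particles between the sites `i` and `j`. -/
structure Exchanged (i j : Fin M) (η η' : Config N) : Prop where
  off : ∀ k, k ≠ i → k ≠ j → η' k = η k
  sum : (η' i : ℕ) + η' j = η i + η j

lemma Exchanged.refl (i j : Fin M) (η : Config N) : Exchanged i j η η := ⟨fun _ _ _ => rfl, rfl⟩

/-- A height sees both sites, neither, or (only at index `j`) exactly one of them; in the first case
the conserved sum makes the change vanish. -/
lemma Exchanged.heightL_eq {i j : Fin M} {η η' : Config N} (h : Exchanged i j η η')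
    (hij : (i : ℕ) + 1 = j) (lam : ℝ) {l : ℕ} (hl : l ≠ j) : heightL lam η' l = heightL lam η l := by
  have hne : i ≠ j := by rintro rfl; omega
  rw [← sub_eq_zero, heightL, heightL, add_sub_add_left_eq_sub, ← Finset.sum_sub_distrib,
    Finset.sum_eq_add (s := Finset.univ) i j hne]
  · have hs : ((η' i : ℕ) : ℝ) + (η' j : ℕ) = (η i : ℕ) + (η j : ℕ) := by exact_mod_cast h.sum
    by_cases hi : (i : ℕ) < l
    · rw [if_pos hi, if_pos hi, if_pos (by omega), if_pos (by omega)]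
      linear_combination 2 * hs
    · rw [if_neg hi, if_neg hi, if_neg (by omega), if_neg (by omega)]
      ring
  · intro c _ hc
    rw [h.off c hc.1 hc.2, sub_self]
  · simp
  · simp

lemma Exchanged.heightR_eq {i j : Fin M} {η η' : Config N} (h : Exchanged i j η η')
    (hij : (i : ℕ) + 1 = j) (rho : ℝ) {l : ℕ} (hl : l ≠ j) : heightR rho η' l = heightR rho η l := by
  have hne : i ≠ j := by rintro rfl; omega
  rw [← sub_eq_zero, heightR, heightR, add_sub_add_left_eq_sub, ← Finset.sum_sub_distrib,
    Finset.sum_eq_add (s := Finset.univ) i j hne]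
  · have hs : ((η' i : ℕ) : ℝ) + (η' j : ℕ) = (η i : ℕ) + (η j : ℕ) := by exact_mod_cast h.sum
    by_cases hi : l ≤ (i : ℕ)
    · rw [if_pos hi, if_pos hi, if_pos (by omega), if_pos (by omega)]
      linear_combination 2 * hs
    · rw [if_neg hi, if_neg hi, if_neg (by omega), if_neg (by omega)]
      ring
  · intro c _ hc
    rw [h.off c hc.1 hc.2, sub_self]
  · simp
  · simp

section jump
variable {η : Config N} {i j : Fin M}

lemma jump_source (hne : i ≠ j) (hi : 0 < (η i : ℕ)) (hj : (η j : ℕ) < N j) :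
    (jump η i j i : ℕ) = η i - 1 := by
  rw [jump, dif_pos ⟨hi, hj⟩, Function.update_of_ne hne, Function.update_self]

lemma jump_target (hi : 0 < (η i : ℕ)) (hj : (η j : ℕ) < N j) :
    (jump η i j j : ℕ) = η j + 1 := by
  rw [jump, dif_pos ⟨hi, hj⟩, Function.update_self]

lemma jump_other (η : Config N) {k : Fin M} (hi : k ≠ i) (hj : k ≠ j) :
    jump η i j k = η k := by
  rw [jump]
  split_ifs
  · rw [Function.update_of_ne hj, Function.update_of_ne hi]
  · rfl

lemma jump_eq_self (h : ¬ (0 < (η i : ℕ) ∧ (η j : ℕ) < N j)) : jump η i j = η := dif_neg h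

lemma exchanged_jump (hne : i ≠ j) (η : Config N) : Exchanged i j η (jump η i j) := by
  by_cases h : 0 < (η i : ℕ) ∧ (η j : ℕ) < N j
  · refine ⟨fun k hi hj => jump_other η hi hj, ?_⟩
    rw [jump_source hne h.1 h.2, jump_target h.1 h.2]
    omega
  · rw [jump_eq_self h]; exact .refl i j η

lemma exchanged_jump_symm (hne : i ≠ j) (η : Config N) : Exchanged i j η (jump η j i) := by
  have := exchanged_jump hne.symm η
  exact ⟨fun k hi hj => this.off k hj hi, by rw [add_comm, this.sum, add_comm]⟩

lemma jump_jump (hne : i ≠ j) (hi : 0 < (η i : ℕ)) (hj : (η j : ℕ) < N j) :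
    jump (jump η i j) j i = η := by
  have h1 := jump_source hne hi hj
  have h2 := jump_target hi hj
  have hlt := (η i).isLt
  funext k
  by_cases hki : k = i
  · subst hki
    apply Fin.ext
    rw [jump_target (by omega) (by omega), h1]
    omega
  by_cases hkj : k = j
  · subst hkj
    apply Fin.ext
    rw [jump_source hne.symm (by omega) (by omega), h2]
    omega
  rw [jump_other _ hkj hki, jump_other _ hki hkj]

end jump

lemma prod_eq_pair_mul {i j : Fin M} (hne : i ≠ j) (f : Fin M → ℝ) :
    ∏ k, f k = (∏ k ∈ (Finset.univ.erase i).erase j, f k) * (f i * f j) := by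
  rw [← Finset.mul_prod_erase _ f (Finset.mem_univ i), ← Finset.mul_prod_erase _ f
    (Finset.mem_erase.2 ⟨hne.symm, Finset.mem_univ j⟩)]
  ring

/-! ### Duality of the generators -/

/-- Allowing both configurations to vary gives one factorisation, with the same constant, for the
left and for the right generator. -/
lemma duality_exchanged (lam rho v : ℝ) {i j : Fin M} (hij : (i : ℕ) + 1 = j) {ζ ζ' ξ ξ' : Config N}
    (hζ : Exchanged i j ζ ζ') (hξ : Exchanged i j ξ ξ') :
    duality lam rho v ζ' ξ' = (∏ k ∈ (Finset.univ.erase i).erase j,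
        siteDuality (ζ k) (ξ k) (heightL lam ζ k) (heightR rho ξ (k + 1)) v (N k))
      * pairDuality (N i) (N j) (heightL lam ζ i) (heightR rho ξ (j + 1)) v
          (ζ' i) (ζ' j) (ξ' i) (ξ' j) := by
  have hne : i ≠ j := by rintro rfl; omega
  rw [duality, prod_eq_pair_mul hne, pairDuality]
  congr 1
  · refine Finset.prod_congr rfl fun k hk => ?_
    rw [Finset.mem_erase, Finset.mem_erase] at hk
    have h1 : (k : ℕ) ≠ j := fun h => hk.1 (Fin.ext h)
    have h2 : (k : ℕ) ≠ i := fun h => hk.2.1 (Fin.ext h)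
    rw [hζ.off k hk.2.1 hk.1, hξ.off k hk.2.1 hk.1, hζ.heightL_eq hij lam h1,
      hξ.heightR_eq hij rho (by omega)]
  · rw [hij, heightR_eq_succ, hξ.heightR_eq hij rho (by omega : (j : ℕ) + 1 ≠ j),
      hζ.heightL_eq hij lam (by omega : (i : ℕ) ≠ j), ← hij, heightL_succ,
      hζ.heightL_eq hij lam (by omega : (i : ℕ) ≠ j)]

lemma bond_term_left (lam : ℝ) {i j : Fin M} (hij : (i : ℕ) + 1 = j) (ζ : Config N)
    (F : Config N → ℝ) (c : ℝ) (f : ℕ → ℕ → ℝ)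
    (hF : ∀ ζ', Exchanged i j ζ ζ' → F ζ' = c * f (ζ' i) (ζ' j)) :
    rateLRight lam ζ i j * (F (jump ζ i j) - F ζ) + rateLLeft lam ζ i j * (F (jump ζ j i) - F ζ)
      = c * bondL (N i) (N j) (heightL lam ζ i) f (ζ i) (ζ j) := by
  have hne : i ≠ j := by rintro rfl; omega
  rw [bondL, rateLRight, rateLLeft, heightL_succ lam ζ j, ← hij, heightL_succ lam ζ i,
    hF _ (exchanged_jump hne ζ), hF _ (exchanged_jump_symm hne ζ), hF _ (.refl i j ζ), mul_add c]
  congr 1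
  · by_cases h : 0 < (ζ i : ℕ) ∧ (ζ j : ℕ) < N j
    · rw [jump_source hne h.1 h.2, jump_target h.1 h.2]
      ring
    · have : (ζ i : ℕ) = 0 ∨ (ζ j : ℕ) = N j := by have := (ζ j).isLt; omega
      rcases this with h | h <;> simp [h]
  · by_cases h : 0 < (ζ j : ℕ) ∧ (ζ i : ℕ) < N i
    · rw [jump_source hne.symm h.1 h.2, jump_target h.1 h.2]
      ring
    · have : (ζ j : ℕ) = 0 ∨ (ζ i : ℕ) = N i := by have := (ζ i).isLt; omega
      rcases this with h | h <;> simp [h]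

lemma bond_term_right (rho : ℝ) {i j : Fin M} (hij : (i : ℕ) + 1 = j) (ξ : Config N)
    (F : Config N → ℝ) (c : ℝ) (f : ℕ → ℕ → ℝ)
    (hF : ∀ ξ', Exchanged i j ξ ξ' → F ξ' = c * f (ξ' i) (ξ' j)) :
    rateRRight rho ξ i j * (F (jump ξ i j) - F ξ) + rateRLeft rho ξ i j * (F (jump ξ j i) - F ξ)
      = c * bondR (N i) (N j) (heightR rho ξ (j + 1)) f (ξ i) (ξ j) := by
  have hne : i ≠ j := by rintro rfl; omega
  rw [bondR, rateRRight, rateRLeft, heightR_eq_succ rho ξ i, hij, heightR_eq_succ rho ξ j,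
    hF _ (exchanged_jump hne ξ), hF _ (exchanged_jump_symm hne ξ), hF _ (.refl i j ξ), mul_add c]
  congr 1
  · by_cases h : 0 < (ξ i : ℕ) ∧ (ξ j : ℕ) < N j
    · rw [jump_source hne h.1 h.2, jump_target h.1 h.2]
      ring
    · have : (ξ i : ℕ) = 0 ∨ (ξ j : ℕ) = N j := by have := (ξ j).isLt; omega
      rcases this with h | h <;> simp [h]
  · by_cases h : 0 < (ξ j : ℕ) ∧ (ξ i : ℕ) < N i
    · rw [jump_source hne.symm h.1 h.2, jump_target h.1 h.2]
      ring
    · have : (ξ j : ℕ) = 0 ∨ (ξ i : ℕ) = N i := by have := (ξ i).isLt; omega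
      rcases this with h | h <;> simp [h]

theorem isDuality_of_generic (hN : ∀ k, 0 < N k) {lam rho v : ℝ} (hg : Generic lam rho v) :
    IsDuality (generatorL N lam) (generatorR N rho) (duality lam rho v) := by
  intro ζ ξ
  simp only [generatorL, generatorR, generator]
  refine Finset.sum_congr rfl fun i _ => Finset.sum_congr rfl fun j _ => ?_
  split_ifs with hij
  swap
  · rfl
  rw [bond_term_left lam hij ζ (fun ζ' => duality lam rho v ζ' ξ) _
      (fun p q => pairDuality (N i) (N j) (heightL lam ζ i) (heightR rho ξ (j + 1)) v p q (ξ i) (ξ j))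
      (fun ζ' h => duality_exchanged lam rho v hij h (.refl i j ξ)),
    bond_term_right rho hij ξ (fun ξ' => duality lam rho v ζ ξ') _
      (fun p q => pairDuality (N i) (N j) (heightL lam ζ i) (heightR rho ξ (j + 1)) v (ζ i) (ζ j) p q)
      (fun ξ' h => duality_exchanged lam rho v hij (.refl i j ζ) h)]
  congr 1
  have hle : ∀ (η : Config N) k, (η k : ℕ) ≤ N k := fun η k => by have := (η k).isLt; omega
  exact bondDuality (hN i) (hN j) _ _ v (hg.height ζ ξ _ _) _ _ _ _ (hle ζ i) (hle ζ j) (hle ξ i)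
    (hle ξ j)

/-! ### Detailed balance -/

/-- Jumps to the left undo jumps to the right, so the balance of rightward jumps covers both
directions. -/
lemma isReversible_generator {cR cL : Config N → Fin M → Fin M → ℝ} {μ : Config N → ℝ}
    (h : ∀ (η : Config N) (i j : Fin M), (i : ℕ) + 1 = j → 0 < (η i : ℕ) → (η j : ℕ) < N j →
      μ η * cR η i j = μ (jump η i j) * cL (jump η i j) i j) :
    IsReversible (generator cR cL) μ := by
  have key : ∀ (a b : Config N) (i j : Fin M), (i : ℕ) + 1 = j → a ≠ b →
      μ a * (cR a i j * (Pi.single b 1 : Config N → ℝ) (jump a i j))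
        = μ b * (cL b i j * (Pi.single a 1 : Config N → ℝ) (jump b j i)) := by
    intro a b i j hij hab
    have hne : i ≠ j := by rintro rfl; omega
    by_cases h1 : jump a i j = b
    · have hp : 0 < (a i : ℕ) ∧ (a j : ℕ) < N j := by
        by_contra hp
        exact hab ((jump_eq_self hp).symm.trans h1)
      subst h1
      rw [jump_jump hne hp.1 hp.2, Pi.single_eq_same, Pi.single_eq_same, mul_one, mul_one]
      exact h a i j hij hp.1 hp.2
    · have h2 : jump b j i ≠ a := by
        rintro rfl
        have hp : 0 < (b j : ℕ) ∧ (b i : ℕ) < N i := by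
          by_contra hp
          exact hab (jump_eq_self hp)
        exact h1 (jump_jump hne.symm hp.1 hp.2)
      rw [Pi.single_eq_of_ne h1, Pi.single_eq_of_ne h2]
      simp
  intro a b
  by_cases hab : a = b
  · rw [hab]
  simp only [generator, Finset.mul_sum, Pi.single_eq_of_ne hab,
    Pi.single_eq_of_ne (Ne.symm hab), sub_zero]
  refine Finset.sum_congr rfl fun i _ => Finset.sum_congr rfl fun j _ => ?_
  split_ifs with hij
  · rw [mul_add, mul_add, key a b i j hij hab, key b a i j hij (Ne.symm hab), add_comm]
  · simp

lemma choose_cast_mul_sub (n k : ℕ) :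
    (n.choose (k + 1) : ℝ) * (k + 1) = n.choose k * (n - k) := by
  rcases le_or_gt k n with h | h
  · rw [← Nat.cast_sub h]
    exact_mod_cast Nat.choose_succ_right_eq n k
  · rw [Nat.choose_eq_zero_of_lt h, Nat.choose_eq_zero_of_lt (by omega)]
    simp

/-- Stated for an abstract height so that it applies to both processes: in the right process the
roles of the two sites are interchanged, since its heights accumulate from the right. -/
lemma siteWeight_pair_balance {l : ℝ} (h : ∀ m : ℤ, l ≠ m) (a b N₁ N₂ : ℕ) :
    siteWeight (a + 1) N₁ l * siteWeight b N₂ (l + 2 * (a + 1) - N₁)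
        * ((a + 1) * (N₂ - b) * (l + (a + 1)) * (l + 2 * (a + 1) - N₁ + b)
          / ((l + 2 * (a + 1) - N₁) * (l + 2 * (a + 1) - N₁ - 1)))
      = siteWeight a N₁ l * siteWeight (b + 1) N₂ (l + 2 * a - N₁)
        * ((b + 1) * (N₁ - a) * (l + a - N₁) * (l + 2 * a - N₁ + (b + 1) - N₂)
          / ((l + 2 * a - N₁) * (l + 2 * a - N₁ + 1))) := by
  obtain ⟨H, hH⟩ : ∃ H, H = l + 2 * a - N₁ := ⟨_, rfl⟩
  have h' : ∀ m : ℤ, H ≠ m := fun m hm => h (m - 2 * a + N₁) (by push_cast; linarith)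
  have h'' : ∀ m : ℤ, H + 2 ≠ m := fun m hm => h' (m - 2) (by push_cast; linarith)
  rw [show l + 2 * (a + 1) - N₁ = H + 2 by rw [hH]; ring, ← hH, siteWeight_eq h, siteWeight_eq h,
    siteWeight_eq h', siteWeight_eq h'']
  have n0 : H ≠ 0 := by simpa using h' 0
  have n1 : H + 1 ≠ 0 := fun h0 => h' (-1) (by push_cast; linarith)
  have n2 : H + 2 ≠ 0 := fun h0 => h' (-2) (by push_cast; linarith)
  have n3 : l + (a + 1) ≠ 0 := fun h0 => h (-a - 1) (by push_cast; linarith)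
  have n4 : H + 2 + b ≠ 0 := fun h0 => h' (-2 - b) (by push_cast; linarith)
  have c1 := choose_cast_mul_sub N₁ a
  have c2 := choose_cast_mul_sub N₂ b
  have p1 := mul_poch_add_one (l - N₁ + a) (N₁ + 1)
  have p2 := mul_poch_add_one (H - N₂ + b + 1) (N₂ + 1)
  have q1 := poch_int_ne_zero h (-N₁ + a + 1) (b := l - N₁ + a + 1) (by push_cast; ring) (N₁ + 1)
  have q2 := poch_int_ne_zero h' (-N₂ + b + 2) (b := H - N₂ + b + 1 + 1) (by push_cast; ring)
    (N₂ + 1)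
  have q3 := poch_int_ne_zero h (-N₁ + a) (b := l - N₁ + a) (by push_cast; ring) (N₁ + 1)
  have q4 := poch_int_ne_zero h' (-N₂ + b + 1) (b := H - N₂ + b + 1) (by push_cast; ring)
    (N₂ + 1)
  push_cast at p1 p2 ⊢
  rw [show l - (N₁ : ℝ) + a + (N₁ + 1) = l + (a + 1) by ring] at p1
  rw [show H - (N₂ : ℝ) + b + 1 + (N₂ + 1) = H + 2 + b by ring] at p2
  rw [show l - (N₁ : ℝ) + (a + 1) = l - N₁ + a + 1 by ring,
    show H + 2 - (N₂ : ℝ) + b = H - N₂ + b + 1 + 1 by ring,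
    show H - (N₂ : ℝ) + (b + 1) = H - N₂ + b + 1 by ring,
    show l - (N₁ : ℝ) + 2 * (a + 1) = H + 2 by rw [hH]; ring,
    show l - (N₁ : ℝ) + 2 * a = H by rw [hH]; ring,
    show H + 2 - (N₂ : ℝ) + 2 * b = H - N₂ + 2 * (b + 1) by ring,
    show H + 2 - 1 = H + 1 by ring,
    show l + (a : ℝ) - N₁ = l - N₁ + a by ring, show H + ((b : ℝ) + 1) - N₂ = H - N₂ + b + 1 by ring,
    show a + 1 + N₁ = a + N₁ + 1 by ring, show b + 1 + N₂ = b + N₂ + 1 by ring, pow_succ, pow_succ]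
  generalize poch (l - N₁ + a + 1) (N₁ + 1) = P1 at *
  generalize poch (l - N₁ + a) (N₁ + 1) = P1' at *
  generalize poch (H - N₂ + b + 1 + 1) (N₂ + 1) = P2 at *
  generalize poch (H - N₂ + b + 1) (N₂ + 1) = P2' at *
  generalize (-1 : ℝ) ^ (a + N₁) = s₁
  generalize (-1 : ℝ) ^ (b + N₂) = s₂
  -- Two runs of equal length shifted by one differ only in their end factors.
  have e1 : (l + (a + 1)) / P1 = (l - N₁ + a) / P1' := by
    rw [div_eq_div_iff q1 q3]; linarith
  have e2 : (H + 2 + b) / P2 = (H - N₂ + b + 1) / P2' := by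
    rw [div_eq_div_iff q2 q4]; linarith
  calc _ = s₁ * s₂ * (-1) * ((N₁.choose (a + 1) : ℝ) * (a + 1)) * (N₂.choose b * (N₂ - b))
        * ((l + (a + 1)) / P1) * ((H + 2 + b) / P2) * (H - N₂ + 2 * (b + 1)) / (H + 1) := by
        field_simp
    _ = _ := by
        rw [e1, e2, c1, ← c2]
        field_simp

lemma weightL_exchanged (lam : ℝ) {i j : Fin M} (hij : (i : ℕ) + 1 = j) {η η' : Config N}
    (h : Exchanged i j η η') :
    weightL lam η' = (∏ k ∈ (Finset.univ.erase i).erase j,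
        (-1) ^ (N k) * siteWeight (η k) (N k) (heightL lam η k)) * ((-1) ^ (N i) * (-1) ^ (N j)
      * (siteWeight (η' i) (N i) (heightL lam η i)
        * siteWeight (η' j) (N j) (heightL lam η i + 2 * ((η' i : ℕ) : ℝ) - N i))) := by
  have hne : i ≠ j := by rintro rfl; omega
  rw [weightL, prod_eq_pair_mul hne]
  congr 1
  · refine Finset.prod_congr rfl fun k hk => ?_
    rw [Finset.mem_erase, Finset.mem_erase] at hk
    have h1 : (k : ℕ) ≠ j := fun h => hk.1 (Fin.ext h)
    rw [h.off k hk.2.1 hk.1, h.heightL_eq hij lam h1]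
  · rw [h.heightL_eq hij lam (by omega : (i : ℕ) ≠ j), ← hij, heightL_succ,
      h.heightL_eq hij lam (by omega : (i : ℕ) ≠ j)]
    ring

lemma weightR_exchanged (rho : ℝ) {i j : Fin M} (hij : (i : ℕ) + 1 = j) {η η' : Config N}
    (h : Exchanged i j η η') :
    weightR rho η' = (∏ k ∈ (Finset.univ.erase i).erase j,
        siteWeight (η k) (N k) (heightR rho η (k + 1)))
      * (siteWeight (η' j) (N j) (heightR rho η (j + 1))
        * siteWeight (η' i) (N i) (heightR rho η (j + 1) + 2 * ((η' j : ℕ) : ℝ) - N j)) := by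
  have hne : i ≠ j := by rintro rfl; omega
  rw [weightR, prod_eq_pair_mul hne]
  congr 1
  · refine Finset.prod_congr rfl fun k hk => ?_
    rw [Finset.mem_erase, Finset.mem_erase] at hk
    have h1 : (k : ℕ) ≠ i := fun h => hk.2.1 (Fin.ext h)
    rw [h.off k hk.2.1 hk.1, h.heightR_eq hij rho (by omega)]
  · rw [hij, heightR_eq_succ, h.heightR_eq hij rho (by omega : (j : ℕ) + 1 ≠ j)]
    ring

theorem isReversible_weightL_of_generic {lam : ℝ} (hg : ∀ m : ℤ, lam ≠ m) :
    IsReversible (generatorL N lam) (weightL lam) := by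
  refine isReversible_generator fun η i j hij hi hj => ?_
  have hne : i ≠ j := by rintro rfl; omega
  have e : ∀ P s w r w' r' : ℝ, w * r = w' * r' → P * (s * w) * r = P * (s * w') * r' := by
    intro P s w r w' r' h; linear_combination P * s * h
  change weightL lam η * rateLRight lam η i j = weightL lam (jump η i j) * rateLLeft lam (jump η i j) i j
  rw [weightL_exchanged lam hij (.refl i j η), weightL_exchanged lam hij (exchanged_jump hne η)]
  apply e
  have ex := exchanged_jump hne η
  rw [rateLRight, rateLLeft, heightL_succ lam _ j, ← hij, heightL_succ lam _ i, heightL_succ lam _ i,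
    ex.heightL_eq hij lam (by omega : (i : ℕ) ≠ j), jump_source hne hi hj, jump_target hi hj]
  obtain ⟨m, hm⟩ := exists_heightL_eq η (i : ℕ)
  obtain ⟨a, ha⟩ : ∃ a, (η i : ℕ) = a + 1 := ⟨(η i : ℕ) - 1, by omega⟩
  rw [ha, hm, Nat.add_sub_cancel]
  have := siteWeight_pair_balance (l := lam + m)
    (fun k hk => hg (k - m) (by push_cast; linarith)) a (η j) (N i) (N j)
  push_cast
  rw [this]
  ring_nf

theorem isReversible_weightR_of_generic {rho : ℝ} (hg : ∀ m : ℤ, rho ≠ m) :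
    IsReversible (generatorR N rho) (weightR rho) := by
  refine isReversible_generator fun η i j hij hi hj => ?_
  have hne : i ≠ j := by rintro rfl; omega
  have e : ∀ P w r w' r' : ℝ, w * r = w' * r' → P * w * r = P * w' * r' := by
    intro P w r w' r' h; linear_combination P * h
  change weightR rho η * rateRRight rho η i j = weightR rho (jump η i j) * rateRLeft rho (jump η i j) i j
  rw [weightR_exchanged rho hij (.refl i j η), weightR_exchanged rho hij (exchanged_jump hne η)]
  apply e
  have ex := exchanged_jump hne η
  rw [rateRRight, rateRLeft, heightR_eq_succ rho _ i, hij, heightR_eq_succ rho _ j,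
    heightR_eq_succ rho _ j, ex.heightR_eq hij rho (by omega : (j : ℕ) + 1 ≠ j),
    jump_source hne hi hj, jump_target hi hj]
  obtain ⟨m, hm⟩ := exists_heightR_eq η ((j : ℕ) + 1)
  obtain ⟨a, ha⟩ : ∃ a, (η i : ℕ) = a + 1 := ⟨(η i : ℕ) - 1, by omega⟩
  rw [ha, hm, Nat.add_sub_cancel]
  have := siteWeight_pair_balance (l := rho + m)
    (fun k hk => hg (k - m) (by push_cast; linarith)) (η j) a (N j) (N i)
  push_cast
  refine Eq.trans ?_ (this.symm.trans ?_) <;> ring_nf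

end config

/-! ### Biorthogonality for generic parameters -/

section cons
variable {M : ℕ} {N : Fin (M + 1) → ℕ}

lemma heightL_zero (lam : ℝ) {M : ℕ} {N : Fin M → ℕ} (ζ : Config N) : heightL lam ζ 0 = lam := by
  simp [heightL]

lemma heightL_cons (lam : ℝ) (z : Fin (N 0 + 1)) (ζ : Config fun k : Fin M => N k.succ) (k : ℕ) :
    heightL lam (Fin.cons z ζ : Config N) (k + 1)
      = heightL (lam + 2 * ((z : ℕ) : ℝ) - N 0) ζ k := by
  simp only [heightL, Fin.sum_univ_succ, Fin.cons_zero, Fin.cons_succ, Fin.val_zero, Fin.val_succ,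
    Nat.add_lt_add_iff_right, Nat.succ_pos, if_true]
  ring

lemma heightR_cons (rho : ℝ) (z : Fin (N 0 + 1)) (ξ : Config fun k : Fin M => N k.succ) (k : ℕ) :
    heightR rho (Fin.cons z ξ : Config N) (k + 1) = heightR rho ξ k := by
  simp [heightR, Fin.sum_univ_succ]

lemma duality_cons (lam rho v : ℝ) (z x : Fin (N 0 + 1)) (ζ ξ : Config fun k : Fin M => N k.succ) :
    duality lam rho v (Fin.cons z ζ : Config N) (Fin.cons x ξ)
      = siteDuality z x lam (heightR rho ξ 0) v (N 0)
        * duality (lam + 2 * ((z : ℕ) : ℝ) - N 0) rho v ζ ξ := by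
  simp only [duality, Fin.prod_univ_succ, Fin.cons_zero, Fin.cons_succ, Fin.val_zero, Fin.val_succ,
    heightL_cons, heightR_cons, heightL_zero]

lemma weightL_cons (lam : ℝ) (z : Fin (N 0 + 1)) (ζ : Config fun k : Fin M => N k.succ) :
    weightL lam (Fin.cons z ζ : Config N) = (-1) ^ N 0 * siteWeight z (N 0) lam
        * weightL (lam + 2 * ((z : ℕ) : ℝ) - N 0) ζ := by
  simp only [weightL, Fin.prod_univ_succ, Fin.cons_zero, Fin.cons_succ, Fin.val_zero, Fin.val_succ,
    heightL_cons, heightL_zero]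

lemma weightR_cons (rho : ℝ) (x : Fin (N 0 + 1)) (ξ : Config fun k : Fin M => N k.succ) :
    weightR rho (Fin.cons x ξ : Config N)
      = siteWeight x (N 0) (heightR rho ξ 0) * weightR rho ξ := by
  simp only [weightR, Fin.prod_univ_succ, Fin.cons_zero, Fin.cons_succ, Fin.val_zero, Fin.val_succ,
    heightR_cons]

end cons

/-- The leftmost site is peeled off. Its left occupation `z` only changes the boundary value of the
remaining left process, and by induction the remaining sum does not depend on that value. It forces
the two tails to agree, so both first-site factors have the same right height and
`siteDuality_orthogonal` applies. -/
theorem duality_orthogonal_of_generic {M : ℕ} {N : Fin M → ℕ} {lam rho v : ℝ}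
    (hg : Generic lam rho v) (ξ ξ' : Config N) :
    ∑ ζ : Config N, duality lam rho v ζ ξ * duality lam rho (-v) ζ ξ' * weightL lam ζ
      = (if ξ = ξ' then 1 else 0) / weightR rho ξ := by
  induction M generalizing lam with
  | zero =>
    rw [if_pos (Subsingleton.elim _ _)]
    simp [duality, weightL, weightR]
  | succ M ih =>
    obtain ⟨x, ξ, rfl⟩ : ∃ (x : Fin (N 0 + 1)) (τ : Config fun k : Fin M => N k.succ),
        ξ = Fin.cons x τ := ⟨ξ 0, Fin.tail ξ, (Fin.cons_self_tail ξ).symm⟩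
    obtain ⟨x', ξ', rfl⟩ : ∃ (x' : Fin (N 0 + 1)) (τ : Config fun k : Fin M => N k.succ),
        ξ' = Fin.cons x' τ := ⟨ξ' 0, Fin.tail ξ', (Fin.cons_self_tail ξ').symm⟩
    rw [← (Fin.consEquiv fun k => Fin (N k + 1)).sum_comp, Fintype.sum_prod_type]
    simp only [Fin.cons_inj]
    have inner : ∀ z : Fin (N 0 + 1),
        ∑ ζ : Config fun k : Fin M => N k.succ,
          duality lam rho v (Fin.cons z ζ : Config N) (Fin.cons x ξ)
            * duality lam rho (-v) (Fin.cons z ζ : Config N) (Fin.cons x' ξ')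
            * weightL lam (Fin.cons z ζ : Config N)
        = siteDuality z x lam (heightR rho ξ 0) v (N 0)
          * siteDuality z x' lam (heightR rho ξ' 0) (-v) (N 0)
          * ((-1) ^ N 0 * siteWeight z (N 0) lam) * ((if ξ = ξ' then 1 else 0) / weightR rho ξ) := by
      intro z
      rw [← ih (lam := lam + 2 * ((z : ℕ) : ℝ) - N 0)
        (hg.shift (2 * (z : ℕ) - N 0) 0 (by push_cast; ring) (by simp)), Finset.mul_sum]
      refine Finset.sum_congr rfl fun ζ _ => ?_
      rw [duality_cons, duality_cons, weightL_cons]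
      ring
    have hsum := Finset.sum_congr (s₁ := (Finset.univ : Finset (Fin (N 0 + 1)))) rfl
      fun z _ => inner z
    refine hsum.trans ?_
    rw [← Finset.sum_mul, weightR_cons]
    by_cases h : ξ = ξ'
    · subst h
      have hs := Fin.sum_univ_eq_sum_range (fun z => siteDuality z x lam (heightR rho ξ 0) v (N 0)
        * siteDuality z x' lam (heightR rho ξ 0) (-v) (N 0)
        * ((-1) ^ N 0 * siteWeight z (N 0) lam)) (N 0 + 1)
      obtain ⟨n, hn⟩ := exists_heightR_eq ξ 0
      rw [hs, siteDuality_orthogonal (hg.shift 0 n (by simp) (hn rho)) (Nat.lt_succ_iff.1 x.isLt)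
        (Nat.lt_succ_iff.1 x'.isLt)]
      simp only [Fin.ext_iff, and_true, if_true]
      rw [div_mul_div_comm, mul_one]
    · simp [h]

/-- Row orthogonality implies column orthogonality. -/
lemma dual_orthogonal {ι : Type*} [Fintype ι] [DecidableEq ι] {A B : ι → ι → ℝ} {wL wR : ι → ℝ}
    (hL : ∀ i, wL i ≠ 0) (hR : ∀ i, wR i ≠ 0)
    (h : ∀ x x', ∑ z, A z x * B z x' * wL z = (if x = x' then 1 else 0) / wR x) (z z' : ι) :
    ∑ x, A z x * B z' x * wR x = (if z = z' then 1 else 0) / wL z := by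
  -- With the weights absorbed, row orthogonality says that one square matrix is a left inverse of
  -- another; commuting them gives column orthogonality.
  have h1 : (Matrix.of fun x z => A z x * wL z) * (Matrix.of fun z x => B z x * wR x)
      = (1 : Matrix ι ι ℝ) := by
    ext x x'
    rw [Matrix.mul_apply, Matrix.one_apply]
    simp only [Matrix.of_apply]
    calc ∑ z, A z x * wL z * (B z x' * wR x') = (∑ z, A z x * B z x' * wL z) * wR x' := by
          rw [Finset.sum_mul]; exact Finset.sum_congr rfl fun z _ => by ring
      _ = _ := by
          rw [h]
          split_ifs with hx
          · subst hx; have := hR x; field_simp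
          · simp
  have h2 := congrArg (fun m : Matrix ι ι ℝ => m z' z) (mul_eq_one_comm.1 h1)
  rw [Matrix.mul_apply, Matrix.one_apply] at h2
  simp only [Matrix.of_apply] at h2
  rw [eq_div_iff (hL z), Finset.sum_mul]
  rw [show (if z = z' then (1 : ℝ) else 0) = if z' = z then 1 else 0 by simp only [eq_comm], ← h2]
  exact Finset.sum_congr rfl fun x _ => by ring

/-! ### Bounds for the height functions -/

section bounds
variable {M : ℕ} {N : Fin M → ℕ}

/-- A height that omits site `i` leaves a margin of `N i` below the capacity. Every factor of the
weight at site `i` shifts that height by at most this margin. -/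
lemma abs_sum_add_le_capacity (η : Config N) (i : Fin M) (p : Fin M → Prop) [DecidablePred p]
    (hp : ¬ p i) :
    |∑ j : Fin M, if p j then 2 * ((η j : ℕ) : ℤ) - (N j : ℤ) else 0| + N i ≤ capacity N := by
  have h1 : |∑ j : Fin M, if p j then 2 * ((η j : ℕ) : ℤ) - (N j : ℤ) else 0|
      ≤ ∑ j : Fin M, if j = i then 0 else (N j : ℤ) := by
    refine (Finset.abs_sum_le_sum_abs _ _).trans (Finset.sum_le_sum fun j _ => ?_)
    have := (η j).isLt
    split_ifs with h1 h2 h2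
    · subst h2; exact absurd h1 hp
    · rw [abs_le]; constructor <;> omega
    · simp
    · simp
  have h2 : ∑ j : Fin M, (if j = i then 0 else (N j : ℤ)) + N i = capacity N := by
    rw [capacity]
    push_cast
    rw [← Finset.add_sum_erase _ _ (Finset.mem_univ i), ← Finset.add_sum_erase _ _ (Finset.mem_univ i),
      if_pos rfl, zero_add, add_comm]
    congr 1
    exact Finset.sum_congr rfl fun j hj => if_neg (Finset.ne_of_mem_erase hj)
  linarith

lemma exists_heightL_bound (ζ : Config N) (i : Fin M) :
    ∃ m : ℤ, |m| + N i ≤ capacity N ∧ ∀ lam : ℝ, heightL lam ζ i = lam + m := by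
  refine ⟨_, abs_sum_add_le_capacity ζ i (fun j => (j : ℕ) < i) (lt_irrefl _), fun lam => ?_⟩
  rw [heightL]
  push_cast
  congr 1

lemma exists_heightR_bound (ξ : Config N) (i : Fin M) :
    ∃ m : ℤ, |m| + N i ≤ capacity N ∧ ∀ rho : ℝ, heightR rho ξ (i + 1) = rho + m := by
  refine ⟨_, abs_sum_add_le_capacity ξ i (fun j => (i : ℕ) + 1 ≤ j) (by omega), fun rho => ?_⟩
  rw [heightR]
  push_cast
  congr 1

lemma WeightDefined.add_ne_zero {s : ℝ} (h : WeightDefined N s) {i : Fin M} {m : ℤ}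
    (hm : |m| + N i ≤ capacity N) {n : ℤ} (hn : |n| ≤ N i) : s + m + n ≠ 0 := by
  intro h0
  refine h (-(m + n)) ?_ (by push_cast; linarith)
  rw [abs_neg]
  exact (abs_add_le m n).trans (by linarith)

/-- No factor of the one-site weight vanishes. -/
structure SiteRegular (x N : ℕ) (r : ℝ) : Prop where
  mid : 2 * x + r - N ≠ 0
  low : r - N ≠ 0
  num : poch (r - N) x ≠ 0
  den : poch (r + 1) x ≠ 0
  den' : poch (-r) N ≠ 0

lemma siteRegular_of_ne {x N : ℕ} {r : ℝ} (hx : x ≤ N) (h : ∀ n : ℤ, |n| ≤ N → r + n ≠ 0) :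
    SiteRegular x N r where
  mid h0 := h (2 * x - N) (by rw [abs_le]; constructor <;> omega) (by push_cast; linarith)
  low h0 := h (-N) (by rw [abs_le]; constructor <;> omega) (by push_cast; linarith)
  num := poch_ne_zero fun i hi h0 =>
    h (-N + i) (by rw [abs_le]; constructor <;> omega) (by push_cast; linarith)
  den := poch_ne_zero fun i hi h0 =>
    h (1 + i) (by rw [abs_le]; constructor <;> omega) (by push_cast; linarith)
  den' := poch_ne_zero fun i hi h0 =>
    h (-i) (by rw [abs_le]; constructor <;> omega) (by push_cast; linarith)

lemma WeightDefined.siteRegularL {lam : ℝ} (h : WeightDefined N lam) (ζ : Config N) (k : Fin M) :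
    SiteRegular (ζ k) (N k) (heightL lam ζ k) := by
  obtain ⟨m, hm, e⟩ := exists_heightL_bound ζ k
  rw [e]
  exact siteRegular_of_ne (Nat.lt_succ_iff.1 (ζ k).isLt) fun n hn => h.add_ne_zero hm hn

lemma WeightDefined.siteRegularR {rho : ℝ} (h : WeightDefined N rho) (ξ : Config N) (k : Fin M) :
    SiteRegular (ξ k) (N k) (heightR rho ξ (k + 1)) := by
  obtain ⟨m, hm, e⟩ := exists_heightR_bound ξ k
  rw [e]
  exact siteRegular_of_ne (Nat.lt_succ_iff.1 (ξ k).isLt) fun n hn => h.add_ne_zero hm hn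

lemma SiteRegular.siteWeight_ne_zero {x N : ℕ} {r : ℝ} (h : SiteRegular x N r) (hx : x ≤ N) :
    siteWeight x N r ≠ 0 := by
  have := (Nat.choose_pos hx).ne'
  rw [siteWeight]
  exact mul_ne_zero (mul_ne_zero (mul_ne_zero (by simp) (div_ne_zero h.mid h.low))
    (div_ne_zero h.num (mul_ne_zero h.den h.den'))) (by exact_mod_cast this)

lemma WeightDefined.weightL_ne_zero {lam : ℝ} (h : WeightDefined N lam) (ζ : Config N) :
    weightL lam ζ ≠ 0 :=
  Finset.prod_ne_zero_iff.2 fun k _ => mul_ne_zero (by simp)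
    ((h.siteRegularL ζ k).siteWeight_ne_zero (Nat.lt_succ_iff.1 (ζ k).isLt))

lemma WeightDefined.weightR_ne_zero {rho : ℝ} (h : WeightDefined N rho) (ξ : Config N) :
    weightR rho ξ ≠ 0 :=
  Finset.prod_ne_zero_iff.2 fun k _ =>
    (h.siteRegularR ξ k).siteWeight_ne_zero (Nat.lt_succ_iff.1 (ξ k).isLt)

/-- The rate denominators shift a height by at most one, and a positive `N j` provides that margin.
-/
lemma WeightDefined.ratesDefinedL (hN : ∀ k, 0 < N k) {lam : ℝ} (h : WeightDefined N lam) :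
    RatesDefinedL N lam := by
  intro ζ i j hij
  obtain ⟨m, hm, e⟩ := exists_heightL_bound ζ j
  have hp := hN j
  have h0 := h.add_ne_zero hm (n := 0) (by simp)
  have h1 := h.add_ne_zero hm (n := 1) (by simp; omega)
  have h2 := h.add_ne_zero hm (n := -1) (by simp; omega)
  push_cast at h0 h1 h2
  rw [add_zero] at h0
  rw [hij, e]
  exact ⟨fun _ _ => mul_ne_zero h0 h2, fun _ _ => mul_ne_zero h0 h1⟩

lemma WeightDefined.ratesDefinedR (hN : ∀ k, 0 < N k) {rho : ℝ} (h : WeightDefined N rho) :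
    RatesDefinedR N rho := by
  intro ξ i j hij
  obtain ⟨m, hm, e⟩ := exists_heightR_bound ξ i
  have hp := hN i
  have h0 := h.add_ne_zero hm (n := 0) (by simp)
  have h1 := h.add_ne_zero hm (n := 1) (by simp; omega)
  have h2 := h.add_ne_zero hm (n := -1) (by simp; omega)
  push_cast at h0 h1 h2
  rw [add_zero] at h0
  rw [← hij, e]
  exact ⟨fun _ _ => mul_ne_zero h0 h1, fun _ _ => mul_ne_zero h0 h2⟩

end bounds

/-! ### Approximation by generic parameters -/

/-- The integers different from `a` form a closed set that misses `a`; if `a` is itself an integer,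
`c * t ≠ 0` excludes it. -/
lemma eventually_ne_int (a : ℝ) {c : ℝ} (hc : c ≠ 0) : ∀ᶠ t in 𝓝[≠] (0 : ℝ), ∀ m : ℤ, a + c * t ≠ m := by
  have hcl : IsClosed ((fun m : ℤ => (m : ℝ)) '' {m : ℤ | (m : ℝ) ≠ a}) :=
    Int.isClosedEmbedding_coe_real.isClosedMap _ (isClosed_discrete _)
  have hmem : ((fun m : ℤ => (m : ℝ)) '' {m : ℤ | (m : ℝ) ≠ a})ᶜ ∈ 𝓝 a :=
    hcl.isOpen_compl.mem_nhds (by rintro ⟨m, hm, rfl⟩; exact hm rfl)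
  have ht : Filter.Tendsto (fun t : ℝ => a + c * t) (𝓝[≠] 0) (𝓝 a) := by
    have : ContinuousAt (fun t : ℝ => a + c * t) 0 := by fun_prop
    have := this.tendsto
    simp only [mul_zero, add_zero] at this
    exact this.mono_left nhdsWithin_le_nhds
  filter_upwards [ht hmem, self_mem_nhdsWithin] with t h1 h2 m hm
  refine h1 ⟨m, fun h => ?_, hm.symm⟩
  rw [← hm] at h
  have : c * t = 0 := by linarith
  exact (mul_ne_zero hc h2) this

/-- The direction `(1, 3, 10)` is chosen so that all six linear forms in `Generic` have nonzero
slope. -/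
lemma eventually_generic (lam rho v : ℝ) :
    ∀ᶠ t in 𝓝[≠] (0 : ℝ), Generic (lam + t) (rho + 3 * t) (v + 10 * t) := by
  filter_upwards [eventually_ne_int lam (c := 1) (by norm_num),
    eventually_ne_int rho (c := 3) (by norm_num),
    eventually_ne_int (rho + lam + v) (c := 14) (by norm_num),
    eventually_ne_int (rho + lam - v) (c := -6) (by norm_num),
    eventually_ne_int (lam - rho + v) (c := 8) (by norm_num),
    eventually_ne_int (lam - rho - v) (c := -12) (by norm_num)] with t h1 h2 h3 h4 h5 h6
  refine ⟨fun m hm => h1 m (by linarith), fun m hm => h2 m (by linarith),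
    fun m hm => h3 m (by linarith), fun m hm => h4 m (by linarith), fun m hm => h5 m (by linarith),
    fun m hm => h6 m (by linarith)⟩

lemma eq_of_eventuallyEq_punctured {f g : ℝ → ℝ} (hf : ContinuousAt f 0) (hg : ContinuousAt g 0)
    (h : ∀ᶠ t in 𝓝[≠] (0 : ℝ), f t = g t) : f 0 = g 0 :=
  tendsto_nhds_unique_of_eventuallyEq (hf.tendsto.mono_left nhdsWithin_le_nhds)
    (hg.tendsto.mono_left nhdsWithin_le_nhds) h

/-! ### Continuity in the parameters -/

lemma continuous_poch (n : ℕ) : Continuous fun a => poch a n := by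
  unfold poch
  exact continuous_finsetProd _ fun i _ => by fun_prop

lemma poch_ne_zero_of_le {a : ℝ} {m n : ℕ} (hmn : m ≤ n) (h : poch a n ≠ 0) : poch a m ≠ 0 := by
  obtain ⟨k, rfl⟩ := Nat.exists_eq_add_of_le hmn
  rw [poch_add] at h
  exact left_ne_zero_of_mul h

section continuity
variable {l r w : ℝ → ℝ} {t₀ : ℝ}

lemma continuousAt_poch (hl : ContinuousAt l t₀) (n : ℕ) : ContinuousAt (fun t => poch (l t) n) t₀ :=
  (continuous_poch n).continuousAt.comp hl

lemma continuousAt_siteDuality (hl : ContinuousAt l t₀) (hr : ContinuousAt r t₀)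
    (hw : ContinuousAt w t₀) {y x N : ℕ} (hN : min x y ≤ N)
    (h1 : poch ((r t₀ + l t₀ - N - w t₀ + 1) / 2) (min x y) ≠ 0)
    (h2 : poch ((r t₀ + l t₀ - N + w t₀ + 1) / 2) (min x y) ≠ 0)
    (h3 : poch (-(x : ℝ) + (l t₀ - r t₀ + N + w t₀ + 1) / 2) (x + y) ≠ 0) :
    ContinuousAt (fun t => siteDuality y x (l t) (r t) (w t) N) t₀ := by
  simp only [fun t => siteDuality_eq_sum (Nat.lt_succ_self (min x y)) (l t) (r t) (w t) N, prefactor,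
    serTerm]
  refine ContinuousAt.mul (ContinuousAt.div (.mul (.mul ?_ ?_) ?_) ?_ h3)
    (tendsto_finsetSum _ fun n hn => ?_)
  · exact continuousAt_poch (by fun_prop) _
  · exact continuousAt_poch (by fun_prop) _
  · exact continuousAt_poch (by fun_prop) _
  · exact continuousAt_poch (by fun_prop) _
  have hn : n ≤ min x y := Nat.lt_succ_iff.1 (Finset.mem_range.1 hn)
  change ContinuousAt _ t₀
  refine ContinuousAt.div_const (ContinuousAt.div (.mul (.mul (.mul ?_ ?_) ?_) ?_)
    (.mul (.mul ?_ ?_) ?_) ?_) _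
  · exact continuousAt_const
  · exact continuousAt_poch (by fun_prop) _
  · exact continuousAt_const
  · exact continuousAt_poch (by fun_prop) _
  · exact continuousAt_poch (by fun_prop) _
  · exact continuousAt_poch (by fun_prop) _
  · exact continuousAt_const
  · exact mul_ne_zero (mul_ne_zero (poch_ne_zero_of_le hn h2) (poch_ne_zero_of_le hn h1))
      (poch_neg_ne_zero (hn.trans hN))

lemma continuousAt_siteWeight (hr : ContinuousAt r t₀) {x N : ℕ} (h : SiteRegular x N (r t₀)) :
    ContinuousAt (fun t => siteWeight x N (r t)) t₀ := by
  simp only [siteWeight]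
  refine .mul (.mul (.mul continuousAt_const (.div (by fun_prop) (by fun_prop) h.low))
    (.div ?_ (.mul ?_ ?_) (mul_ne_zero h.den h.den'))) continuousAt_const
  · exact continuousAt_poch (by fun_prop) _
  · exact continuousAt_poch (by fun_prop) _
  · exact continuousAt_poch (by fun_prop) _

variable {M : ℕ} {N : Fin M → ℕ}

lemma continuousAt_heightL (hl : ContinuousAt l t₀) (ζ : Config N) (i : ℕ) :
    ContinuousAt (fun t => heightL (l t) ζ i) t₀ := by
  obtain ⟨m, hm⟩ := exists_heightL_eq ζ i
  simp only [hm]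
  fun_prop

lemma continuousAt_heightR (hr : ContinuousAt r t₀) (ξ : Config N) (i : ℕ) :
    ContinuousAt (fun t => heightR (r t) ξ i) t₀ := by
  obtain ⟨m, hm⟩ := exists_heightR_eq ξ i
  simp only [hm]
  fun_prop

lemma continuousAt_duality (hl : ContinuousAt l t₀) (hr : ContinuousAt r t₀)
    (hw : ContinuousAt w t₀) (h : DualityDefined N (l t₀) (r t₀) (w t₀)) (ζ ξ : Config N) :
    ContinuousAt (fun t => duality (l t) (r t) (w t) ζ ξ) t₀ := by
  simp only [duality]
  refine tendsto_finsetProd _ fun k _ => ?_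
  obtain ⟨h1, h2, h3⟩ := h ζ ξ k
  rw [min_comm] at h1 h2
  exact continuousAt_siteDuality (continuousAt_heightL hl ζ k) (continuousAt_heightR hr ξ (k + 1)) hw
    ((min_le_right _ _).trans (Nat.lt_succ_iff.1 (ζ k).isLt)) h1 h2 h3

lemma continuousAt_weightL (hl : ContinuousAt l t₀) (h : WeightDefined N (l t₀)) (ζ : Config N) :
    ContinuousAt (fun t => weightL (l t) ζ) t₀ :=
  tendsto_finsetProd _ fun k _ => ContinuousAt.mul continuousAt_const
    (continuousAt_siteWeight (continuousAt_heightL hl ζ k) (h.siteRegularL ζ k))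

lemma continuousAt_weightR (hr : ContinuousAt r t₀) (h : WeightDefined N (r t₀)) (ξ : Config N) :
    ContinuousAt (fun t => weightR (r t) ξ) t₀ :=
  tendsto_finsetProd _ fun k _ =>
    continuousAt_siteWeight (continuousAt_heightR hr ξ (k + 1)) (h.siteRegularR ξ k)

/-- The rate of an impossible jump is identically zero along the curve, so only denominators of
possible jumps have to be controlled. -/
lemma continuousAt_exchange_rate {a b n : ℕ} (hb : b ≤ n) {A B C : ℝ → ℝ} (hA : ContinuousAt A t₀)
    (hB : ContinuousAt B t₀) (hC : ContinuousAt C t₀) (h : 0 < a → b < n → C t₀ ≠ 0) :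
    ContinuousAt (fun t => (a : ℝ) * ((n : ℝ) - b) * A t * B t / C t) t₀ := by
  by_cases hab : 0 < a ∧ b < n
  · exact .div (by fun_prop) hC (h hab.1 hab.2)
  · have : a = 0 ∨ b = n := by omega
    have e : (a : ℝ) * ((n : ℝ) - b) = 0 := by rcases this with rfl | rfl <;> simp
    simp only [e, zero_mul, zero_div]
    exact continuousAt_const

lemma continuousAt_generatorL (hl : ContinuousAt l t₀) (h : RatesDefinedL N (l t₀))
    {f : ℝ → Config N → ℝ} (hf : ∀ ζ, ContinuousAt (fun t => f t ζ) t₀) (ζ : Config N) :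
    ContinuousAt (fun t => generatorL N (l t) (f t) ζ) t₀ := by
  simp only [generatorL, generator, rateLRight, rateLLeft]
  refine tendsto_finsetSum _ fun i _ => tendsto_finsetSum _ fun j _ => ?_
  split_ifs with hij
  swap
  · exact tendsto_const_nhds
  have c := fun k => continuousAt_heightL hl ζ k
  have ci := c i
  have cj := c j
  have ci' := c (i + 1)
  have cj' := c (j + 1)
  exact .add (.mul (continuousAt_exchange_rate (Nat.lt_succ_iff.1 (ζ j).isLt) (by fun_prop)
      (by fun_prop) (by fun_prop) (h ζ i j hij).1) (.sub (hf _) (hf _)))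
    (.mul (continuousAt_exchange_rate (Nat.lt_succ_iff.1 (ζ i).isLt) (by fun_prop)
      (by fun_prop) (by fun_prop) (h ζ i j hij).2) (.sub (hf _) (hf _)))

lemma continuousAt_generatorR (hr : ContinuousAt r t₀) (h : RatesDefinedR N (r t₀))
    {f : ℝ → Config N → ℝ} (hf : ∀ ξ, ContinuousAt (fun t => f t ξ) t₀) (ξ : Config N) :
    ContinuousAt (fun t => generatorR N (r t) (f t) ξ) t₀ := by
  simp only [generatorR, generator, rateRRight, rateRLeft]
  refine tendsto_finsetSum _ fun i _ => tendsto_finsetSum _ fun j _ => ?_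
  split_ifs with hij
  swap
  · exact tendsto_const_nhds
  have c := fun k => continuousAt_heightR hr ξ k
  have ci := c i
  have cj := c j
  have cj' := c (j + 1)
  exact .add (.mul (continuousAt_exchange_rate (Nat.lt_succ_iff.1 (ξ j).isLt) (by fun_prop)
      (by fun_prop) (by fun_prop) (h ξ i j hij).1) (.sub (hf _) (hf _)))
    (.mul (continuousAt_exchange_rate (Nat.lt_succ_iff.1 (ξ i).isLt) (by fun_prop)
      (by fun_prop) (by fun_prop) (h ξ i j hij).2) (.sub (hf _) (hf _)))

end continuity

/-! ### Duality, reversibility and biorthogonality -/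

section main
variable {M : ℕ} {N : Fin M → ℕ} {lam rho v : ℝ}

theorem isDuality_duality (hN : ∀ k, 0 < N k) (hv : DualityDefined N lam rho v)
    (hL : RatesDefinedL N lam) (hR : RatesDefinedR N rho) :
    IsDuality (generatorL N lam) (generatorR N rho) (duality lam rho v) := by
  intro ζ ξ
  have cl : ContinuousAt (fun t : ℝ => lam + t) 0 := by fun_prop
  have cr : ContinuousAt (fun t : ℝ => rho + 3 * t) 0 := by fun_prop
  have cw : ContinuousAt (fun t : ℝ => v + 10 * t) 0 := by fun_prop
  have cd := fun ζ ξ => continuousAt_duality cl cr cw (N := N) (by simpa using hv) ζ ξ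
  have := eq_of_eventuallyEq_punctured
    (continuousAt_generatorL (N := N) cl (by simpa using hL) (fun ζ => cd ζ ξ) ζ)
    (continuousAt_generatorR (N := N) cr (by simpa using hR) (fun ξ => cd ζ ξ) ξ)
    ((eventually_generic lam rho v).mono fun t ht => isDuality_of_generic hN ht ζ ξ)
  simpa using this

theorem isReversible_weightL (hN : ∀ k, 0 < N k) (h : WeightDefined N lam) :
    IsReversible (generatorL N lam) (weightL lam) := by
  intro a b
  have cl : ContinuousAt (fun t : ℝ => lam + 1 * t) 0 := by fun_prop
  have h0 : WeightDefined N (lam + 1 * 0) := by simpa using h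
  have cg := fun a b => continuousAt_generatorL (N := N) cl (h0.ratesDefinedL hN)
    (f := fun _ => Pi.single a 1) (fun ζ => continuousAt_const) b
  have := eq_of_eventuallyEq_punctured
    (.mul (continuousAt_weightL cl h0 a) (cg b a))
    (.mul (continuousAt_weightL cl h0 b) (cg a b))
    ((eventually_ne_int lam one_ne_zero).mono fun t ht => isReversible_weightL_of_generic ht a b)
  simpa using this

theorem isReversible_weightR (hN : ∀ k, 0 < N k) (h : WeightDefined N rho) :
    IsReversible (generatorR N rho) (weightR rho) := by
  intro a b
  have cr : ContinuousAt (fun t : ℝ => rho + 1 * t) 0 := by fun_prop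
  have h0 : WeightDefined N (rho + 1 * 0) := by simpa using h
  have cg := fun a b => continuousAt_generatorR (N := N) cr (h0.ratesDefinedR hN)
    (f := fun _ => Pi.single a 1) (fun ζ => continuousAt_const) b
  have := eq_of_eventuallyEq_punctured
    (.mul (continuousAt_weightR cr h0 a) (cg b a))
    (.mul (continuousAt_weightR cr h0 b) (cg a b))
    ((eventually_ne_int rho one_ne_zero).mono fun t ht => isReversible_weightR_of_generic ht a b)
  simpa using this

theorem duality_orthogonal (hL : WeightDefined N lam) (hR : WeightDefined N rho)
    (hv : DualityDefined N lam rho v) (hv' : DualityDefined N lam rho (-v)) (ξ ξ' : Config N) :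
    ∑ ζ : Config N, duality lam rho v ζ ξ * duality lam rho (-v) ζ ξ' * weightL lam ζ
      = (if ξ = ξ' then 1 else 0) / weightR rho ξ := by
  have cl : ContinuousAt (fun t : ℝ => lam + t) 0 := by fun_prop
  have cr : ContinuousAt (fun t : ℝ => rho + 3 * t) 0 := by fun_prop
  have cw : ContinuousAt (fun t : ℝ => v + 10 * t) 0 := by fun_prop
  have h0 : WeightDefined N (lam + 0) := by simpa using hL
  have h0' : WeightDefined N (rho + 3 * 0) := by simpa using hR
  have cd := fun ζ ξ => continuousAt_duality cl cr cw (N := N) (by simpa using hv) ζ ξ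
  have cd' := fun ζ ξ => continuousAt_duality cl cr cw.neg (N := N) (by simpa using hv') ζ ξ
  have c1 : ContinuousAt (fun t : ℝ => ∑ ζ : Config N, duality (lam + t) (rho + 3 * t) (v + 10 * t) ζ ξ
      * duality (lam + t) (rho + 3 * t) (-(v + 10 * t)) ζ ξ' * weightL (lam + t) ζ) 0 :=
    tendsto_finsetSum _ fun ζ _ => ((cd ζ ξ).mul (cd' ζ ξ')).mul (continuousAt_weightL cl h0 ζ)
  have c2 : ContinuousAt (fun t : ℝ => (if ξ = ξ' then (1 : ℝ) else 0) / weightR (rho + 3 * t) ξ) 0 :=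
    .div continuousAt_const (continuousAt_weightR cr h0' ξ) (h0'.weightR_ne_zero ξ)
  have := eq_of_eventuallyEq_punctured c1 c2
    ((eventually_generic lam rho v).mono fun t ht => duality_orthogonal_of_generic ht ξ ξ')
  simpa using this

end main

/-! ### Limits of `q`-shifted factorials -/

/-- The limit is the derivative of `q ^ a` at `1`, divided by the limit of `1 + q`. -/
lemma tendsto_one_sub_rpow_div (a : ℝ) :
    Filter.Tendsto (fun q : ℝ => (1 - q ^ a) / (1 - q ^ 2)) (𝓝[≠] 1) (𝓝 (a / 2)) := by
  have h1 : Filter.Tendsto (fun q : ℝ => (q ^ a - 1) / (q - 1)) (𝓝[≠] 1) (𝓝 a) := by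
    have := (Real.hasDerivAt_rpow_const (x := 1) (p := a) (Or.inl one_ne_zero))
    rw [hasDerivAt_iff_tendsto_slope] at this
    simpa [slope_fun_def_field] using this
  have h2 : Filter.Tendsto (fun q : ℝ => 1 + q) (𝓝[≠] 1) (𝓝 2) := by
    have : Filter.Tendsto (fun q : ℝ => 1 + q) (𝓝 1) (𝓝 (1 + 1)) :=
      (continuous_const.add continuous_id).tendsto 1
    rw [one_add_one_eq_two] at this
    exact this.mono_left nhdsWithin_le_nhds
  refine (h1.div h2 two_ne_zero).congr' ?_
  filter_upwards [self_mem_nhdsWithin] with q hq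
  have : q - 1 ≠ 0 := sub_ne_zero.2 hq
  simp only [Pi.div_apply]
  rw [div_div, ← neg_div_neg_eq]
  congr 1 <;> ring

lemma eventually_pos_ne_one : ∀ᶠ q : ℝ in 𝓝[≠] 1, 0 < q ∧ q ≠ 1 := by
  filter_upwards [self_mem_nhdsWithin, nhdsWithin_le_nhds (lt_mem_nhds one_pos)] with q h1 h2
  exact ⟨h2, h1⟩

lemma one_sub_sq_ne_zero {q : ℝ} (h0 : 0 < q) (h1 : q ≠ 1) : (1 - (q : ℂ) ^ 2) ≠ 0 := by
  intro h
  have h2 : 1 - q ^ 2 = 0 := by exact_mod_cast h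
  have h3 : (1 - q) * (1 + q) = 0 := by linarith
  rcases mul_eq_zero.1 h3 with h4 | h4
  · exact h1 (by linarith)
  · linarith

lemma tendsto_rpow_one (a : ℝ) :
    Filter.Tendsto (fun q : ℝ => ((q ^ a : ℝ) : ℂ)) (𝓝[≠] 1) (𝓝 1) := by
  have : ContinuousAt (fun q : ℝ => ((q ^ a : ℝ) : ℂ)) 1 :=
    Complex.continuous_ofReal.continuousAt.comp (Real.continuousAt_rpow_const 1 a (Or.inl one_ne_zero))
  have := this.tendsto
  simp only [Real.one_rpow, Complex.ofReal_one] at this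
  exact this.mono_left nhdsWithin_le_nhds

lemma tendsto_one_sub_rpow_div_complex (a : ℝ) :
    Filter.Tendsto (fun q : ℝ => (1 - ((q ^ a : ℝ) : ℂ)) / (1 - (q : ℂ) ^ 2)) (𝓝[≠] 1)
      (𝓝 ((a / 2 : ℝ) : ℂ)) := by
  have := (Complex.continuous_ofReal.tendsto _).comp (tendsto_one_sub_rpow_div a)
  refine this.congr fun q => ?_
  simp

lemma tendsto_qpoch_div (a : ℝ) (n : ℕ) :
    Filter.Tendsto (fun q : ℝ => qpoch ((q ^ a : ℝ) : ℂ) ((q : ℂ) ^ 2) n / (1 - (q : ℂ) ^ 2) ^ n)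
      (𝓝[≠] 1) (𝓝 ((poch (a / 2) n : ℝ) : ℂ)) := by
  simp only [poch, Complex.ofReal_prod]
  have := tendsto_finsetProd (Finset.range n) fun i _ =>
    tendsto_one_sub_rpow_div_complex (a + 2 * i)
  simp only [show ∀ i : ℕ, (a + 2 * i) / 2 = a / 2 + i by intro i; ring] at this
  refine this.congr' ?_
  filter_upwards [eventually_pos_ne_one] with q hq
  rw [qpoch, Finset.prod_div_distrib, Finset.prod_const, Finset.card_range]
  congr 1
  refine Finset.prod_congr rfl fun i _ => ?_
  rw [Real.rpow_add hq.1, Real.rpow_mul hq.1.le]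
  push_cast
  rw [Real.rpow_natCast, Real.rpow_ofNat]
  push_cast; rfl

/-! ### Powers with shifted exponents -/

lemma qpow_ofReal {q : ℝ} (h : 0 < q) (s : ℝ) : qpow q s = ((q ^ s : ℝ) : ℂ) := by
  rw [qpow, Complex.ofReal_cpow h.le]

/-- The integer `n` counts how often `2 * τ` occurs in the exponent; each occurrence gives a sign.
Leaving `τ` abstract covers the bases `q` and `q⁻¹` together. -/
lemma qpow_shifted {q : ℝ} (h : 0 < q) {τ : ℂ} (hτ : qpow q (2 * τ) = -1) (s : ℝ) (n : ℤ) {z : ℂ}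
    (hz : z = s + n * (2 * τ)) : qpow q z = (-1) ^ n * ((q ^ s : ℝ) : ℂ) := by
  have hq : (q : ℂ) ≠ 0 := by exact_mod_cast h.ne'
  rw [hz, ← qpow_ofReal h, ← hτ]
  simp only [qpow]
  rw [Complex.cpow_add _ _ hq, Complex.cpow_int_mul, mul_comm]

lemma rpow_add_ofReal {q : ℝ} (h : 0 < q) (a b : ℝ) :
    ((q ^ a : ℝ) : ℂ) * ((q ^ b : ℝ) : ℂ) = ((q ^ (a + b) : ℝ) : ℂ) := by
  rw [Real.rpow_add h]; push_cast; rfl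

lemma pow_sq_ofReal {q : ℝ} (h : 0 < q) (n : ℕ) :
    ((q : ℂ) ^ 2) ^ n = ((q ^ (2 * n : ℝ) : ℝ) : ℂ) := by
  rw [Real.rpow_mul h.le, Real.rpow_natCast, Real.rpow_ofNat]; push_cast; rfl

lemma inv_pow_sq_ofReal {q : ℝ} (h : 0 < q) (n : ℕ) :
    (((q : ℂ) ^ 2) ^ n)⁻¹ = ((q ^ (-(2 * n) : ℝ) : ℝ) : ℂ) := by
  rw [pow_sq_ofReal h, Real.rpow_neg h.le]; push_cast; rfl

lemma qpow_two_mul_quarter_period {q : ℝ} (h0 : 0 < q) (h1 : q ≠ 1) :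
    qpow q (2 * (Complex.I * Real.pi / (2 * (Real.log q : ℂ)))) = -1 := by
  have hq : (q : ℂ) ≠ 0 := by exact_mod_cast h0.ne'
  have hl : (Real.log q : ℂ) ≠ 0 := by
    exact_mod_cast Real.log_ne_zero_of_pos_of_ne_one h0 h1
  rw [qpow, Complex.cpow_def_of_ne_zero hq, ← Complex.ofReal_log h0.le, ← Complex.exp_pi_mul_I]
  congr 1
  field_simp

lemma qpow_inv_two_mul_quarter_period {q : ℝ} (h0 : 0 < q) (h1 : q ≠ 1) :
    qpow q (2 * (Complex.I * Real.pi / (2 * (Real.log q⁻¹ : ℂ)))) = -1 := by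
  have hq : (q : ℂ) ≠ 0 := by exact_mod_cast h0.ne'
  have hl : (Real.log q : ℂ) ≠ 0 := by
    exact_mod_cast Real.log_ne_zero_of_pos_of_ne_one h0 h1
  rw [qpow, Complex.cpow_def_of_ne_zero hq, ← Complex.ofReal_log h0.le, Real.log_inv]
  have : (Real.log q : ℂ) * (2 * (Complex.I * Real.pi / (2 * ((-Real.log q : ℝ) : ℂ))))
      = -(Real.pi * Complex.I) := by
    push_cast; field_simp
  rw [this, Complex.exp_neg, Complex.exp_pi_mul_I]
  norm_num

/-! ### Limit of the weights -/

lemma qpoch_eq_qpoch_rpow {q : ℝ} (n : ℕ) :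
    qpoch ((q : ℂ) ^ 2) ((q : ℂ) ^ 2) n = qpoch ((q ^ (2 : ℝ) : ℝ) : ℂ) ((q : ℂ) ^ 2) n := by
  rw [Real.rpow_ofNat]; push_cast; rfl

lemma poch_one_eq_factorial (n : ℕ) : poch 1 n = n.factorial := by
  induction n with
  | zero => simp
  | succ n ih => rw [poch_succ, ih, Nat.factorial_succ]; push_cast; ring

lemma tendsto_qpoch_self_div (n : ℕ) :
    Filter.Tendsto (fun q : ℝ => qpoch ((q : ℂ) ^ 2) ((q : ℂ) ^ 2) n / (1 - (q : ℂ) ^ 2) ^ n)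
      (𝓝[≠] 1) (𝓝 (n.factorial : ℂ)) := by
  have := tendsto_qpoch_div 2 n
  rw [div_self two_ne_zero, poch_one_eq_factorial] at this
  simpa only [qpoch_eq_qpoch_rpow, Complex.ofReal_natCast] using this

lemma tendsto_qbinom {N x : ℕ} (hx : x ≤ N) :
    Filter.Tendsto (fun q : ℝ => qbinom ((q : ℂ) ^ 2) N x) (𝓝[≠] 1) (𝓝 (N.choose x : ℂ)) := by
  have h1 := tendsto_qpoch_self_div N
  have h2 := (tendsto_qpoch_self_div x).mul (tendsto_qpoch_self_div (N - x))
  have hne : ((x.factorial : ℂ) * ((N - x).factorial : ℂ)) ≠ 0 :=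
    mul_ne_zero (by exact_mod_cast x.factorial_ne_zero) (by exact_mod_cast (N - x).factorial_ne_zero)
  have h := h1.div h2 hne
  rw [Nat.cast_choose ℂ hx]
  refine h.congr' ?_
  filter_upwards [eventually_pos_ne_one] with q hq
  have hu := one_sub_sq_ne_zero hq.1 hq.2
  obtain ⟨k, rfl⟩ := Nat.exists_eq_add_of_le hx
  simp only [Pi.div_apply, qbinom, Nat.add_sub_cancel_left, pow_add]
  rw [div_mul_div_comm, div_div_div_cancel_right₀ (mul_ne_zero (pow_ne_zero _ hu) (pow_ne_zero _ hu))]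

/-- All factors `1 - q^a` balance except the `N` of the last factorial in the denominator, which the
power of `1 - q^2` compensates. The sign `(-1)^x` comes from the shift in the pure power of `q`. -/
lemma tendsto_qSiteWeight {x N : ℕ} {r : ℝ} (hx : x ≤ N) (h : SiteRegular x N r) {τ : ℝ → ℂ}
    (hτ : ∀ q : ℝ, 0 < q → q ≠ 1 → qpow q (2 * τ q) = -1) :
    Filter.Tendsto (fun q : ℝ => (1 - (q : ℂ) ^ 2) ^ N * qSiteWeight x N (r + τ q) q) (𝓝[≠] 1)
      (𝓝 ((siteWeight x N r : ℝ) : ℂ)) := by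
  have c : ∀ {z : ℝ}, z ≠ 0 → (z : ℂ) ≠ 0 := fun hz => by exact_mod_cast hz
  have t1 := tendsto_one_sub_rpow_div_complex (4 * x + 2 * r - 2 * N)
  have t2 := tendsto_one_sub_rpow_div_complex (2 * r - 2 * N)
  have t3 := tendsto_qpoch_div (2 * r - 2 * N) x
  have t4 := tendsto_qpoch_div (2 * r + 2) x
  have t5 := (tendsto_rpow_one (-x * (2 * r + 1 + x - 2 * N))).const_mul ((-1) ^ x)
  have t6 := tendsto_qpoch_div (-2 * r) N
  rw [show (2 * r - 2 * N) / 2 = r - N by ring] at t2 t3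
  rw [show (4 * x + 2 * r - 2 * N) / 2 = 2 * x + r - N by ring] at t1
  rw [show (2 * r + 2) / 2 = r + 1 by ring] at t4
  rw [show -2 * r / 2 = -r by ring] at t6
  have t := (((t1.div t2 (c h.low)).mul (t3.div t4 (c h.den))).mul (t5.div t6 (c h.den'))).mul
    (tendsto_qbinom hx)
  convert t.congr' ?_ using 2
  · rw [siteWeight]
    push_cast
    generalize (poch (r - N) x : ℂ) = a
    generalize (poch (r + 1) x : ℂ) = b
    generalize (poch (-r) N : ℂ) = d
    simp only [div_eq_mul_inv, mul_inv]
    ring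
  · filter_upwards [eventually_pos_ne_one] with q hq
    have hu := one_sub_sq_ne_zero hq.1 hq.2
    have hs := fun s n z => qpow_shifted hq.1 (hτ q hq.1 hq.2) s n (z := z)
    simp only [Pi.div_apply, qSiteWeight]
    rw [hs (4 * x + 2 * r - 2 * N) 1 _ (by push_cast; ring),
      hs (2 * r - 2 * N) 1 _ (by push_cast; ring), hs (2 * r + 2) 1 _ (by push_cast; ring),
      hs (-x * (2 * r + 1 + x - 2 * N)) (-x) _ (by push_cast; ring),
      hs (-2 * r) (-1) _ (by push_cast; ring)]
    have e1 : ((-1 : ℂ) ^ (-(x : ℤ))) = (-1) ^ x := by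
      rw [zpow_neg, zpow_natCast, ← inv_pow]; norm_num
    rw [e1, div_div_div_cancel_right₀ hu, div_div_div_cancel_right₀ (pow_ne_zero _ hu),
      div_div_eq_mul_div]
    norm_num [← sub_eq_add_neg]
    ring

/-! ### Limit of the `q`-Racah polynomials -/

lemma qpoch_rpow_neg_eq_zero {q : ℝ} (h : 0 < q) {x n : ℕ} (hn : x < n) :
    qpoch ((q ^ (-(2 * x) : ℝ) : ℝ) : ℂ) ((q : ℂ) ^ 2) n = 0 := by
  refine Finset.prod_eq_zero (Finset.mem_range.2 hn) ?_
  rw [pow_sq_ofReal h, rpow_add_ofReal h, neg_add_cancel, Real.rpow_zero, Complex.ofReal_one,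
    sub_self]

lemma qRacah_rpow {q : ℝ} (h : 0 < q) {x y m : ℕ} (hm : min x y < m) (a b c d : ℝ) :
    qRacah x y ((q ^ a : ℝ) : ℂ) ((q ^ b : ℝ) : ℂ) ((q ^ c : ℝ) : ℂ) ((q ^ d : ℝ) : ℂ) ((q : ℂ) ^ 2)
      = ∑ n ∈ Finset.range m,
        qpoch ((q ^ (-(2 * x) : ℝ) : ℝ) : ℂ) ((q : ℂ) ^ 2) n
          * qpoch ((q ^ (a + b + 2 * (x + 1 : ℕ)) : ℝ) : ℂ) ((q : ℂ) ^ 2) n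
          * qpoch ((q ^ (-(2 * y) : ℝ) : ℝ) : ℂ) ((q : ℂ) ^ 2) n
          * qpoch ((q ^ (c + d + 2 * (y + 1 : ℕ)) : ℝ) : ℂ) ((q : ℂ) ^ 2) n
          / (qpoch ((q ^ (a + 2 * (1 : ℕ)) : ℝ) : ℂ) ((q : ℂ) ^ 2) n
            * qpoch ((q ^ (b + d + 2 * (1 : ℕ)) : ℝ) : ℂ) ((q : ℂ) ^ 2) n
            * qpoch ((q ^ (c + 2 * (1 : ℕ)) : ℝ) : ℂ) ((q : ℂ) ^ 2) n)
          * (((q : ℂ) ^ 2) ^ n / qpoch ((q : ℂ) ^ 2) ((q : ℂ) ^ 2) n) := by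
  have e1 : ∀ s : ℝ, ((q ^ s : ℝ) : ℂ) * (q : ℂ) ^ 2 = ((q ^ (s + 2 * (1 : ℕ)) : ℝ) : ℂ) := by
    intro s
    rw [← rpow_add_ofReal h, ← pow_sq_ofReal h, pow_one]
  have e : ∀ (s : ℝ) (k : ℕ), ((q ^ s : ℝ) : ℂ) * ((q : ℂ) ^ 2) ^ k
      = ((q ^ (s + 2 * k) : ℝ) : ℂ) := by
    intro s k
    rw [← rpow_add_ofReal h, ← pow_sq_ofReal h]
  simp only [qRacah, qhyper, List.map_cons, List.map_nil, List.prod_cons, List.prod_nil, mul_one,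
    rpow_add_ofReal h, e, e1, inv_pow_sq_ofReal h]
  rw [tsum_eq_sum (s := Finset.range m)]
  · refine Finset.sum_congr rfl fun n _ => ?_
    simp only [mul_assoc]
  · intro n hn
    rw [Finset.mem_range, not_lt] at hn
    rcases lt_or_ge x n with h1 | h1
    · rw [qpoch_rpow_neg_eq_zero h h1]; simp
    · rw [qpoch_rpow_neg_eq_zero h (x := y) (n := n) (by omega)]; simp

lemma tendsto_sq_pow (n : ℕ) :
    Filter.Tendsto (fun q : ℝ => ((q : ℂ) ^ 2) ^ n) (𝓝[≠] 1) (𝓝 1) := by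
  have h : Continuous fun q : ℝ => ((q : ℂ) ^ 2) ^ n := by fun_prop
  simpa using (h.tendsto 1).mono_left nhdsWithin_le_nhds

/-- The sum is finite with a range independent of `q`, so the limit is taken term by term; each term
has equally many `1 - q^a` above and below. -/
lemma tendsto_qRacah {x y : ℕ} {a b c d : ℝ} (hA : poch (a / 2 + 1) (min x y) ≠ 0)
    (hB : poch (b / 2 + d / 2 + 1) (min x y) ≠ 0) (hC : poch (c / 2 + 1) (min x y) ≠ 0) :
    Filter.Tendsto (fun q : ℝ => qRacah x y ((q ^ a : ℝ) : ℂ) ((q ^ b : ℝ) : ℂ) ((q ^ c : ℝ) : ℂ)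
        ((q ^ d : ℝ) : ℂ) ((q : ℂ) ^ 2)) (𝓝[≠] 1)
      (𝓝 ((racah x y (a / 2) (b / 2) (c / 2) (d / 2) : ℝ) : ℂ)) := by
  have hm := Nat.lt_succ_self (min x y)
  rw [racah_eq_sum hm, Complex.ofReal_sum]
  have key := tendsto_finsetSum (Finset.range (min x y).succ) (f := fun n (q : ℝ) =>
      qpoch ((q ^ (-(2 * x) : ℝ) : ℝ) : ℂ) ((q : ℂ) ^ 2) n
          * qpoch ((q ^ (a + b + 2 * (x + 1 : ℕ)) : ℝ) : ℂ) ((q : ℂ) ^ 2) n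
          * qpoch ((q ^ (-(2 * y) : ℝ) : ℝ) : ℂ) ((q : ℂ) ^ 2) n
          * qpoch ((q ^ (c + d + 2 * (y + 1 : ℕ)) : ℝ) : ℂ) ((q : ℂ) ^ 2) n
          / (qpoch ((q ^ (a + 2 * (1 : ℕ)) : ℝ) : ℂ) ((q : ℂ) ^ 2) n
            * qpoch ((q ^ (b + d + 2 * (1 : ℕ)) : ℝ) : ℂ) ((q : ℂ) ^ 2) n
            * qpoch ((q ^ (c + 2 * (1 : ℕ)) : ℝ) : ℂ) ((q : ℂ) ^ 2) n)
          * (((q : ℂ) ^ 2) ^ n / qpoch ((q : ℂ) ^ 2) ((q : ℂ) ^ 2) n)) (x := 𝓝[≠] 1)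
    (a := fun n => ((serTerm (-(x : ℝ)) (x + a / 2 + b / 2 + 1) (-(y : ℝ)) (y + c / 2 + d / 2 + 1)
      (a / 2 + 1) (b / 2 + d / 2 + 1) (c / 2 + 1) n : ℝ) : ℂ)) ?_
  · refine key.congr' ?_
    filter_upwards [eventually_pos_ne_one] with q hq
    rw [qRacah_rpow hq.1 hm]
  intro n hn
  have hn : n ≤ min x y := Nat.lt_succ_iff.1 (Finset.mem_range.1 hn)
  have cz : ∀ {z : ℝ}, z ≠ 0 → (z : ℂ) ≠ 0 := fun hz => by exact_mod_cast hz
  have hf : (n.factorial : ℂ) ≠ 0 := by exact_mod_cast n.factorial_ne_zero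
  have t1 := tendsto_qpoch_div (-(2 * x)) n
  have t2 := tendsto_qpoch_div (a + b + 2 * (x + 1 : ℕ)) n
  have t3 := tendsto_qpoch_div (-(2 * y)) n
  have t4 := tendsto_qpoch_div (c + d + 2 * (y + 1 : ℕ)) n
  have t5 := tendsto_qpoch_div (a + 2 * (1 : ℕ)) n
  have t6 := tendsto_qpoch_div (b + d + 2 * (1 : ℕ)) n
  have t7 := tendsto_qpoch_div (c + 2 * (1 : ℕ)) n
  rw [show (-(2 * x) : ℝ) / 2 = -x by ring] at t1
  rw [show (a + b + 2 * (x + 1 : ℕ)) / 2 = x + a / 2 + b / 2 + 1 by push_cast; ring] at t2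
  rw [show (-(2 * y) : ℝ) / 2 = -y by ring] at t3
  rw [show (c + d + 2 * (y + 1 : ℕ)) / 2 = y + c / 2 + d / 2 + 1 by push_cast; ring] at t4
  rw [show (a + 2 * (1 : ℕ)) / 2 = a / 2 + 1 by push_cast; ring] at t5
  rw [show (b + d + 2 * (1 : ℕ)) / 2 = b / 2 + d / 2 + 1 by push_cast; ring] at t6
  rw [show (c + 2 * (1 : ℕ)) / 2 = c / 2 + 1 by push_cast; ring] at t7
  have t := ((((t1.mul t2).mul t3).mul t4).div ((t5.mul t6).mul t7)
    (mul_ne_zero (mul_ne_zero (cz (poch_ne_zero_of_le hn hA)) (cz (poch_ne_zero_of_le hn hB)))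
      (cz (poch_ne_zero_of_le hn hC)))).mul ((tendsto_sq_pow n).div (tendsto_qpoch_self_div n) hf)
  convert t.congr' ?_ using 2
  · rw [serTerm]
    push_cast
    ring
  · filter_upwards [eventually_pos_ne_one] with q hq
    have hu := pow_ne_zero n (one_sub_sq_ne_zero hq.1 hq.2)
    simp only [Pi.div_apply]
    generalize (1 - (q : ℂ) ^ 2) ^ n = u at hu ⊢
    simp only [div_eq_mul_inv, mul_inv, inv_inv]
    field_simp

/-! ### Limit of the duality functions -/

/-- The prefactor has `x + y + N` vanishing factors above and `x + y` below, hence the power `N`.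
The exponent `y * (y + rho + lam - N)` contains `2 * τ` exactly `y` times, which produces `(-1)^y`.
-/
lemma tendsto_qSiteDuality {x y N : ℕ} {l r w : ℝ} (hN : min x y ≤ N)
    (h1 : poch ((r + l - N - w + 1) / 2) (min x y) ≠ 0)
    (h2 : poch ((r + l - N + w + 1) / 2) (min x y) ≠ 0)
    (h3 : poch (-(x : ℝ) + (l - r + N + w + 1) / 2) (x + y) ≠ 0) {τ : ℝ → ℂ}
    (hτ : ∀ q : ℝ, 0 < q → q ≠ 1 → qpow q (2 * τ q) = -1) :
    Filter.Tendsto (fun q : ℝ => ((1 - (q : ℂ) ^ 2) ^ N)⁻¹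
        * qSiteDuality y x (l + τ q) (r + τ q) ((q ^ w : ℝ) : ℂ) N q) (𝓝[≠] 1)
      (𝓝 (((-1) ^ y * siteDuality y x l r w N : ℝ) : ℂ)) := by
  have hR : Filter.Tendsto _ _ _ := tendsto_qRacah (x := x) (y := y) (a := -w + (r + l - N - 1))
    (b := w + (r - l - N - 1)) (c := -2 * N - 2) (d := 2 * l)
    (by convert h1 using 2; ring) (by convert h2 using 2; ring)
    (by convert poch_neg_ne_zero hN using 2; ring)
  have t0 := (tendsto_rpow_one (w * y - y * (y + r + l - N))).const_mul ((-1) ^ y)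
  have t1 := tendsto_qpoch_div (w + (r + l - N + 1)) x
  have t2 := tendsto_qpoch_div (-w + (r + l - N + 1)) y
  have t3 := tendsto_qpoch_div (w + (2 * y - r + l - N + 1)) N
  have t4 := tendsto_qpoch_div (w + (-2 * x - r + l + N + 1)) (x + y)
  rw [show (w + (r + l - N + 1)) / 2 = (r + l - N + w + 1) / 2 by ring] at t1
  rw [show (-w + (r + l - N + 1)) / 2 = (r + l - N - w + 1) / 2 by ring] at t2
  rw [show (w + (2 * y - r + l - N + 1)) / 2 = y + (l - r - N + w + 1) / 2 by ring] at t3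
  rw [show (w + (-2 * x - r + l + N + 1)) / 2 = -(x : ℝ) + (l - r + N + w + 1) / 2 by ring] at t4
  have t := (t0.mul (((t1.mul t2).mul t3).div t4 (by exact_mod_cast h3))).mul hR
  convert t.congr' ?_ using 2
  · rw [siteDuality]
    rw [show (-w + (r + l - N - 1)) / 2 = (r + l - N - w - 1) / 2 by ring,
      show (w + (r - l - N - 1)) / 2 = (r - l - N + w - 1) / 2 by ring,
      show (-2 * (N : ℝ) - 2) / 2 = -(N : ℝ) - 1 by ring, show 2 * l / 2 = l by ring]
    push_cast
    ring
  · filter_upwards [eventually_pos_ne_one] with q hq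
    have hu := one_sub_sq_ne_zero hq.1 hq.2
    have hs := fun s n z => qpow_shifted hq.1 (hτ q hq.1 hq.2) s n (z := z)
    have hinv : (((q ^ w : ℝ) : ℂ))⁻¹ = ((q ^ (-w) : ℝ) : ℂ) := by
      rw [Real.rpow_neg hq.1.le]; push_cast; rfl
    have hpow : ((q ^ w : ℝ) : ℂ) ^ y = ((q ^ (w * y) : ℝ) : ℂ) := by
      rw [Real.rpow_mul hq.1.le, Real.rpow_natCast]; push_cast; rfl
    have hneg : ((q ^ (y * (y + r + l - N)) : ℝ) : ℂ)⁻¹ = ((q ^ (-(y * (y + r + l - N))) : ℝ) : ℂ) := by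
      rw [Real.rpow_neg hq.1.le]; push_cast; rfl
    simp only [Pi.div_apply, qSiteDuality]
    rw [hs (r + l - N + 1) 1 _ (by push_cast; ring), hs (2 * y - r + l - N + 1) 0 _ (by push_cast; ring),
      hs (y * (y + r + l - N)) y _ (by push_cast; ring),
      hs (-2 * x - r + l + N + 1) 0 _ (by push_cast; ring),
      hs (r + l - N - 1) 1 _ (by push_cast; ring), hs (r - l - N - 1) 0 _ (by push_cast; ring),
      hs (-2 * N - 2) 0 _ (by push_cast; ring), hs (2 * l) 1 _ (by push_cast; ring), hinv, hpow]
    simp only [zpow_one, zpow_zero, zpow_natCast, one_mul, neg_mul, neg_neg, mul_neg,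
      rpow_add_ofReal hq.1]
    rw [sub_eq_add_neg (w * y), ← rpow_add_ofReal hq.1, ← hneg]
    have e1 : ((-1 : ℂ) ^ y)⁻¹ = (-1) ^ y := by rw [← inv_pow]; norm_num
    simp only [div_eq_mul_inv, mul_inv, inv_inv, e1, pow_add]
    have hux := pow_ne_zero x hu
    have huy := pow_ne_zero y hu
    generalize (1 - (q : ℂ) ^ 2) ^ x = ux at hux ⊢
    generalize (1 - (q : ℂ) ^ 2) ^ y = uy at huy ⊢
    field_simp

section products
variable {M : ℕ} {N : Fin M → ℕ}

lemma heightL_add_ofReal (lam : ℝ) (c : ℂ) (ζ : Config N) (i : ℕ) :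
    heightL ((lam : ℂ) + c) ζ i = ((heightL lam ζ i : ℝ) : ℂ) + c := by
  simp only [heightL]
  push_cast [apply_ite]
  ring

lemma heightR_add_ofReal (rho : ℝ) (c : ℂ) (ξ : Config N) (i : ℕ) :
    heightR ((rho : ℂ) + c) ξ i = ((heightR rho ξ i : ℝ) : ℂ) + c := by
  simp only [heightR]
  push_cast [apply_ite]
  ring

theorem tendsto_qDuality {lam rho v : ℝ} (hv : DualityDefined N lam rho v) (ζ ξ : Config N) :
    Filter.Tendsto (fun q : ℝ => ((1 - (q : ℂ) ^ 2) ^ capacity N)⁻¹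
        * qDuality (shift q lam) (shift q rho) ((q ^ v : ℝ) : ℂ) q ζ ξ)
      (𝓝[≠] (1 : ℝ)) (𝓝 (((-1) ^ particles ζ * duality lam rho v ζ ξ : ℝ) : ℂ)) := by
  have e : ((-1) ^ particles ζ * duality lam rho v ζ ξ : ℝ) = ∏ k : Fin M, ((-1) ^ (ζ k : ℕ)
      * siteDuality (ζ k) (ξ k) (heightL lam ζ k) (heightR rho ξ (k + 1)) v (N k)) := by
    rw [Finset.prod_mul_distrib, Finset.prod_pow_eq_pow_sum]; rfl
  rw [e, Complex.ofReal_prod]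
  refine (tendsto_finsetProd Finset.univ fun k _ => ?_).congr
    (f₁ := fun q : ℝ => ∏ k, ((1 - (q : ℂ) ^ 2) ^ N k)⁻¹ * qSiteDuality (ζ k) (ξ k)
      (((heightL lam ζ k : ℝ) : ℂ) + Complex.I * Real.pi / (2 * (Real.log q : ℂ)))
      (((heightR rho ξ (k + 1) : ℝ) : ℂ) + Complex.I * Real.pi / (2 * (Real.log q : ℂ)))
      ((q ^ v : ℝ) : ℂ) (N k) q) fun q => ?_
  · obtain ⟨h1, h2, h3⟩ := hv ζ ξ k
    rw [min_comm] at h1 h2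
    exact tendsto_qSiteDuality ((min_le_right _ _).trans (Nat.lt_succ_iff.1 (ζ k).isLt)) h1 h2
      h3 fun q => qpow_two_mul_quarter_period
  · simp only [Finset.prod_mul_distrib, Finset.prod_inv_distrib, Finset.prod_pow_eq_pow_sum,
      qDuality, shift, heightL_add_ofReal, heightR_add_ofReal, capacity]

theorem tendsto_qWeightR {rho : ℝ} (h : WeightDefined N rho) (ξ : Config N) :
    Filter.Tendsto (fun q : ℝ => (1 - (q : ℂ) ^ 2) ^ capacity N * qWeightR (shift q rho) q ξ)
      (𝓝[≠] (1 : ℝ)) (𝓝 ((weightR rho ξ : ℝ) : ℂ)) := by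
  rw [weightR, Complex.ofReal_prod]
  refine (tendsto_finsetProd Finset.univ fun k _ => tendsto_qSiteWeight
    (Nat.lt_succ_iff.1 (ξ k).isLt) (h.siteRegularR ξ k)
    fun q => qpow_two_mul_quarter_period).congr fun q => ?_
  simp only [Finset.prod_mul_distrib, Finset.prod_pow_eq_pow_sum, qWeightR, shift,
    heightR_add_ofReal, capacity]

lemma tendsto_inv_punctured_one :
    Filter.Tendsto (fun q : ℝ => q⁻¹) (𝓝[≠] 1) (𝓝[≠] 1) := by
  refine tendsto_nhdsWithin_iff.2 ⟨?_, ?_⟩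
  · have := (continuousAt_inv₀ (one_ne_zero (α := ℝ))).tendsto
    rw [inv_one] at this
    exact this.mono_left nhdsWithin_le_nhds
  · filter_upwards [eventually_pos_ne_one] with q hq
    exact fun h => hq.2 (inv_eq_one.1 h)

/-- From the limit at `q⁻¹` and `1 - q^2 = -q^2 * (1 - q⁻¹^2)`, whose `N`-th power gives the sign
`(-1)^N`. -/
lemma tendsto_qSiteWeight_inv {x N : ℕ} {r : ℝ} (hx : x ≤ N) (h : SiteRegular x N r) :
    Filter.Tendsto (fun q : ℝ => (1 - (q : ℂ) ^ 2) ^ N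
        * qSiteWeight x N (r + Complex.I * Real.pi / (2 * (Real.log q : ℂ))) q⁻¹) (𝓝[≠] 1)
      (𝓝 (((-1) ^ N * siteWeight x N r : ℝ) : ℂ)) := by
  have h1 := (tendsto_qSiteWeight hx h fun q => qpow_inv_two_mul_quarter_period).comp
    tendsto_inv_punctured_one
  have h2 := ((tendsto_sq_pow 1).neg).pow N
  convert (h2.mul h1).congr' ?_ using 2
  · push_cast; ring
  · filter_upwards [eventually_pos_ne_one] with q hq
    have hq0 : (q : ℂ) ≠ 0 := by exact_mod_cast hq.1.ne'
    simp only [Function.comp_apply, inv_inv, pow_one]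
    rw [← mul_assoc, ← mul_pow]
    congr 2
    push_cast
    field_simp
    ring

theorem tendsto_qWeightL {lam : ℝ} (h : WeightDefined N lam) (ζ : Config N) :
    Filter.Tendsto (fun q : ℝ => (1 - (q : ℂ) ^ 2) ^ capacity N * qWeightL (shift q lam) q ζ)
      (𝓝[≠] (1 : ℝ)) (𝓝 ((weightL lam ζ : ℝ) : ℂ)) := by
  rw [weightL, Complex.ofReal_prod]
  refine (tendsto_finsetProd Finset.univ fun k _ => tendsto_qSiteWeight_inv
    (Nat.lt_succ_iff.1 (ζ k).isLt) (h.siteRegularL ζ k)).congr fun q => ?_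
  simp only [Finset.prod_mul_distrib, Finset.prod_pow_eq_pow_sum, qWeightL, shift,
    heightL_add_ofReal, capacity]

end products

end DynSSEP

theorem proposition5p3 {M : ℕ} (N : Fin M → ℕ) (hN : ∀ k, 0 < N k) (lam rho v : ℝ)
    (hv : DualityDefined N lam rho v) :
    -- the duality function is, up to the sign `(-1)^|ζ|`, the limit of the q-Racah duality function
    (∀ ζ ξ : Config N,
      Filter.Tendsto
        (fun q : ℝ => ((1 - (q : ℂ) ^ 2) ^ capacity N)⁻¹
          * qDuality (shift q lam) (shift q rho) ((q ^ v : ℝ) : ℂ) q ζ ξ)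
        (𝓝[≠] (1 : ℝ)) (𝓝 (((-1) ^ particles ζ * duality lam rho v ζ ξ : ℝ) : ℂ))) ∧
    -- duality
    (RatesDefinedL N lam → RatesDefinedR N rho →
      IsDuality (generatorL N lam) (generatorR N rho) (duality lam rho v)) ∧
    -- the weights of the two processes: limits of the q-weights, nonzero, reversible
    (WeightDefined N lam →
      (∀ ζ : Config N,
        Filter.Tendsto (fun q : ℝ => (1 - (q : ℂ) ^ 2) ^ capacity N * qWeightL (shift q lam) q ζ)
          (𝓝[≠] (1 : ℝ)) (𝓝 ((weightL lam ζ : ℝ) : ℂ)) ∧ weightL lam ζ ≠ 0) ∧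
      IsReversible (generatorL N lam) (weightL lam)) ∧
    (WeightDefined N rho →
      (∀ ξ : Config N,
        Filter.Tendsto (fun q : ℝ => (1 - (q : ℂ) ^ 2) ^ capacity N * qWeightR (shift q rho) q ξ)
          (𝓝[≠] (1 : ℝ)) (𝓝 ((weightR rho ξ : ℝ) : ℂ)) ∧ weightR rho ξ ≠ 0) ∧
      IsReversible (generatorR N rho) (weightR rho)) ∧
    -- biorthogonality
    (WeightDefined N lam → WeightDefined N rho → DualityDefined N lam rho (-v) →
      (∀ ξ ξ' : Config N,
        ∑ ζ : Config N, duality lam rho v ζ ξ * duality lam rho (-v) ζ ξ' * weightL lam ζ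
          = (if ξ = ξ' then 1 else 0) / weightR rho ξ) ∧
      (∀ ζ ζ' : Config N,
        ∑ ξ : Config N, duality lam rho v ζ ξ * duality lam rho (-v) ζ' ξ * weightR rho ξ
          = (if ζ = ζ' then 1 else 0) / weightL lam ζ)) := by
  refine ⟨tendsto_qDuality hv, isDuality_duality hN hv,
    fun hL => ⟨fun ζ => ⟨tendsto_qWeightL hL ζ, hL.weightL_ne_zero ζ⟩, isReversible_weightL hN hL⟩,
    fun hR => ⟨fun ξ => ⟨tendsto_qWeightR hR ξ, hR.weightR_ne_zero ξ⟩, isReversible_weightR hN hR⟩,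
    fun hL hR hv' => ⟨duality_orthogonal hL hR hv hv', ?_⟩⟩
  exact dual_orthogonal hL.weightL_ne_zero hR.weightR_ne_zero (duality_orthogonal hL hR hv hv')
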